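/- Let $G$ be a finite group. A two-dimensional spin system $\mathcal A=\bigotimes_{j\in\mathbb Z^2}\mathcal A_j$ assigns to each site $j\in\mathbb Z^2$ a nonzero finite-dimensional Hilbert space $\mathcal H_j$ with $\sup_j\dim\mathcal H_j<\infty$; $\mathcal A_j=\mathrm{End}(\mathcal H_j)$, $\mathcal A$ is the quasi-local $C^*$-algebra, and $\mathcal A_X\subset\mathcal A$ is the subalgebra of observables supported on $X\subset\mathbb Z^2$. The stack $\mathcal A\otimes\mathcal A'$ has on-site algebras $\mathcal A_j\otimes\mathcal A'_j$. Automorphisms and isomorphisms are $*$-automorphisms and $*$-isomorphisms. An automorphism $\alpha$ has range at most $r$ if $\alpha(\mathcal A_X)\subset\mathcal A_{X^{(r)}}$ for every $X\subset\mathbb Z^2$, where $X^{(r)}$ is the set of sites at distance at most $r$ from $X$. A block partitioned automorphism is $\bigotimes_a\mathrm{Ad}\,V_a$ with unitary gates $V_a\in\mathcal A_{B_a}$, where the rectangles $B_a$ form a partition of $\mathbb Z^2$ and have uniformly bounded cardinality. A finite depth quantum circuit (FDQC) is a finite composition of such automorphisms (its layers). An on-site symmetry is an action $\beta_g=\bigotimes_j\mathrm{Ad}\,U_j(g)$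 of $G$ on $\mathcal A$, with each $U_j$ a unitary representation of $G$ on $\mathcal H_j$. A symmetric entangler $(\alpha,\beta,\mathcal A)$ consists of an FDQC $\alpha$ and an on-site symmetry $\beta$ on $\mathcal A$ with $\alpha\circ\beta_g=\beta_g\circ\alpha$ for all $g\in G$. A symmetric entangler $(\alpha,\beta,\mathcal A)$ is striped if there are pairwise disjoint integer intervals $(I_i)_{i\in\mathbb Z}$ of uniformly bounded size and FDQCs $\alpha_{I_i}$ on $\mathcal A$ of uniformly bounded range, each representable by a circuit whose gates all lie in $\mathcal A_{I_i\times\mathbb Z}$, such that $\alpha=\bigotimes_i\alpha_{I_i}$, i.e. $\alpha$ agrees with $\alpha_{I_i}$ on $\mathcal A_{I_i\times\mathbb Z}$ for every $i$ and is the identity on observables supported outside all the strips $I_i\times\mathbb Z$. Two symmetric entanglers $(\alpha,\beta,\mathcal A)$ and $(\alpha',\beta,\mathcal A)$ are equivalent if $\alpha\circ\gamma=\alpha'$ for some FDQC $\gamma$ that can be written as a circuit all of whose gates $V$ satisfy $\beta_g(V)=V$ for all $g\in G$. Two symmetric entanglers $(\alpha,\beta,\mathcal A)$ and $(\alpha',\beta',\mathcal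 A')$ are stably equivalent if there are on-site symmetries $(\tilde\beta,\tilde{\mathcal A})$ and $(\tilde\beta',\tilde{\mathcal A}')$ such that $(\alpha\otimes\mathrm{id},\beta\otimes\tilde\beta,\mathcal A\otimes\tilde{\mathcal A})$ and $(\alpha'\otimes\mathrm{id},\beta'\otimes\tilde\beta',\mathcal A'\otimes\tilde{\mathcal A}')$ are equivalent after identifying the two stacked systems by some $G$-equivariant isomorphism that maps the on-site algebra at each site onto the on-site algebra at the same site. Lemma. Any two striped symmetric entanglers in 2d (on possibly different spin systems, with possibly different on-site symmetries) are stably equivalent. In particular, any striped symmetric entangler $(\alpha,\beta,\mathcal A)$ is stably equivalent to $(\mathrm{id},\beta,\mathcal A)$. -/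

import Mathlib

noncomputable section

namespace SpinSys

/-! ### Amplification of operators on `ℓ²` spaces -/

/-- The Hilbert space `ℓ²(X)`. -/
abbrev Ell2 (X : Type) : Type := lp (fun _ : X => ℂ) 2

section Amplify

variable {X Y Z : Type}

theorem ell2_summable (f : Ell2 X) : Summable fun x => ‖f x‖ ^ 2 := by
  have h := (lp.hasSum_norm (p := 2) (by norm_num) f).summable
  simpa using h

theorem ell2_norm_sq (f : Ell2 X) : ‖f‖ ^ 2 = ∑' x, ‖f x‖ ^ 2 := by
  have h := lp.norm_rpow_eq_tsum (p := 2) (by norm_num) f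
  simpa using h

theorem ell2_mem {f : X → ℂ} (h : Summable fun x => ‖f x‖ ^ 2) : Memℓp f 2 :=
  memℓp_gen (by simpa using h)

/-- The slice `x ↦ Φ (x, y)` of a vector `Φ ∈ ℓ²(Z)`, where `Z ≃ X × Y`. -/
def slice (e : Z ≃ X × Y) (y : Y) (Φ : Ell2 Z) : Ell2 X :=
  ⟨fun x => Φ (e.symm (x, y)), ell2_mem <|
    (ell2_summable Φ).comp_injective (i := fun x => e.symm (x, y)) fun a b h => by
      simpa using h⟩

theorem summable_prod_slice (e : Z ≃ X × Y) (Φ : Ell2 Z) :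
    Summable fun p : Y × X => ‖Φ (e.symm (p.2, p.1))‖ ^ 2 :=
  (ell2_summable Φ).comp_injective (i := fun p : Y × X => e.symm (p.2, p.1)) fun a b h => by
    have := e.symm.injective h
    simp only [Prod.mk.injEq] at this
    exact Prod.ext this.2 this.1

theorem summable_slice (e : Z ≃ X × Y) (Φ : Ell2 Z) :
    Summable fun y => ‖slice e y Φ‖ ^ 2 := by
  have h := (summable_prod_slice e Φ).prod
  refine h.congr fun y => ?_
  rw [ell2_norm_sq]; rfl

theorem tsum_slice (e : Z ≃ X × Y) (Φ : Ell2 Z) :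
    ∑' y, ‖slice e y Φ‖ ^ 2 = ‖Φ‖ ^ 2 := by
  rw [ell2_norm_sq Φ, ← ((Equiv.prodComm Y X).trans e.symm).tsum_eq]
  have h := (summable_prod_slice e Φ).tsum_prod
  refine Eq.trans ?_ h.symm
  refine tsum_congr fun y => ?_
  rw [ell2_norm_sq]; rfl

theorem summable_amplify (e : Z ≃ X × Y) (T : Ell2 X →L[ℂ] Ell2 X) (Φ : Ell2 Z) :
    Summable fun z => ‖T (slice e (e z).2 Φ) (e z).1‖ ^ 2 := by
  rw [← ((Equiv.prodComm Y X).trans e.symm).summable_iff]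
  refine (summable_prod_of_nonneg (fun _ => sq_nonneg _)).2 ⟨?_, ?_⟩
  · intro y
    simpa using ell2_summable (T (slice e y Φ))
  · have h : Summable fun y => ‖T (slice e y Φ)‖ ^ 2 := by
      refine Summable.of_nonneg_of_le (fun _ => sq_nonneg _) (fun y => ?_)
        ((summable_slice e Φ).mul_left (‖T‖ ^ 2))
      rw [← mul_pow]
      exact pow_le_pow_left₀ (norm_nonneg _) (T.le_opNorm _) 2
    refine h.congr fun y => ?_
    rw [ell2_norm_sq]
    simp

/-- The vector `(T ⊗ 1) Φ`. -/
def amplifyVec (e : Z ≃ X × Y) (T : Ell2 X →L[ℂ] Ell2 X) (Φ : Ell2 Z) : Ell2 Z :=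
  ⟨fun z => T (slice e (e z).2 Φ) (e z).1, ell2_mem (summable_amplify e T Φ)⟩

theorem slice_amplifyVec (e : Z ≃ X × Y) (T : Ell2 X →L[ℂ] Ell2 X) (Φ : Ell2 Z) (y : Y) :
    slice e y (amplifyVec e T Φ) = T (slice e y Φ) := by
  ext x
  simp [slice, amplifyVec]

theorem slice_add (e : Z ≃ X × Y) (y : Y) (Φ Ψ : Ell2 Z) :
    slice e y (Φ + Ψ) = slice e y Φ + slice e y Ψ := rfl

theorem slice_smul (e : Z ≃ X × Y) (y : Y) (c : ℂ) (Φ : Ell2 Z) :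
    slice e y (c • Φ) = c • slice e y Φ := rfl

theorem norm_amplifyVec_le (e : Z ≃ X × Y) (T : Ell2 X →L[ℂ] Ell2 X) (Φ : Ell2 Z) :
    ‖amplifyVec e T Φ‖ ≤ ‖T‖ * ‖Φ‖ := by
  refine le_of_sq_le_sq ?_ (by positivity)
  rw [mul_pow, ← tsum_slice e, ← tsum_slice e Φ, ← tsum_mul_left]
  refine Summable.tsum_le_tsum (fun y => ?_) (summable_slice e _)
    ((summable_slice e Φ).mul_left _)
  rw [slice_amplifyVec, ← mul_pow]
  exact pow_le_pow_left₀ (norm_nonneg _) (T.le_opNorm _) 2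

/-- The operator `T ⊗ 1` on `ℓ²(Z) = ℓ²(X) ⊗ ℓ²(Y)`, where `Z ≃ X × Y`. -/
def amplifyCLM (e : Z ≃ X × Y) (T : Ell2 X →L[ℂ] Ell2 X) : Ell2 Z →L[ℂ] Ell2 Z :=
  LinearMap.mkContinuous
    { toFun := amplifyVec e T
      map_add' := fun Φ Ψ => by
        ext z; simp [amplifyVec, slice_add]; rfl
      map_smul' := fun c Φ => by
        ext z; simp [amplifyVec, slice_smul] }
    ‖T‖ (norm_amplifyVec_le e T)

theorem amplifyCLM_apply (e : Z ≃ X × Y) (T : Ell2 X →L[ℂ] Ell2 X) (Φ : Ell2 Z) (z : Z) :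
    amplifyCLM e T Φ z = T (slice e (e z).2 Φ) (e z).1 := rfl

theorem slice_amplifyCLM (e : Z ≃ X × Y) (T : Ell2 X →L[ℂ] Ell2 X) (Φ : Ell2 Z) (y : Y) :
    slice e y (amplifyCLM e T Φ) = T (slice e y Φ) := slice_amplifyVec e T Φ y

theorem inner_eq_tsum_slice (e : Z ≃ X × Y) (Φ Ψ : Ell2 Z) :
    inner ℂ Φ Ψ = ∑' y, inner ℂ (slice e y Φ) (slice e y Ψ) := by
  rw [lp.inner_eq_tsum, ← ((Equiv.prodComm Y X).trans e.symm).tsum_eq]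
  have hs := (((Equiv.prodComm Y X).trans e.symm).summable_iff).2 (lp.summable_inner (𝕜 := ℂ) Φ Ψ)
  refine Eq.trans hs.tsum_prod ?_
  refine tsum_congr fun y => ?_
  rw [lp.inner_eq_tsum]; rfl

/-- `T ↦ T ⊗ 1` as a unital `*`-homomorphism. -/
def amplify (e : Z ≃ X × Y) : (Ell2 X →L[ℂ] Ell2 X) →⋆ₐ[ℂ] (Ell2 Z →L[ℂ] Ell2 Z) where
  toFun := amplifyCLM e
  map_one' := by
    ext Φ z
    simp [amplifyCLM_apply, slice]
  map_mul' S T := by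
    ext Φ z
    simp [amplifyCLM_apply, slice_amplifyCLM]
  map_zero' := by
    ext Φ z
    simp [amplifyCLM_apply]
  map_add' S T := by
    ext Φ z
    simp [amplifyCLM_apply]
  commutes' c := by
    ext Φ z
    simp [amplifyCLM_apply, Algebra.algebraMap_eq_smul_one, slice]
  map_star' T := by
    rw [ContinuousLinearMap.star_eq_adjoint, ContinuousLinearMap.star_eq_adjoint,
      ContinuousLinearMap.eq_adjoint_iff]
    intro Φ Ψ
    rw [inner_eq_tsum_slice e, inner_eq_tsum_slice e]
    refine tsum_congr fun y => ?_
    rw [slice_amplifyCLM, slice_amplifyCLM, ContinuousLinearMap.adjoint_inner_left]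

/-- A complex matrix as an operator on the finite-dimensional Hilbert space `ℓ²(X)`. -/
def matrixOp (X : Type) [Fintype X] [DecidableEq X] :
    Matrix X X ℂ ≃⋆ₐ[ℂ] (Ell2 X →L[ℂ] Ell2 X) :=
  (Matrix.toEuclideanCLM (n := X) (𝕜 := ℂ)).trans
    (lpPiLpₗᵢ (p := 2) (fun _ : X => ℂ) ℂ).symm.conjStarAlgEquiv

theorem matrixOp_apply [Fintype X] [DecidableEq X] (M : Matrix X X ℂ) (f : Ell2 X) (x : X) :
    matrixOp X M f x = ∑ k, M x k * f k := rfl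

end Amplify

/-! ### Spin systems on `ℤ²` and their quasi-local algebras -/

/-- The sites of the two-dimensional lattice. -/
abbrev Site : Type := ℤ × ℤ

/-- A two-dimensional spin system: to every site `j` is assigned a finite-dimensional nonzero
on-site Hilbert space, given by a finite orthonormal basis labelled by `idx j`, so that the
on-site algebra is `Matrix (idx j) (idx j) ℂ`; the on-site dimensions are uniformly bounded. -/
structure SpinSystem where
  idx : Site → Type
  [fintype : ∀ j, Fintype (idx j)]
  [decEq : ∀ j, DecidableEq (idx j)]
  [nonempty : ∀ j, Nonempty (idx j)]
  bounded : ∃ D : ℕ, ∀ j, Fintype.card (idx j) ≤ D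

attribute [instance] SpinSystem.fintype SpinSystem.decEq SpinSystem.nonempty

namespace SpinSystem

/-- The classical configurations of a spin system. -/
abbrev Config (S : SpinSystem) : Type := ∀ j, S.idx j

/-- The algebra of bounded operators on `ℓ²` of the set of all configurations. It serves as the
ambient algebra in which the quasi-local algebra is realized. -/
abbrev Op (S : SpinSystem) : Type := Ell2 S.Config →L[ℂ] Ell2 S.Config

/-- The on-site matrix `M` at the site `j`, tensored with the identity at all other sites. -/
def siteOp (S : SpinSystem) (j : Site) : Matrix (S.idx j) (S.idx j) ℂ →⋆ₐ[ℂ] S.Op :=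
  (amplify (Equiv.piSplitAt j S.idx)).comp
    (matrixOp (S.idx j) : Matrix (S.idx j) (S.idx j) ℂ →⋆ₐ[ℂ] _)

theorem siteOp_apply (S : SpinSystem) (j : Site) (M : Matrix (S.idx j) (S.idx j) ℂ)
    (Φ : Ell2 S.Config) (ω : S.Config) :
    S.siteOp j M Φ ω = ∑ k, M (ω j) k * Φ (Function.update ω j k) := by
  have h : S.siteOp j M Φ ω =
      ∑ k, M (ω j) k * slice (Equiv.piSplitAt j S.idx) (Equiv.piSplitAt j S.idx ω).2 Φ k :=
    matrixOp_apply M _ (ω j)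
  rw [h]
  refine Finset.sum_congr rfl fun k _ => ?_
  refine congrArg (fun z => M (ω j) k * Φ z) ?_
  funext i
  simp only [Equiv.piSplitAt, Equiv.coe_fn_mk, Equiv.coe_fn_symm_mk]
  by_cases hi : i = j
  · subst hi; simp
  · simp [hi]

/-- The quasi-local algebra `𝒜 = ⨂ⱼ 𝒜ⱼ`. The matrix algebras of the finite regions act faithfully,
hence isometrically, and compatibly with the inclusions `A ↦ A ⊗ 1`, so that the norm closure of
the `*`-algebra generated by the on-site matrices is their C⋆-inductive limit. -/
def quasiLocal (S : SpinSystem) : StarSubalgebra ℂ S.Op :=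
  (StarAlgebra.adjoin ℂ (⋃ j, Set.range (S.siteOp j))).topologicalClosure

/-- The quasi-local algebra, as a type. -/
abbrev Alg (S : SpinSystem) : Type := S.quasiLocal

/-- The inclusion of the on-site algebra at `j` into the quasi-local algebra. -/
def site (S : SpinSystem) (j : Site) : Matrix (S.idx j) (S.idx j) ℂ →⋆ₐ[ℂ] S.Alg :=
  (S.siteOp j).codRestrict S.quasiLocal fun M =>
    StarSubalgebra.le_topologicalClosure _ <|
      StarAlgebra.subset_adjoin ℂ _ <| Set.mem_iUnion.2 ⟨j, M, rfl⟩

/-- The subalgebra `𝒜_X ⊆ 𝒜` of observables supported on `X`. -/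
def supp (S : SpinSystem) (X : Set Site) : StarSubalgebra ℂ S.Alg :=
  (StarAlgebra.adjoin ℂ (⋃ j ∈ X, Set.range (S.site j))).topologicalClosure

/-- The group of `*`-automorphisms of the quasi-local algebra; multiplication is composition. -/
abbrev Aut (S : SpinSystem) : Type := S.Alg ≃⋆ₐ[ℂ] S.Alg

/-! ### Stacking -/

/-- The stacked spin system, with on-site algebras `𝒜ⱼ ⊗ 𝒜'ⱼ`. -/
def stack (S T : SpinSystem) : SpinSystem where
  idx j := S.idx j × T.idx j
  bounded := by
    obtain ⟨D, hD⟩ := S.bounded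
    obtain ⟨D', hD'⟩ := T.bounded
    refine ⟨D * D', fun j => ?_⟩
    rw [Fintype.card_prod]
    exact Nat.mul_le_mul (hD j) (hD' j)

/-- A configuration of the stacked system is a pair of configurations. -/
def stackConfig (S T : SpinSystem) : (S.stack T).Config ≃ S.Config × T.Config :=
  Equiv.arrowProdEquivProdArrow Site S.idx T.idx

theorem amplify_siteOp_left (S T : SpinSystem) (j : Site) (M : Matrix (S.idx j) (S.idx j) ℂ) :
    amplify (S.stackConfig T) (S.siteOp j M) =
      (S.stack T).siteOp j (Matrix.kronecker M (1 : Matrix (T.idx j) (T.idx j) ℂ)) := by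
  ext Φ ω
  refine Eq.trans (S.siteOp_apply j M (slice (S.stackConfig T) (S.stackConfig T ω).2 Φ)
    (S.stackConfig T ω).1) (Eq.trans ?_ ((S.stack T).siteOp_apply j _ Φ ω).symm)
  refine Eq.trans ?_ (Fintype.sum_prod_type (α₁ := S.idx j) (α₂ := T.idx j) _).symm
  refine Finset.sum_congr rfl fun k _ => ?_
  have hk (l) : (Matrix.kronecker M (1 : Matrix (T.idx j) (T.idx j) ℂ)) (ω j) (k, l) =
      M (ω j).1 k * (1 : Matrix (T.idx j) (T.idx j) ℂ) (ω j).2 l := rfl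
  have hu : (S.stackConfig T).symm (Function.update (S.stackConfig T ω).1 j k, (S.stackConfig T ω).2) =
      Function.update ω j (k, (ω j).2) := by
    funext i
    by_cases hi : i = j
    · subst hi
      refine Eq.trans ?_ (Function.update_self i _ ω).symm
      exact Prod.ext (Function.update_self i k _) rfl
    · refine Eq.trans ?_ (Function.update_of_ne hi _ ω).symm
      exact Prod.ext (Function.update_of_ne hi k _) rfl
  refine Eq.trans ?_ (Finset.sum_eq_single (ω j).2 (fun l _ hl => ?_) (by simp)).symm
  · refine Eq.trans ?_ (congrArg (· * _) (hk _)).symm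
    rw [Matrix.one_apply_eq, mul_one, ← hu]
    rfl
  · refine (congrArg (· * _) (hk l)).trans ?_
    rw [Matrix.one_apply_ne hl.symm, mul_zero]
    exact zero_mul _

theorem amplify_siteOp_right (S T : SpinSystem) (j : Site) (M : Matrix (T.idx j) (T.idx j) ℂ) :
    amplify ((S.stackConfig T).trans (Equiv.prodComm _ _)) (T.siteOp j M) =
      (S.stack T).siteOp j (Matrix.kronecker (1 : Matrix (S.idx j) (S.idx j) ℂ) M) := by
  ext Φ ω
  refine Eq.trans (T.siteOp_apply j M (slice ((S.stackConfig T).trans (Equiv.prodComm _ _))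
    (S.stackConfig T ω).1 Φ) (S.stackConfig T ω).2)
    (Eq.trans ?_ ((S.stack T).siteOp_apply j _ Φ ω).symm)
  refine Eq.trans ?_ (Fintype.sum_prod_type_right (α₁ := S.idx j) (α₂ := T.idx j) _).symm
  refine Finset.sum_congr rfl fun k _ => ?_
  have hk (l) : (Matrix.kronecker (1 : Matrix (S.idx j) (S.idx j) ℂ) M) (ω j) (l, k) =
      (1 : Matrix (S.idx j) (S.idx j) ℂ) (ω j).1 l * M (ω j).2 k := rfl
  have hu : (S.stackConfig T).symm ((S.stackConfig T ω).1, Function.update (S.stackConfig T ω).2 j k) =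
      Function.update ω j ((ω j).1, k) := by
    funext i
    by_cases hi : i = j
    · subst hi
      refine Eq.trans ?_ (Function.update_self i _ ω).symm
      exact Prod.ext rfl (Function.update_self i k _)
    · refine Eq.trans ?_ (Function.update_of_ne hi _ ω).symm
      exact Prod.ext rfl (Function.update_of_ne hi k _)
  refine Eq.trans ?_ (Finset.sum_eq_single (ω j).1 (fun l _ hl => ?_) (by simp)).symm
  · refine Eq.trans ?_ (congrArg (· * _) (hk _)).symm
    rw [Matrix.one_apply_eq, one_mul, ← hu]
    rfl
  · refine (congrArg (· * _) (hk l)).trans ?_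
    rw [Matrix.one_apply_ne hl.symm, zero_mul]
    exact zero_mul _

theorem map_quasiLocal {S T : SpinSystem} (f : S.Op →⋆ₐ[ℂ] T.Op)
    (hf : ∀ j M, ∃ N, f (S.siteOp j M) = T.siteOp j N) (a : S.Alg) :
    f a ∈ T.quasiLocal := by
  have hle : S.quasiLocal ≤ T.quasiLocal.comap f := by
    refine StarSubalgebra.topologicalClosure_minimal ?_ ?_
    · refine StarAlgebra.adjoin_le ?_
      intro x hx
      obtain ⟨j, M, rfl⟩ := Set.mem_iUnion.1 hx
      obtain ⟨N, hN⟩ := hf j M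
      change f (S.siteOp j M) ∈ T.quasiLocal
      rw [hN]
      exact (T.site j N).2
    · exact (StarSubalgebra.isClosed_topologicalClosure _).preimage (map_continuous f)
  exact hle a.2

/-- The embedding `a ↦ a ⊗ 1` of the first layer into the stacked system. -/
def inl (S T : SpinSystem) : S.Alg →⋆ₐ[ℂ] (S.stack T).Alg :=
  ((amplify (S.stackConfig T)).comp S.quasiLocal.subtype).codRestrict _
    (map_quasiLocal _ fun j M => ⟨_, amplify_siteOp_left S T j M⟩)

/-- The embedding `b ↦ 1 ⊗ b` of the second layer into the stacked system. -/
def inr (S T : SpinSystem) : T.Alg →⋆ₐ[ℂ] (S.stack T).Alg :=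
  ((amplify ((S.stackConfig T).trans (Equiv.prodComm _ _))).comp
    T.quasiLocal.subtype).codRestrict _
    (map_quasiLocal _ fun j M => ⟨_, amplify_siteOp_right S T j M⟩)

theorem inl_site (S T : SpinSystem) (j : Site) (M : Matrix (S.idx j) (S.idx j) ℂ) :
    S.inl T (S.site j M) =
      (S.stack T).site j (Matrix.kronecker M (1 : Matrix (T.idx j) (T.idx j) ℂ)) :=
  Subtype.ext (amplify_siteOp_left S T j M)

theorem inr_site (S T : SpinSystem) (j : Site) (M : Matrix (T.idx j) (T.idx j) ℂ) :
    S.inr T (T.site j M) =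
      (S.stack T).site j (Matrix.kronecker (1 : Matrix (S.idx j) (S.idx j) ℂ) M) :=
  Subtype.ext (amplify_siteOp_right S T j M)

/-- `c` is the automorphism `a ⊗ b` of the stacked system. The images of `a ⊗ 1` and `1 ⊗ b`
generate, so `c` is determined by `a` and `b`. -/
def IsTensor {S T : SpinSystem} (a : S.Aut) (b : T.Aut) (c : (S.stack T).Aut) : Prop :=
  (∀ x, c (S.inl T x) = S.inl T (a x)) ∧ ∀ y, c (S.inr T y) = S.inr T (b y)

/-! ### Circuits -/

/-- The `r`-fattening of a region. -/
def fatten (X : Set Site) (r : ℕ) : Set Site := {j | ∃ k ∈ X, dist j k ≤ r}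

/-- `α` is a quantum cellular automaton of range at most `r`. -/
def RangeLE {S : SpinSystem} (α : S.Aut) (r : ℕ) : Prop :=
  ∀ (X : Set Site), ∀ x ∈ S.supp X, α x ∈ S.supp (fatten X r)

/-- `γ = ⨂ₐ Ad Vₐ` is a block partitioned automorphism with unitary gates `Vₐ` in the set `P`,
where the blocks `Iₐ = [lo a, hi a]` (rectangles, as `≤` is the product order) form a partition of
the lattice and have uniformly bounded cardinality. Prescribing `γ` on each `𝒜_{Iₐ}` determines it.
-/
def IsLayer {S : SpinSystem} (P : Set S.Alg) (γ : S.Aut) : Prop :=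
  ∃ (ι : Type) (lo hi : ι → Site) (V : ι → S.Alg),
    (∀ a, lo a ≤ hi a) ∧
    (∀ x, ∃! a, x ∈ Set.Icc (lo a) (hi a)) ∧
    (∃ N : ℕ, ∀ a, (Set.Icc (lo a) (hi a)).ncard ≤ N) ∧
    ∀ a, V a ∈ unitary S.Alg ∧ V a ∈ S.supp (Set.Icc (lo a) (hi a)) ∧ V a ∈ P ∧
      ∀ x ∈ S.supp (Set.Icc (lo a) (hi a)), γ x = V a * x * star (V a)

/-- `γ` is a finite composition of block partitioned automorphisms all of whose gates lie in the
set `P`. -/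
def IsCircuit {S : SpinSystem} (P : Set S.Alg) (γ : S.Aut) : Prop :=
  ∃ L : List S.Aut, (∀ l ∈ L, IsLayer P l) ∧ L.prod = γ

/-- `γ` is a finite depth quantum circuit. -/
def IsFDQC {S : SpinSystem} (γ : S.Aut) : Prop := IsCircuit Set.univ γ

end SpinSystem

open SpinSystem

/-! ### Symmetric entanglers -/

/-- An on-site symmetry `β_g = ⨂ⱼ Ad (Uⱼ g)`, where each `Uⱼ` is a (linear) unitary
representation of `G` on the on-site Hilbert space. -/
structure OnSiteSymmetry (G : Type*) [Group G] (S : SpinSystem) where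
  toHom : G →* S.Aut
  onSite : ∃ U : ∀ j, G →* Matrix.unitaryGroup (S.idx j) ℂ, ∀ g j M,
    toHom g (S.site j M) =
      S.site j ((U j g : Matrix (S.idx j) (S.idx j) ℂ) * M * star (U j g : Matrix _ _ ℂ))

/-- A symmetric entangler `(α, β, 𝒜)`: a finite depth quantum circuit `α` on `𝒜` that is
equivariant with respect to an on-site symmetry `β`. -/
structure SymmetricEntangler (G : Type*) [Group G] (S : SpinSystem) where
  α : S.Aut
  β : OnSiteSymmetry G S
  fdqc : IsFDQC α
  equivariant : ∀ g, α * β.toHom g = β.toHom g * α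

/-- The symmetric entangler `(id, β, 𝒜)`. -/
def OnSiteSymmetry.idEntangler {G : Type*} [Group G] {S : SpinSystem} (β : OnSiteSymmetry G S) :
    SymmetricEntangler G S where
  α := 1
  β := β
  fdqc := ⟨[], by simp, rfl⟩
  equivariant g := by rw [one_mul, mul_one]

namespace SymmetricEntangler

variable {G : Type*} [Group G]

/-- `γ` is a finite depth quantum circuit with symmetric gates. -/
def IsSymmetricCircuit {S : SpinSystem} (β : OnSiteSymmetry G S) (γ : S.Aut) : Prop :=
  IsCircuit {V | ∀ g, β.toHom g V = V} γ

/-- `F` is the stack `(α ⊗ α', β ⊗ β', 𝒜 ⊗ 𝒜')` of `E = (α, β, 𝒜)` and `E' = (α', β', 𝒜')`. -/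
def IsStack {S T : SpinSystem} (E : SymmetricEntangler G S) (E' : SymmetricEntangler G T)
    (F : SymmetricEntangler G (S.stack T)) : Prop :=
  IsTensor E.α E'.α F.α ∧ ∀ g, IsTensor (E.β.toHom g) (E'.β.toHom g) (F.β.toHom g)

/-- Equivalence of symmetric entanglers, `α ∘ γ = α'` for some circuit `γ` with symmetric gates.
The two spin systems with symmetry are identified through an equivariant isomorphism `Φ` of the
quasi-local algebras that maps each on-site algebra onto the on-site algebra at the same site. -/
def Equivalent {S S' : SpinSystem} (E : SymmetricEntangler G S) (E' : SymmetricEntangler G S') :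
    Prop :=
  ∃ Φ : S.Alg ≃⋆ₐ[ℂ] S'.Alg,
    (∀ j, Φ '' Set.range (S.site j) = Set.range (S'.site j)) ∧
    (∀ g x, Φ (E.β.toHom g x) = E'.β.toHom g (Φ x)) ∧
    ∃ γ : S.Aut, IsSymmetricCircuit E.β γ ∧ ∀ x, Φ (E.α (γ x)) = E'.α (Φ x)

/-- Stable equivalence: equivalence after stacking with identities on auxiliary spin systems that
carry on-site symmetries. -/
def StablyEquivalent {S S' : SpinSystem} (E : SymmetricEntangler G S)
    (E' : SymmetricEntangler G S') : Prop :=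
  ∃ (T T' : SpinSystem) (δ : OnSiteSymmetry G T) (δ' : OnSiteSymmetry G T')
    (F : SymmetricEntangler G (S.stack T)) (F' : SymmetricEntangler G (S'.stack T')),
    IsStack E δ.idEntangler F ∧ IsStack E' δ'.idEntangler F' ∧ Equivalent F F'

/-- The vertical strip `[m, n] × ℤ`. -/
def strip (m n : ℤ) : Set Site := {x | m ≤ x.1 ∧ x.1 ≤ n}

/-- `E = (α, β, 𝒜)` is a striped symmetric entangler: `α = ⨂ᵢ αᵢ`, where the `αᵢ` are finite depth
quantum circuits of uniformly bounded range whose gates are supported on the strips `Iᵢ × ℤ`, for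
pairwise disjoint intervals `Iᵢ = [m i, n i]` of uniformly bounded size. The product acts as `αᵢ`
on the `i`-th strip, and trivially outside the strips. -/
def IsStriped {S : SpinSystem} (E : SymmetricEntangler G S) : Prop :=
  ∃ (m n : ℤ → ℤ) (a : ℤ → S.Aut),
    (Pairwise fun i k => Disjoint (Set.Icc (m i) (n i)) (Set.Icc (m k) (n k))) ∧
    (∃ N : ℕ, ∀ i, (Set.Icc (m i) (n i)).ncard ≤ N) ∧
    (∃ r : ℕ, ∀ i, RangeLE (a i) r) ∧
    (∀ i, IsCircuit (S.supp (strip (m i) (n i))) (a i)) ∧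
    (∀ i, ∀ x ∈ S.supp (strip (m i) (n i)), E.α x = a i x) ∧
    ∀ x ∈ S.supp ((⋃ i, strip (m i) (n i))ᶜ), E.α x = x

end SymmetricEntangler

end SpinSys

end

/-!
# Striped symmetric entanglers are stably trivial

It suffices to show that a striped symmetric entangler `(α, β)`, stacked with an ancilla that
carries the regular representation of `G` at every site, is a circuit with symmetric gates
(`IsStriped.isSymmetricCircuit`). Two striped entanglers `E` and `E'` on `S` and `S'` then become
equivalent after stacking `E` with `S' ⊗ ℂ[G]` and `E'` with `S ⊗ ℂ[G]`, since both become symmetric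
circuits and the two stacks are identified by exchanging the factors.

*Cutting a strip.* On a strip, `α` is a one-dimensional circuit of some range `r`. At the heights
`2rk` it can be cut by unitaries `W k` supported within distance `r` of the cut (`exists_cut`): after
the conjugation by all `W k`, what remains is a product of conjugations by unitaries `X k` supported
between consecutive cuts. As `α` is symmetric, `W k · β_g(W k)⁻¹ = p_g q_g` with `p_g` below and
`q_g` above the cut. The families `p` and `q` are projective, with a cocycle `ω` and its inverse
(`exists_cocycle`). The unitary `X k` links the two ends of its block, so that after a change of the
phases of `p` and `q` the cocycle is the same at all cuts (`exists_stripData`). The class of `ω` may be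
nontrivial, and then the cutting unitaries cannot be made symmetric within the strip.

*Controlled unitaries.* The ancilla provides projections `e_h` permuted by `G`, and with them the
controlled unitaries `∑ e_h w(h)`. The symmetrization `∑ e_h β_h(W k)` of `W k` differs from `W k` by
the controlled unitaries of `p⁻¹` and `q⁻¹` (`Control.symm_eq`). These are absorbed into the `X k`,
at the price of a charge of the cocycle `ω` at both ends. A link unitary
`∑ ω(h, h⁻¹h') e_h ⊗ e_{h'}` between two consecutive cuts carries the opposite charges
(`Control.act_link`), so that `Control.dressed` is symmetric. Altogether, `α` is a product of
symmetric gates and of all links along the strips (`eq_prod`).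

*Removing the links.* The product of the links around a plaquette is symmetric, because its charges
cancel (`Control.act_plaquette`). Let `n x` be cocycles with `n x = ω x * n (x - 1)`, where `ω x` is
the cocycle of the strip with left end `x`, and `1` if there is none. They exist because the line of
columns is infinite: the anomalies of the strips are pumped to infinity. In the product of the
plaquettes of `n x` between the columns `x` and `x + 1`, horizontal links cancel, and the vertical
links on the column `x` add up to `n x / n (x - 1) = ω x` (`exists_prod_P`). So the product of all
links along the strips is a circuit with symmetric gates.

The infinite products of commuting inner automorphisms are pointwise limits over the finite subsets
(`IsInfProd`). The local unitaries come from the Skolem–Noether theorem for the matrix algebras of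
finite regions (`exists_unitary_conj`), and their supports are controlled by the commutants of the
on-site algebras (`mem_supp_diff`).
-/

noncomputable section

open scoped CStarAlgebra Kronecker

namespace SpinSys

/-! ### Matrix units -/

section MatrixUnits

variable {ι A : Type*} [Fintype ι] [Ring A]

/-- A system of matrix units `e a b = |a⟩⟨b|` in a ring. -/
structure IsMatrixUnits (e : ι → ι → A) : Prop where
  mul_same : ∀ a b c, e a b * e b c = e a c
  mul_of_ne : ∀ a c {b b'}, b ≠ b' → e a b * e b' c = 0
  sum_eq_one : ∑ a, e a a = 1

/-- The `(a, b)` coefficient of `x` with respect to the matrix units `e`: with these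
coefficients `x = ∑ e_{ab} x_{ab}`, and all `x_{ab}` commute with the matrix units. -/
def coeff (e : ι → ι → A) (x : A) (a b : ι) : A := ∑ c, e c a * x * e b c

variable {e : ι → ι → A}

theorem IsMatrixUnits.sum_mul_coeff (he : IsMatrixUnits e) (x : A) :
    ∑ a, ∑ b, e a b * coeff e x a b = x := by
  have h (a b : ι) : e a b * coeff e x a b = e a a * x * e b b := by
    rw [coeff, Finset.mul_sum, Finset.sum_eq_single b]
    · rw [← mul_assoc, ← mul_assoc, he.mul_same]
    · intro c _ hc
      rw [← mul_assoc, ← mul_assoc, he.mul_of_ne a a hc.symm, zero_mul, zero_mul]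
    · simp
  simp_rw [h]
  simp_rw [← Finset.mul_sum, he.sum_eq_one, mul_one, ← Finset.sum_mul, he.sum_eq_one, one_mul]

theorem IsMatrixUnits.coeff_mul (he : IsMatrixUnits e) (x y : A) (a b : ι) :
    coeff e (x * y) a b = ∑ d, coeff e x a d * coeff e y d b := by
  have h (d : ι) : coeff e x a d * coeff e y d b =
      ∑ c, e c a * x * e d d * (y * e b c) := by
    rw [coeff, coeff, Finset.sum_mul]
    refine Finset.sum_congr rfl fun c _ => ?_
    rw [Finset.mul_sum, Finset.sum_eq_single c]
    · rw [← he.mul_same d c d]; simp only [mul_assoc]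
    · intro c' _ hc
      calc _ = e c a * x * (e d c * e c' d) * (y * e b c') := by
            simp only [mul_assoc]
        _ = 0 := by rw [he.mul_of_ne d d hc.symm, mul_zero, zero_mul]
    · simp
  simp_rw [h]
  rw [Finset.sum_comm, coeff]
  refine Finset.sum_congr rfl fun c _ => ?_
  rw [← Finset.sum_mul, ← Finset.mul_sum, he.sum_eq_one, mul_one]
  simp only [mul_assoc]

theorem IsMatrixUnits.coeff_of_commute [DecidableEq ι] (he : IsMatrixUnits e) {x : A}
    (h : ∀ a b, Commute x (e a b)) (a b : ι) : coeff e x a b = if a = b then x else 0 := by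
  have h1 (c : ι) : e c a * x * e b c = x * (e c a * e b c) := by
    rw [← mul_assoc, (h c a).eq]
  rw [coeff]
  simp_rw [h1, ← Finset.mul_sum]
  split_ifs with hab
  · subst hab
    simp_rw [he.mul_same, he.sum_eq_one, mul_one]
  · rw [Finset.sum_eq_zero fun c _ => he.mul_of_ne c c hab, mul_zero]

theorem IsMatrixUnits.coeff_self [DecidableEq ι] (he : IsMatrixUnits e) (p q a b : ι) :
    coeff e (e p q) a b = if p = a ∧ q = b then 1 else 0 := by
  rw [coeff]
  split_ifs with h
  · obtain ⟨rfl, rfl⟩ := h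
    simp_rw [he.mul_same, he.sum_eq_one]
  · refine Finset.sum_eq_zero fun c _ => ?_
    by_cases h1 : p = a
    · have h2 : q ≠ b := fun h2 => h ⟨h1, h2⟩
      rw [mul_assoc, he.mul_of_ne p c h2, mul_zero]
    · rw [he.mul_of_ne c q (Ne.symm h1), zero_mul]

theorem isMatrixUnits_map_single {B : Type*} [Ring B] [Algebra ℂ B] {ι : Type*} [Fintype ι]
    [DecidableEq ι] (f : Matrix ι ι ℂ →ₐ[ℂ] B) :
    IsMatrixUnits fun a b => f (Matrix.single a b 1) where
  mul_same a b c := by simp [← map_mul]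
  mul_of_ne a c {b b'} h := by simp [← map_mul, h]
  sum_eq_one := by
    rw [← map_sum, show ∑ a, Matrix.single a a (1 : ℂ) = (1 : Matrix ι ι ℂ) from ?_, map_one]
    ext b c
    simp [Matrix.sum_apply, Matrix.single_apply, Matrix.one_apply, ite_and]

theorem coeff_star [StarRing A] (hs : ∀ a b, star (e a b) = e b a) (x : A) (a b : ι) :
    coeff e (star x) a b = star (coeff e x b a) := by
  simp only [coeff, star_sum, star_mul, hs, mul_assoc]

theorem coeff_add (x y : A) (a b : ι) : coeff e (x + y) a b = coeff e x a b + coeff e y a b := by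
  simp only [coeff, mul_add, add_mul, Finset.sum_add_distrib]

/-- If a subalgebra `Q` contains matrix units and the coefficients of its elements lie in a
subalgebra `P ⊆ Q` that commutes with them, then `Q` is the algebra of matrices over `P`. -/
theorem IsMatrixUnits.exists_algEquiv [Algebra ℂ A] [StarRing A] [StarModule ℂ A] [DecidableEq ι]
    (he : IsMatrixUnits e) {P Q : StarSubalgebra ℂ A} (hPQ : P ≤ Q) (heQ : ∀ a b, e a b ∈ Q)
    (hcomm : ∀ x ∈ P, ∀ a b, Commute x (e a b)) (hcoeff : ∀ x ∈ Q, ∀ a b, coeff e x a b ∈ P) :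
    Nonempty (Q ≃ₐ[ℂ] Matrix ι ι P) := by
  let f : Q →ₐ[ℂ] Matrix ι ι P := AlgHom.ofLinearMap
    { toFun := fun x => Matrix.of fun a b => ⟨coeff e x a b, hcoeff x x.2 a b⟩
      map_add' := fun x y => Matrix.ext fun a b => Subtype.ext (coeff_add (x : A) y a b)
      map_smul' := fun c x => Matrix.ext fun a b => Subtype.ext <| by
        simp [coeff, Finset.smul_sum] }
    (Matrix.ext fun a b => Subtype.ext <| by
      refine (he.coeff_of_commute (fun _ _ => Commute.one_left _) a b).trans ?_
      by_cases h : a = b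
      · subst h; simp
      · simp [h])
    (fun x y => Matrix.ext fun a b => Subtype.ext <| by
      refine (he.coeff_mul (x : A) y a b).trans ?_
      simp [Matrix.mul_apply])
  have hf (x : Q) (a b : ι) : (f x a b : A) = coeff e x a b := rfl
  refine ⟨AlgEquiv.ofBijective f ⟨fun x y h => Subtype.ext ?_, fun M => ?_⟩⟩
  · rw [← he.sum_mul_coeff (x : A), ← he.sum_mul_coeff (y : A)]
    refine Finset.sum_congr rfl fun a _ => Finset.sum_congr rfl fun b _ => ?_
    rw [← hf, h, hf]
  · refine ⟨∑ p, ∑ q, ⟨e p q * M p q, mul_mem (heQ p q) (hPQ (M p q).2)⟩, ?_⟩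
    refine Matrix.ext fun a b => Subtype.ext ?_
    simp only [map_sum, Matrix.sum_apply, AddSubmonoidClass.coe_finsetSum, hf]
    have h (p q : ι) : coeff e (e p q * (M p q : A)) a b =
        if p = a then if q = b then (M p q : A) else 0 else 0 := by
      rw [he.coeff_mul, Finset.sum_eq_single b, he.coeff_self,
        he.coeff_of_commute (hcomm _ (M p q).2), if_pos rfl]
      · by_cases h1 : p = a <;> by_cases h2 : q = b <;> simp [h1, h2]
      · intro d _ hd
        rw [he.coeff_of_commute (hcomm _ (M p q).2), if_neg hd, mul_zero]
      · simp
    simp [h]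

/-- The elements whose coefficients lie in a given subalgebra form a subalgebra. -/
def IsMatrixUnits.coeffMem [Algebra ℂ A] [StarRing A] [StarModule ℂ A] (he : IsMatrixUnits e)
    (hs : ∀ a b, star (e a b) = e b a) (P : StarSubalgebra ℂ A) : StarSubalgebra ℂ A where
  carrier := {x | ∀ a b, coeff e x a b ∈ P}
  mul_mem' hx hy a b := by
    rw [he.coeff_mul]; exact sum_mem fun d _ => mul_mem (hx a d) (hy d b)
  add_mem' hx hy a b := by
    rw [coeff_add]; exact add_mem (hx a b) (hy a b)
  algebraMap_mem' c a b := by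
    classical
    rw [he.coeff_of_commute fun _ _ => Algebra.commutes c _]
    split_ifs
    · exact algebraMap_mem _ c
    · exact zero_mem _
  star_mem' hx a b := by
    rw [coeff_star hs]; exact star_mem (hx b a)

theorem IsMatrixUnits.isClosed_coeffMem {A : Type*} [CStarAlgebra A] {e : ι → ι → A}
    (he : IsMatrixUnits e) (hs : ∀ a b, star (e a b) = e b a) {P : StarSubalgebra ℂ A}
    (hP : IsClosed (P : Set A)) : IsClosed (he.coeffMem hs P : Set A) := by
  have : (he.coeffMem hs P : Set A) = ⋂ a, ⋂ b, (fun x => coeff e x a b) ⁻¹' P := by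
    ext x; simp only [Set.mem_iInter]; rfl
  rw [this]
  refine isClosed_iInter fun a => isClosed_iInter fun b => hP.preimage ?_
  unfold coeff
  fun_prop

end MatrixUnits

namespace SpinSystem

variable {S T : SpinSystem}

/-! ### Local subalgebras -/

instance instIsClosedQuasiLocal (S : SpinSystem) : IsClosed (S.quasiLocal : Set S.Op) :=
  StarSubalgebra.isClosed_topologicalClosure _

instance instIsClosedSupp (S : SpinSystem) (X : Set Site) : IsClosed (S.supp X : Set S.Alg) :=
  StarSubalgebra.isClosed_topologicalClosure _

instance instNormedAlgebraAlg (S : SpinSystem) : NormedAlgebra ℂ S.Alg :=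
  { S.quasiLocal.algebra with norm_smul_le := norm_smul_le }

instance instCStarAlgebraAlg (S : SpinSystem) : CStarAlgebra S.Alg where
  toCompleteSpace := (instIsClosedQuasiLocal S).completeSpace_coe
  norm_mul_self_le x := CStarRing.norm_star_mul_self (x := (x : S.Op)) |>.symm.le

instance instNontrivialAlg (S : SpinSystem) : Nontrivial S.Alg := by
  classical
  have ω : S.Config := fun j => Classical.arbitrary _
  refine ⟨⟨1, 0, fun h => ?_⟩⟩
  have h1 : (1 : S.Op) = 0 := congrArg Subtype.val h
  have h2 := congrArg (fun A : S.Op => A (lp.single 2 ω (1 : ℂ)) ω) h1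
  simp at h2

theorem siteOp_commute (S : SpinSystem) {j k : Site} (h : j ≠ k)
    (M : Matrix (S.idx j) (S.idx j) ℂ) (N : Matrix (S.idx k) (S.idx k) ℂ) :
    Commute (S.siteOp j M) (S.siteOp k N) := by
  ext Φ ω
  rw [mul_apply_eq_comp, mul_apply_eq_comp]
  simp only [siteOp_apply, Finset.mul_sum]
  rw [Finset.sum_comm]
  refine Finset.sum_congr rfl fun b _ => Finset.sum_congr rfl fun a _ => ?_
  rw [Function.update_of_ne h.symm, Function.update_of_ne h, Function.update_comm h]
  ring

theorem site_commute (S : SpinSystem) {j k : Site} (h : j ≠ k)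
    (M : Matrix (S.idx j) (S.idx j) ℂ) (N : Matrix (S.idx k) (S.idx k) ℂ) :
    Commute (S.site j M) (S.site k N) :=
  Subtype.ext (S.siteOp_commute h M N)

theorem site_mem_supp {X : Set Site} {j : Site} (hj : j ∈ X) (M : Matrix (S.idx j) (S.idx j) ℂ) :
    S.site j M ∈ S.supp X :=
  StarSubalgebra.le_topologicalClosure _ <|
    StarAlgebra.subset_adjoin ℂ _ <| Set.mem_iUnion₂.2 ⟨j, hj, M, rfl⟩

theorem supp_le {X : Set Site} {B : StarSubalgebra ℂ S.Alg} (hB : IsClosed (B : Set S.Alg))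
    (h : ∀ j ∈ X, ∀ M, S.site j M ∈ B) : S.supp X ≤ B := by
  refine StarSubalgebra.topologicalClosure_minimal (StarAlgebra.adjoin_le ?_) hB
  intro x hx
  obtain ⟨j, hj, M, rfl⟩ := Set.mem_iUnion₂.1 hx
  exact h j hj M

theorem supp_mono {X Y : Set Site} (h : X ⊆ Y) : S.supp X ≤ S.supp Y :=
  supp_le (S.instIsClosedSupp Y) fun _ hj M => site_mem_supp (h hj) M

theorem supp_univ (S : SpinSystem) : S.supp Set.univ = ⊤ := by
  rw [eq_top_iff]
  intro x _
  have hcl : IsClosed (((S.supp Set.univ).map S.quasiLocal.subtype : StarSubalgebra ℂ S.Op) :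
      Set S.Op) :=
    (S.instIsClosedQuasiLocal.isClosedEmbedding_subtypeVal.isClosedMap _
      (S.instIsClosedSupp Set.univ))
  have hle : S.quasiLocal ≤ (S.supp Set.univ).map S.quasiLocal.subtype := by
    refine StarSubalgebra.topologicalClosure_minimal (StarAlgebra.adjoin_le ?_) hcl
    intro y hy
    obtain ⟨j, M, rfl⟩ := Set.mem_iUnion.1 hy
    exact ⟨S.site j M, site_mem_supp (Set.mem_univ j) M, rfl⟩
  obtain ⟨y, hy, hyx⟩ := hle x.2
  rwa [← Subtype.ext hyx]

theorem mem_of_site_mem {B : StarSubalgebra ℂ S.Alg} (hB : IsClosed (B : Set S.Alg))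
    (h : ∀ j M, S.site j M ∈ B) (x : S.Alg) : x ∈ B := by
  have : x ∈ S.supp Set.univ := by rw [supp_univ]; trivial
  exact supp_le hB (fun j _ M => h j M) this

/-- A `*`-homomorphism on the quasi-local algebra is continuous, hence maps `𝒜_X` into any closed
subalgebra that contains the images of the on-site algebras of `X`. -/
theorem map_mem_of_site {B : Type*} [CStarAlgebra B] (f : S.Alg →⋆ₐ[ℂ] B)
    {C : StarSubalgebra ℂ B} (hC : IsClosed (C : Set B)) {X : Set Site}
    (h : ∀ j ∈ X, ∀ M, f (S.site j M) ∈ C) {x : S.Alg} (hx : x ∈ S.supp X) : f x ∈ C := by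
  have hle : S.supp X ≤ C.comap f := supp_le (hC.preimage (map_continuous f)) h
  exact hle hx

theorem hom_eqOn_supp {B : Type*} [CStarAlgebra B] {f g : S.Alg →⋆ₐ[ℂ] B} {X : Set Site}
    (h : ∀ j ∈ X, ∀ M, f (S.site j M) = g (S.site j M)) {x : S.Alg} (hx : x ∈ S.supp X) :
    f x = g x := by
  have hle : S.supp X ≤ StarAlgHom.equalizer f g :=
    supp_le (isClosed_eq (map_continuous f) (map_continuous g)) h
  exact hle hx

theorem hom_ext {B : Type*} [CStarAlgebra B] {f g : S.Alg →⋆ₐ[ℂ] B}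
    (h : ∀ j M, f (S.site j M) = g (S.site j M)) : f = g :=
  StarAlgHom.ext fun x => hom_eqOn_supp (X := Set.univ) (fun j _ M => h j M)
    (by rw [supp_univ]; trivial)

theorem aut_ext {f g : S.Aut} (h : ∀ j M, f (S.site j M) = g (S.site j M)) : f = g := by
  have := hom_ext (f := (f : S.Alg →⋆ₐ[ℂ] S.Alg)) (g := (g : S.Alg →⋆ₐ[ℂ] S.Alg)) h
  exact StarAlgEquiv.ext fun x => congrArg (fun k : S.Alg →⋆ₐ[ℂ] S.Alg => k x) this

theorem aut_map_mem_of_site {f : S.Aut} {C : StarSubalgebra ℂ S.Alg}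
    (hC : IsClosed (C : Set S.Alg)) {X : Set Site}
    (h : ∀ j ∈ X, ∀ M, f (S.site j M) ∈ C) {x : S.Alg} (hx : x ∈ S.supp X) : f x ∈ C :=
  map_mem_of_site (f : S.Alg →⋆ₐ[ℂ] S.Alg) hC h hx

theorem isClosed_centralizer (s : Set S.Alg) :
    IsClosed (StarSubalgebra.centralizer ℂ s : Set S.Alg) := by
  rw [StarSubalgebra.coe_centralizer]
  exact Set.isClosed_centralizer _

theorem commute_of_site {X : Set Site} {y : S.Alg}
    (h : ∀ j ∈ X, ∀ M, Commute (S.site j M) y) {x : S.Alg} (hx : x ∈ S.supp X) :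
    Commute x y := by
  have hle : S.supp X ≤ StarSubalgebra.centralizer ℂ {y} := by
    refine supp_le (isClosed_centralizer _) fun j hj M => ?_
    rw [StarSubalgebra.mem_centralizer_iff]
    rintro _ rfl
    have h1 := h j hj (star M)
    rw [map_star] at h1
    exact ⟨(h j hj M).symm, by simpa using h1.star_star.symm.eq⟩
  have := (StarSubalgebra.mem_centralizer_iff ℂ).1 (hle hx) y rfl
  exact this.1.symm

/-- Observables with disjoint supports commute. -/
theorem commute_of_disjoint {X Y : Set Site} (h : Disjoint X Y) {x y : S.Alg}
    (hx : x ∈ S.supp X) (hy : y ∈ S.supp Y) : Commute x y := by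
  refine commute_of_site (fun j hj M => ?_) hx
  refine (commute_of_site (fun k hk N => ?_) hy).symm
  exact S.site_commute (fun e => h.ne_of_mem hj hk e.symm) N M

theorem mem_supp_empty {x : S.Alg} (hx : x ∈ S.supp ∅) : ∃ c : ℂ, x = algebraMap ℂ S.Alg c := by
  have hcl : IsClosed ((⊥ : StarSubalgebra ℂ S.Alg) : Set S.Alg) := by
    rw [StarSubalgebra.coe_bot]
    exact (algebraMap_isometry ℂ S.Alg).isClosedEmbedding.isClosed_range
  have hle : S.supp ∅ ≤ ⊥ := supp_le hcl fun j hj => hj.elim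
  obtain ⟨c, hc⟩ := StarSubalgebra.mem_bot.1 (hle hx)
  exact ⟨c, hc.symm⟩

/-! ### Commutants of on-site algebras -/

/-- The matrix unit `|a⟩⟨b|` at the site `j`. -/
def unit (S : SpinSystem) (j : Site) (a b : S.idx j) : S.Alg := S.site j (Matrix.single a b 1)

theorem unit_mem_supp {X : Set Site} {j : Site} (hj : j ∈ X) (a b : S.idx j) :
    S.unit j a b ∈ S.supp X := site_mem_supp hj _

theorem star_unit (j : Site) (a b : S.idx j) : star (S.unit j a b) = S.unit j b a := by
  simp [unit, ← map_star, Matrix.star_eq_conjTranspose]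

theorem isMatrixUnits_unit (S : SpinSystem) (j : Site) : IsMatrixUnits (S.unit j) :=
  isMatrixUnits_map_single (S.site j).toAlgHom

theorem coeff_site (j : Site) (M : Matrix (S.idx j) (S.idx j) ℂ) (a b : S.idx j) :
    coeff (S.unit j) (S.site j M) a b = algebraMap ℂ S.Alg (M a b) := by
  have h1 (c : S.idx j) : S.unit j c a * S.site j M * S.unit j b c =
      (M a b) • S.unit j c c := by
    simp [unit, ← map_mul, ← map_smul, Matrix.single_mul_mul_single]
  rw [coeff]
  simp_rw [h1]
  rw [← Finset.smul_sum, (S.isMatrixUnits_unit j).sum_eq_one, Algebra.algebraMap_eq_smul_one]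

theorem coeff_mem_supp {Y : Set Site} {x : S.Alg} (hx : x ∈ S.supp Y) (j : Site)
    (a b : S.idx j) : coeff (S.unit j) x a b ∈ S.supp (Y \ {j}) := by
  have he := S.isMatrixUnits_unit j
  refine supp_le (he.isClosed_coeffMem (star_unit j) (S.instIsClosedSupp (Y \ {j})))
    (fun k hk M a b => ?_) hx a b
  by_cases hkj : k = j
  · subst hkj
    rw [coeff_site]
    exact algebraMap_mem _ _
  · rw [he.coeff_of_commute fun _ _ => S.site_commute hkj M _]
    split_ifs
    · exact site_mem_supp (show k ∈ Y \ {j} from ⟨hk, hkj⟩) M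
    · exact zero_mem _

theorem mem_supp_diff_singleton {Y : Set Site} {x : S.Alg} (hx : x ∈ S.supp Y) {j : Site}
    (h : ∀ M, Commute x (S.site j M)) : x ∈ S.supp (Y \ {j}) := by
  have := coeff_mem_supp hx j (Classical.arbitrary _) (Classical.arbitrary _)
  rwa [(S.isMatrixUnits_unit j).coeff_of_commute fun _ _ => h _, if_pos rfl] at this

/-- An observable on `Y` that commutes with the observables on a finite region `X` is supported
on `Y \ X`. -/
theorem mem_supp_diff {X Y : Set Site} (hX : X.Finite) {x : S.Alg} (hx : x ∈ S.supp Y)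
    (h : ∀ y ∈ S.supp X, Commute x y) : x ∈ S.supp (Y \ X) := by
  induction X, hX using Set.Finite.induction_on with
  | empty => simpa using hx
  | @insert a s _ _ ih =>
    have h1 := ih fun y hy => h y (supp_mono (Set.subset_insert _ _) hy)
    have h2 := mem_supp_diff_singleton h1 fun M =>
      h _ (site_mem_supp (Set.mem_insert a s) M)
    rwa [Set.sdiff_sdiff, Set.union_comm, Set.singleton_union] at h2

theorem mem_supp_inter {X Y : Set Site} (hX : X.Finite) {x : S.Alg} (hx : x ∈ S.supp X)
    (hy : x ∈ S.supp Y) : x ∈ S.supp (X ∩ Y) := by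
  have := mem_supp_diff (hX.subset Set.sdiff_subset) hx fun y hy' =>
    commute_of_disjoint (X := Y) (Y := X \ Y) Set.disjoint_sdiff_right hy hy'
  rwa [Set.sdiff_sdiff_right_self] at this

theorem mem_supp_of_subset {X Y Z : Set Site} (hX : X.Finite) {x : S.Alg} (hx : x ∈ S.supp X)
    (hy : x ∈ S.supp Y) (h : X ∩ Y ⊆ Z) : x ∈ S.supp Z :=
  supp_mono h (mem_supp_inter hX hx hy)

end SpinSystem

/-! ### Homomorphisms between matrix algebras -/

/-- Two unital representations of a full matrix algebra on the same finite-dimensional space are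
equivalent: the images of a minimal projection have the same rank, and an isomorphism between
these two subspaces extends uniquely to an intertwiner. -/
theorem exists_intertwiner {m V : Type*} [Fintype m] [DecidableEq m] [Nonempty m] [AddCommGroup V]
    [Module ℂ V] [FiniteDimensional ℂ V] (f g : Matrix m m ℂ →ₐ[ℂ] Module.End ℂ V) :
    ∃ u v : Module.End ℂ V, u * v = 1 ∧ v * u = 1 ∧ ∀ x, g x * u = u * f x := by
  obtain ⟨o⟩ := ‹Nonempty m›
  let E (h : Matrix m m ℂ →ₐ[ℂ] Module.End ℂ V) (a b : m) : Module.End ℂ V :=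
    h (Matrix.single a b 1)
  have hE (h : Matrix m m ℂ →ₐ[ℂ] Module.End ℂ V) (a b c : m) : E h a b * E h b c = E h a c :=
    (isMatrixUnits_map_single h).mul_same a b c
  have hE0 (h : Matrix m m ℂ →ₐ[ℂ] Module.End ℂ V) (a b b' c : m) (hb : b ≠ b') :
      E h a b * E h b' c = 0 :=
    (isMatrixUnits_map_single h).mul_of_ne a c hb
  have hsum (h : Matrix m m ℂ →ₐ[ℂ] Module.End ℂ V) : ∑ a, E h a a = 1 :=
    (isMatrixUnits_map_single h).sum_eq_one
  have htr (h : Matrix m m ℂ →ₐ[ℂ] Module.End ℂ V) :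
      (Fintype.card m : ℂ) * LinearMap.trace ℂ V (E h o o) = Module.finrank ℂ V := by
    have h1 (a : m) : LinearMap.trace ℂ V (E h a a) = LinearMap.trace ℂ V (E h o o) := by
      rw [← hE h a o a, LinearMap.trace_mul_comm, hE]
    have h2 := congrArg (LinearMap.trace ℂ V) (hsum h)
    rw [map_sum, LinearMap.trace_one] at h2
    simpa [h1] using h2
  have hrank : Module.finrank ℂ (LinearMap.range (E f o o)) =
      Module.finrank ℂ (LinearMap.range (E g o o)) := by
    have hf := (LinearMap.IsIdempotentElem.isProj_range (E f o o) (hE f o o o)).trace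
    have hg := (LinearMap.IsIdempotentElem.isProj_range (E g o o) (hE g o o o)).trace
    have := (htr f).trans (htr g).symm
    rw [hf, hg] at this
    have hc : (Fintype.card m : ℂ) ≠ 0 := by
      have : 0 < Fintype.card m := Fintype.card_pos_iff.2 ⟨o⟩
      exact_mod_cast this.ne'
    exact_mod_cast mul_left_cancel₀ hc this
  obtain ⟨e⟩ := FiniteDimensional.nonempty_linearEquiv_of_finrank_eq hrank
  let w : Module.End ℂ V :=
    (LinearMap.range (E g o o)).subtype ∘ₗ e.toLinearMap ∘ₗ (E f o o).rangeRestrict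
  let w' : Module.End ℂ V :=
    (LinearMap.range (E f o o)).subtype ∘ₗ e.symm.toLinearMap ∘ₗ (E g o o).rangeRestrict
  have hfix (h : Matrix m m ℂ →ₐ[ℂ] Module.End ℂ V) (y : LinearMap.range (E h o o)) :
      (E h o o).rangeRestrict y = y := by
    obtain ⟨_, z, rfl⟩ := y
    exact Subtype.ext (congrArg (fun A : Module.End ℂ V => A z) (hE h o o o))
  have hw'w : w' * w = E f o o := by
    ext y
    simp only [w, w', Module.End.mul_apply, LinearMap.comp_apply, LinearEquiv.coe_coe,
      Submodule.subtype_apply, hfix, e.symm_apply_apply, LinearMap.codRestrict_apply]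
  have hww' : w * w' = E g o o := by
    ext y
    simp only [w, w', Module.End.mul_apply, LinearMap.comp_apply, LinearEquiv.coe_coe,
      Submodule.subtype_apply, hfix, e.apply_symm_apply, LinearMap.codRestrict_apply]
  -- `w` is an isomorphism from the range of `f e_{oo}` onto that of `g e_{oo}`
  have key (h k : Matrix m m ℂ →ₐ[ℂ] Module.End ℂ V) (s t : Module.End ℂ V)
      (hst : s * E h o o * t = E k o o) :
      (∑ a, E k a o * s * E h o a) * (∑ a, E h a o * t * E k o a) = 1 := by
    rw [Finset.sum_mul, ← hsum k]
    refine Finset.sum_congr rfl fun a _ => ?_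
    rw [Finset.mul_sum, Finset.sum_eq_single a]
    · calc _ = E k a o * (s * (E h o a * E h a o) * t) * E k o a := by simp only [mul_assoc]
        _ = _ := by rw [hE, hst, hE, hE]
    · intro b _ hb
      calc _ = E k a o * s * (E h o a * E h b o) * t * E k o b := by simp only [mul_assoc]
        _ = 0 := by rw [hE0 h o a b o hb.symm]; simp
    · simp
  refine ⟨∑ a, E g a o * w * E f o a, ∑ a, E f a o * w' * E g o a, key f g w w' ?_,
    key g f w' w ?_, fun x => ?_⟩
  · rw [← hw'w, ← mul_assoc, hww', mul_assoc, hww', hE]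
  · rw [← hww', ← mul_assoc, hw'w, mul_assoc, hw'w, hE]
  · have hx : x = ∑ p, ∑ q, x p q • Matrix.single p q (1 : ℂ) := by
      conv_lhs => rw [Matrix.matrix_eq_sum_single x]
      simp
    have hpq (p q : m) : E g p q * (∑ a, E g a o * w * E f o a) =
        (∑ a, E g a o * w * E f o a) * E f p q := by
      rw [Finset.mul_sum, Finset.sum_mul, Finset.sum_eq_single q, Finset.sum_eq_single p]
      · rw [← mul_assoc, ← mul_assoc, hE, mul_assoc (E g p o * w), hE]
      · intro b _ hb
        rw [mul_assoc, hE0 f o b p q hb, mul_zero]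
      · simp
      · intro b _ hb
        rw [← mul_assoc, ← mul_assoc, hE0 g p q b o hb.symm, zero_mul, zero_mul]
      · simp
    generalize ∑ a, E g a o * w * E f o a = W at hpq ⊢
    rw [hx]
    simp only [map_sum, map_smul, Finset.sum_mul, smul_mul_assoc]
    rw [Finset.mul_sum]
    refine Finset.sum_congr rfl fun p _ => ?_
    rw [Finset.mul_sum]
    refine Finset.sum_congr rfl fun q _ => ?_
    rw [mul_smul_comm]
    exact congrArg _ (hpq p q)

/-- An invertible intertwiner between `*`-homomorphisms can be replaced by a unitary one, its
polar part. -/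
theorem exists_unitary_intertwiner {D B : Type*} [Ring D] [StarRing D] [Algebra ℂ D]
    [CStarAlgebra B] (f g : D →⋆ₐ[ℂ] B) {u v : B} (huv : u * v = 1) (hvu : v * u = 1)
    (h : ∀ x, g x * u = u * f x) : ∃ w ∈ unitary B, ∀ x, g x = w * f x * star w := by
  let a : B := star u * u
  have hsa : IsSelfAdjoint a := IsSelfAdjoint.star_mul_self u
  have hunit : IsUnit a := by
    have hu : IsUnit u := ⟨⟨u, v, huv, hvu⟩, rfl⟩
    exact hu.star.mul hu
  have hpos : ∀ t ∈ spectrum ℝ a, 0 < t := fun t ht => by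
    refine lt_of_le_of_ne (spectrum_star_mul_self_nonneg t ht) ?_
    rintro rfl
    exact spectrum.zero_notMem ℝ hunit ht
  have hcomm (x : D) : Commute a (f x) := by
    have h1 : star u * g x = f x * star u := by
      have := congrArg star (h (star x))
      rwa [star_mul, star_mul, map_star, map_star, star_star, star_star] at this
    rw [Commute, SemiconjBy, ← mul_assoc, ← h1, mul_assoc, mul_assoc, ← h x]
  let k : B := cfc (fun t : ℝ => (Real.sqrt t)⁻¹) a
  have hcont : ContinuousOn (fun t : ℝ => (Real.sqrt t)⁻¹) (spectrum ℝ a) :=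
    Real.continuous_sqrt.continuousOn.inv₀ fun t ht => (Real.sqrt_pos.2 (hpos t ht)).ne'
  have hk : IsSelfAdjoint k := cfc_predicate _ a
  have hkcomm (x : D) : Commute k (f x) := (hcomm x).cfc_real _
  have hkak : k * a * k = 1 := by
    have h1 : a = cfc (fun t : ℝ => t) a := (cfc_id' ℝ a).symm
    have h2 : k * a * k = cfc (fun t : ℝ => (Real.sqrt t)⁻¹ * t * (Real.sqrt t)⁻¹) a := by
      rw [cfc_mul (fun t : ℝ => (Real.sqrt t)⁻¹ * t) (fun t => (Real.sqrt t)⁻¹) a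
        (hcont.mul continuousOn_id) hcont,
        cfc_mul (fun t : ℝ => (Real.sqrt t)⁻¹) (fun t => t) a hcont continuousOn_id, ← h1]
    rw [h2, ← cfc_one ℝ a]
    refine cfc_congr fun t ht => ?_
    have := Real.sqrt_pos.2 (hpos t ht)
    have h3 := Real.mul_self_sqrt (hpos t ht).le
    simp only [Pi.one_apply]
    field_simp
    nlinarith
  have hwu : star (u * k) * (u * k) = 1 := by
    rw [star_mul, hk.star_eq]
    calc _ = k * (star u * u) * k := by simp only [mul_assoc]
      _ = 1 := hkak
  have hku : IsUnit k := by
    have hka : Commute k a := by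
      exact ((Commute.refl a).cfc_real _)
    refine ⟨⟨k, k * a, ?_, hkak⟩, rfl⟩
    rw [← mul_assoc, mul_assoc, hka.eq, ← mul_assoc, hkak]
  have hwunit : IsUnit (u * k) := (show IsUnit u from ⟨⟨u, v, huv, hvu⟩, rfl⟩).mul hku
  have hww : (u * k) * star (u * k) = 1 := by
    obtain ⟨y, hy⟩ := hwunit
    have : star (u * k) = ↑y⁻¹ := by
      rw [← mul_one (star (u * k)), ← y.mul_inv, ← mul_assoc, hy, hwu, one_mul]
    rw [this, ← hy, y.mul_inv]
  refine ⟨u * k, Unitary.mem_iff.2 ⟨hwu, hww⟩, fun x => ?_⟩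
  rw [mul_assoc u k, (hkcomm x).eq, ← mul_assoc u, ← h x, mul_assoc, mul_assoc, ← mul_assoc u, hww,
    mul_one]

/-- A form of the Skolem–Noether theorem: an automorphism that maps one matrix algebra into a larger
one is, on the smaller algebra, the conjugation by a unitary of the larger algebra. -/
theorem _root_.StarSubalgebra.exists_unitary_conj {A : Type*} [CStarAlgebra A]
    {P Q : StarSubalgebra ℂ A} [IsClosed (Q : Set A)] (hPQ : P ≤ Q) (θ : A ≃⋆ₐ[ℂ] A)
    (hθ : ∀ x ∈ P, θ x ∈ Q) {m n : Type*} [Fintype m] [DecidableEq m] [Nonempty m] [Fintype n]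
    [DecidableEq n] (eP : P ≃ₐ[ℂ] Matrix m m ℂ) (eQ : Q ≃ₐ[ℂ] Matrix n n ℂ) :
    ∃ u : unitary A, (u : A) ∈ Q ∧ ∀ x ∈ P, θ x = Unitary.conjStarAlgAut ℂ A u x := by
  let f : P →⋆ₐ[ℂ] Q := StarSubalgebra.inclusion hPQ
  let g : P →⋆ₐ[ℂ] Q :=
    ((θ : A →⋆ₐ[ℂ] A).comp P.subtype).codRestrict _ fun x => hθ x x.2
  let eL : Q ≃ₐ[ℂ] Module.End ℂ (n → ℂ) := eQ.trans Matrix.toLinAlgEquiv'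
  obtain ⟨u, v, huv, hvu, h⟩ := exists_intertwiner
    ((eL.toAlgHom.comp f.toAlgHom).comp eP.symm.toAlgHom)
    ((eL.toAlgHom.comp g.toAlgHom).comp eP.symm.toAlgHom)
  obtain ⟨w, hw, hwx⟩ := exists_unitary_intertwiner f g (u := eL.symm u) (v := eL.symm v)
    (by rw [← map_mul, huv, map_one]) (by rw [← map_mul, hvu, map_one]) (fun x => by
      apply eL.injective
      have := h (eP x)
      simpa using this)
  refine ⟨⟨w, ?_⟩, w.2, fun x hx => ?_⟩
  · exact (Unitary.map_mem Q.subtype hw)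
  · exact congrArg Subtype.val (hwx ⟨x, hx⟩)

namespace SpinSystem

variable {S T : SpinSystem}

/-! ### Finite regions -/

theorem exists_algEquiv_matrix {Y : Set Site} (hY : Y.Finite) :
    ∃ (n : Type) (_ : Fintype n) (_ : DecidableEq n),
      Nonempty n ∧ Nonempty (S.supp Y ≃ₐ[ℂ] Matrix n n ℂ) := by
  classical
  induction Y, hY using Set.Finite.induction_on with
  | empty =>
    refine ⟨Unit, inferInstance, inferInstance, inferInstance, ?_⟩
    have e : ℂ ≃ₐ[ℂ] S.supp ∅ := AlgEquiv.ofBijective (Algebra.ofId ℂ _)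
      ⟨(algebraMap ℂ (S.supp ∅)).injective, fun x => by
        obtain ⟨c, hc⟩ := mem_supp_empty x.2
        exact ⟨c, Subtype.ext hc.symm⟩⟩
    exact ⟨e.symm.trans (Matrix.uniqueAlgEquiv (m := Unit) (R := ℂ) (A := ℂ)).symm⟩
  | @insert j Y hj _ ih =>
    obtain ⟨n, _, _, hn, ⟨e⟩⟩ := ih
    obtain ⟨e'⟩ := (S.isMatrixUnits_unit j).exists_algEquiv
      (supp_mono (S := S) (Set.subset_insert j Y))
      (fun a b => unit_mem_supp (Set.mem_insert _ _) a b)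
      (fun x hx a b => commute_of_disjoint (Set.disjoint_singleton_right.2 hj) hx
        (unit_mem_supp (Set.mem_singleton j) a b))
      (fun x hx a b => by simpa [hj] using coeff_mem_supp hx j a b)
    exact ⟨S.idx j × n, inferInstance, inferInstance, inferInstance,
      ⟨e'.trans
        ((e.mapMatrix (m := S.idx j)).trans (Matrix.compAlgEquiv (S.idx j) n ℂ ℂ))⟩⟩

/-- An automorphism that maps the observables on a finite region `X` into those on a finite region
`Y ⊇ X` agrees on `X` with the conjugation by a unitary supported on `Y`. -/
theorem exists_unitary_conj {X Y : Set Site} (hXY : X ⊆ Y) (hY : Y.Finite) (θ : S.Aut)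
    (hθ : ∀ x ∈ S.supp X, θ x ∈ S.supp Y) :
    ∃ u : unitary S.Alg, (u : S.Alg) ∈ S.supp Y ∧
      ∀ x ∈ S.supp X, θ x = Unitary.conjStarAlgAut ℂ S.Alg u x := by
  obtain ⟨m, _, _, _, ⟨eX⟩⟩ := exists_algEquiv_matrix (S := S) (hY.subset hXY)
  obtain ⟨n, _, _, _, ⟨eY⟩⟩ := exists_algEquiv_matrix (S := S) hY
  exact StarSubalgebra.exists_unitary_conj (supp_mono hXY) θ hθ eX eY

end SpinSystem

/-! ### Infinite products of commuting automorphisms -/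

section InfProd

open Filter Topology

variable {A : Type*} [CStarAlgebra A]

theorem aut_dist (f : A ≃⋆ₐ[ℂ] A) (x y : A) : dist (f x) (f y) = dist x y :=
  (NonUnitalStarAlgHom.isometry f f.injective).dist_eq x y

theorem aut_apply_inv (f : A ≃⋆ₐ[ℂ] A) (x : A) : f (f⁻¹ x) = x := StarAlgEquiv.apply_symm_apply f x

theorem aut_inv_apply (f : A ≃⋆ₐ[ℂ] A) (x : A) : f⁻¹ (f x) = x := StarAlgEquiv.symm_apply_apply f x

theorem tendsto_aut_mul {κ : Type*} {l : Filter κ} {u v : κ → A ≃⋆ₐ[ℂ] A} {γ δ : A → A}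
    (hu : ∀ x, Tendsto (fun k => u k x) l (𝓝 (γ x))) (hv : ∀ x, Tendsto (fun k => v k x) l (𝓝 (δ x)))
    (x : A) : Tendsto (fun k => (u k * v k) x) l (𝓝 (γ (δ x))) := by
  refine Tendsto.congr_dist (hu (δ x)) ?_
  have := (tendsto_iff_dist_tendsto_zero.1 (hv x))
  refine this.congr fun k => ?_
  rw [dist_comm, StarAlgEquiv.mul_apply, aut_dist]

theorem tendsto_aut_inv {κ : Type*} {l : Filter κ} {u : κ → A ≃⋆ₐ[ℂ] A} {γ : A ≃⋆ₐ[ℂ] A}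
    (hu : ∀ x, Tendsto (fun k => u k x) l (𝓝 (γ x))) (x : A) :
    Tendsto (fun k => (u k)⁻¹ x) l (𝓝 (γ⁻¹ x)) := by
  rw [tendsto_iff_dist_tendsto_zero]
  have := tendsto_iff_dist_tendsto_zero.1 (hu (γ⁻¹ x))
  refine this.congr fun k => ?_
  rw [← aut_dist (u k) ((u k)⁻¹ x), aut_apply_inv, aut_apply_inv, dist_comm]

/-- A net of automorphisms that converges pointwise, together with the net of the inverses,
converges to an automorphism. -/
theorem exists_aut_of_tendsto {κ : Type*} {l : Filter κ} [l.NeBot] {u : κ → A ≃⋆ₐ[ℂ] A}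
    (hu : ∀ x, ∃ y, Tendsto (fun k => u k x) l (𝓝 y))
    (hu' : ∀ x, ∃ y, Tendsto (fun k => (u k)⁻¹ x) l (𝓝 y)) :
    ∃ γ : A ≃⋆ₐ[ℂ] A, ∀ x, Tendsto (fun k => u k x) l (𝓝 (γ x)) := by
  have key (v : κ → A ≃⋆ₐ[ℂ] A) (hv : ∀ x, ∃ y, Tendsto (fun k => v k x) l (𝓝 y)) :
      ∃ γ : A →⋆ₐ[ℂ] A, ∀ x, Tendsto (fun k => v k x) l (𝓝 (γ x)) := by
    choose f hf using hv
    exact ⟨{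
      toFun := f
      map_one' := tendsto_nhds_unique (hf 1) (by simp)
      map_zero' := tendsto_nhds_unique (hf 0) (by simp)
      map_mul' := fun x y => tendsto_nhds_unique (hf _) (by simpa using (hf x).mul (hf y))
      map_add' := fun x y => tendsto_nhds_unique (hf _) (by simpa using (hf x).add (hf y))
      map_star' := fun x => tendsto_nhds_unique (hf _) (by simpa [map_star] using (hf x).star)
      commutes' := fun c => tendsto_nhds_unique (hf _)
        (by simp [Algebra.algebraMap_eq_smul_one, map_smul]) }, hf⟩
  obtain ⟨γ, hγ⟩ := key u hu
  obtain ⟨δ, hδ⟩ := key _ hu'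
  refine ⟨StarAlgEquiv.ofStarAlgHom γ δ (StarAlgHom.ext fun x => ?_)
    (StarAlgHom.ext fun x => ?_), hγ⟩
  · refine tendsto_nhds_unique (tendsto_aut_mul hδ hγ x) ?_
    simp
  · refine tendsto_nhds_unique (tendsto_aut_mul hγ hδ x) ?_
    simp

variable {ι : Type*}

/-- `γ` is the product of the pairwise commuting automorphisms `φ a`, as the pointwise limit of
the finite products. -/
structure IsInfProd (φ : ι → A ≃⋆ₐ[ℂ] A) (γ : A ≃⋆ₐ[ℂ] A) : Prop where
  comm : Pairwise fun a b => Commute (φ a) (φ b)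
  tendsto : ∀ x, Tendsto (fun F : Finset ι => F.noncommProd φ (comm.set_pairwise _) x) atTop
    (𝓝 (γ x))

theorem noncommProd_inv {H : Type*} [Group H] {φ : ι → H}
    (hφ : Pairwise fun a b => Commute (φ a) (φ b)) (F : Finset ι) (comm) :
    F.noncommProd (fun a => (φ a)⁻¹) comm = (F.noncommProd φ (hφ.set_pairwise _))⁻¹ := by
  classical
  induction F using Finset.induction_on with
  | empty => simp
  | insert a F ha ih =>
    rw [Finset.noncommProd_insert_of_notMem _ _ _ _ ha,
      Finset.noncommProd_insert_of_notMem' _ _ _ _ ha, mul_inv_rev, ih]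

theorem noncommProd_map_equiv {H κ : Type*} [Monoid H] {φ : ι → H}
    (hφ : Pairwise fun a b => Commute (φ a) (φ b)) (e : κ ≃ ι) (F : Finset κ) (comm) :
    F.noncommProd (fun k => φ (e k)) comm =
      (F.map e.toEmbedding).noncommProd φ (hφ.set_pairwise _) := by
  classical
  induction F using Finset.induction_on with
  | empty => simp
  | insert a F ha ih =>
    rw [Finset.noncommProd_insert_of_notMem _ _ _ _ ha, ih,
      ← Finset.noncommProd_insert_of_notMem (F.map e.toEmbedding) (e a) φ
        (hφ.set_pairwise _) (by simpa using ha)]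
    congr 1
    simp

theorem noncommProd_fix {φ : ι → A ≃⋆ₐ[ℂ] A} (F : Finset ι) (comm) {x : A}
    (h : ∀ a ∈ F, φ a x = x) : F.noncommProd φ comm x = x := by
  classical
  induction F using Finset.induction_on with
  | empty => simp
  | insert a F ha ih =>
    rw [Finset.noncommProd_insert_of_notMem _ _ _ _ ha, StarAlgEquiv.mul_apply,
      ih _ fun b hb => h b (Finset.mem_insert_of_mem hb), h a (Finset.mem_insert_self a F)]

theorem noncommProd_apply_of_subset {φ : ι → A ≃⋆ₐ[ℂ] A}
    (hφ : Pairwise fun a b => Commute (φ a) (φ b)) {F F' : Finset ι} (hF : F ⊆ F') {x : A}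
    (h : ∀ a ∉ F, φ a x = x) : F'.noncommProd φ (hφ.set_pairwise _) x =
      F.noncommProd φ (hφ.set_pairwise _) x := by
  classical
  have hu : F ∪ (F' \ F) = F' := Finset.union_sdiff_of_subset hF
  have h1 := Finset.noncommProd_union_of_disjoint (s := F) (t := F' \ F) Finset.disjoint_sdiff φ
    (hφ.set_pairwise _)
  have h2 : F'.noncommProd φ (hφ.set_pairwise _) =
      (F ∪ (F' \ F)).noncommProd φ (hφ.set_pairwise _) := by
    congr 1
    exact hu.symm
  rw [h2, h1, StarAlgEquiv.mul_apply, noncommProd_fix _ _ fun a ha => h a ?_]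
  exact (Finset.mem_sdiff.1 ha).2

namespace IsInfProd

variable {φ ψ : ι → A ≃⋆ₐ[ℂ] A} {γ δ : A ≃⋆ₐ[ℂ] A}

theorem unique (h : IsInfProd φ γ) (h' : IsInfProd φ δ) : γ = δ :=
  StarAlgEquiv.ext fun x => tendsto_nhds_unique (h.tendsto x) (h'.tendsto x)

theorem apply_eq (h : IsInfProd φ γ) (F : Finset ι) {x : A} (hx : ∀ a ∉ F, φ a x = x) :
    γ x = F.noncommProd φ (h.comm.set_pairwise _) x := by
  refine tendsto_nhds_unique (h.tendsto x) (tendsto_const_nhds.congr' ?_)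
  filter_upwards [eventually_ge_atTop F] with F' hF'
  exact (noncommProd_apply_of_subset h.comm hF' hx).symm

theorem apply_eq_self (h : IsInfProd φ γ) {x : A} (hx : ∀ a, φ a x = x) : γ x = x := by
  rw [h.apply_eq ∅ fun a _ => hx a]
  simp

theorem apply_eq_single (h : IsInfProd φ γ) (a : ι) {x : A} (hx : ∀ b, b ≠ a → φ b x = x) :
    γ x = φ a x := by
  rw [h.apply_eq {a} fun b hb => hx b (by simpa using hb)]
  simp

theorem apply_eq_pair (h : IsInfProd φ γ) {a b : ι} (hab : a ≠ b) {x : A}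
    (hx : ∀ c, c ≠ a → c ≠ b → φ c x = x) : γ x = φ a (φ b x) := by
  classical
  rw [h.apply_eq {a, b} fun c hc => hx c (by aesop) (by aesop),
    Finset.noncommProd_insert_of_notMem _ _ _ _ (by simpa using hab)]
  simp

theorem mul (h : IsInfProd φ γ) (h' : IsInfProd ψ δ)
    (hc : Pairwise fun a b => Commute (ψ a) (φ b)) :
    IsInfProd (fun a => φ a * ψ a) (γ * δ) := by
  have hcomm : Pairwise fun a b => Commute (φ a * ψ a) (φ b * ψ b) := fun a b hab =>
    ((h.comm hab).mul_right (hc hab.symm).symm).mul_left ((hc hab).mul_right (h'.comm hab))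
  refine ⟨hcomm, fun x => ?_⟩
  refine (tendsto_aut_mul h.tendsto h'.tendsto x).congr fun F => ?_
  rw [← Finset.noncommProd_mul_distrib φ ψ _ _ (hc.set_pairwise _)]
  rfl

theorem one : IsInfProd (fun _ : ι => (1 : A ≃⋆ₐ[ℂ] A)) 1 := by
  refine ⟨fun _ _ _ => Commute.one_left _, fun x => ?_⟩
  refine tendsto_const_nhds.congr fun F => ?_
  exact (noncommProd_fix _ _ fun _ _ => rfl).symm

theorem inv (h : IsInfProd φ γ) : IsInfProd (fun a => (φ a)⁻¹) γ⁻¹ := by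
  have hcomm : Pairwise fun a b => Commute (φ a)⁻¹ (φ b)⁻¹ := fun a b hab =>
    (h.comm hab).inv_inv
  refine ⟨hcomm, fun x => ?_⟩
  refine (tendsto_aut_inv h.tendsto x).congr fun F => ?_
  rw [noncommProd_inv h.comm]

theorem reindex {κ : Type*} (h : IsInfProd φ γ) (e : κ ≃ ι) :
    IsInfProd (fun k => φ (e k)) γ := by
  classical
  have hcomm : Pairwise fun a b => Commute (φ (e a)) (φ (e b)) := fun a b hab =>
    h.comm (e.injective.ne hab)
  refine ⟨hcomm, fun x => ?_⟩
  have ht : Tendsto (fun F : Finset κ => F.map e.toEmbedding) atTop atTop := by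
    refine Monotone.tendsto_atTop_atTop (fun F F' h => Finset.map_subset_map.2 h) fun F =>
      ⟨F.map e.symm.toEmbedding, fun i hi => ?_⟩
    exact Finset.mem_map.2 ⟨e.symm i, Finset.mem_map.2 ⟨i, hi, rfl⟩, e.apply_symm_apply i⟩
  refine ((h.tendsto x).comp ht).congr fun F => ?_
  rw [noncommProd_map_equiv h.comm e F]
  rfl

end IsInfProd

theorem exists_isInfProd {φ : ι → A ≃⋆ₐ[ℂ] A} (hφ : Pairwise fun a b => Commute (φ a) (φ b))
    (hd : Dense {x : A | ∃ F : Finset ι, ∀ a ∉ F, φ a x = x}) : ∃ γ, IsInfProd φ γ := by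
  classical
  have key (ψ : ι → A ≃⋆ₐ[ℂ] A) (hψ : Pairwise fun a b => Commute (ψ a) (ψ b))
      (hd : Dense {x : A | ∃ F : Finset ι, ∀ a ∉ F, ψ a x = x}) (x : A) :
      ∃ y, Tendsto (fun F : Finset ι => F.noncommProd ψ (hψ.set_pairwise _) x) atTop (𝓝 y) := by
    let P (F : Finset ι) : A ≃⋆ₐ[ℂ] A := F.noncommProd ψ (hψ.set_pairwise _)
    have hP {F F' : Finset ι} (hF : F ⊆ F') {x : A} (h : ∀ a ∉ F, ψ a x = x) :
        P F' x = P F x := noncommProd_apply_of_subset hψ hF h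
    change ∃ y, Tendsto (fun F => P F x) atTop (𝓝 y)
    clear_value P
    have hc : CauchySeq fun F => P F x := by
      rw [Metric.cauchySeq_iff']
      intro ε hε
      obtain ⟨y, hxy, F, hF⟩ := Metric.dense_iff.1 hd x (ε / 2) (by positivity)
      rw [Metric.mem_ball] at hxy
      refine ⟨F, fun F' hF' => ?_⟩
      calc dist (P F' x) (P F x) ≤ dist (P F' x) (P F' y) + dist (P F' y) (P F x) :=
            dist_triangle _ _ _
        _ = dist x y + dist y x := by rw [aut_dist (P F'), hP hF' hF, aut_dist (P F)]
        _ < ε := by rw [dist_comm x y]; linarith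
    exact cauchySeq_tendsto_of_complete hc
  have hφ' : Pairwise fun a b => Commute (φ a)⁻¹ (φ b)⁻¹ := fun a b hab => (hφ hab).inv_inv
  obtain ⟨γ, hγ⟩ := exists_aut_of_tendsto (key φ hφ hd) (fun x => by
    have hd' : Dense {x : A | ∃ F : Finset ι, ∀ a ∉ F, (φ a)⁻¹ x = x} := by
      refine hd.mono ?_
      rintro x ⟨F, hF⟩
      exact ⟨F, fun a ha => by conv_lhs => rw [← hF a ha, aut_inv_apply]⟩
    obtain ⟨y, hy⟩ := key _ hφ' hd' x
    refine ⟨y, hy.congr fun F => ?_⟩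
    rw [noncommProd_inv hφ])
  exact ⟨γ, hφ, hγ⟩

end InfProd

/-! ### Inner automorphisms -/

section Inner

variable {A : Type*} [CStarAlgebra A]

/-- The inner automorphism `Ad u`. -/
abbrev Ad : unitary A →* (A ≃⋆ₐ[ℂ] A) := Unitary.conjStarAlgAut ℂ A

theorem Ad_apply_eq_self {u : unitary A} {x : A} (h : Commute (u : A) x) : Ad u x = x := by
  rw [Unitary.conjStarAlgAut_apply, h.eq, mul_assoc, Unitary.mul_star_self_of_mem u.2, mul_one]

/-- A unital `*`-homomorphism on unitaries. -/
def umap {B : Type*} [CStarAlgebra B] (f : A →⋆ₐ[ℂ] B) : unitary A →* unitary B where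
  toFun u := ⟨f u, Unitary.map_mem f u.2⟩
  map_one' := Subtype.ext (map_one f)
  map_mul' _ _ := Subtype.ext (map_mul f _ _)

@[simp] theorem coe_umap {B : Type*} [CStarAlgebra B] (f : A →⋆ₐ[ℂ] B) (u : unitary A) :
    (umap f u : B) = f u := rfl

theorem umap_mul {B : Type*} [CStarAlgebra B] (f : A →⋆ₐ[ℂ] B) (u v : unitary A) :
    umap f (u * v) = umap f u * umap f v := map_mul _ _ _

theorem map_Ad {B : Type*} [CStarAlgebra B] (f : A →⋆ₐ[ℂ] B) (u : unitary A) (x : A) :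
    f (Ad u x) = Ad (umap f u) (f x) := by
  rw [Unitary.conjStarAlgAut_apply, Unitary.conjStarAlgAut_apply, map_mul, map_mul, map_star]
  rfl

theorem commute_Ad {u v : unitary A} (h : Commute u v) : Commute (Ad u) (Ad v) := h.map Ad

theorem commute_coe {u v : unitary A} : Commute (u : A) (v : A) ↔ Commute u v :=
  ⟨fun h => Subtype.ext h, fun h => congrArg Subtype.val h⟩

/-- The elements that are fixed by all but finitely many of the given automorphisms. -/
def cofinitelyFixed {ι : Type*} (φ : ι → A ≃⋆ₐ[ℂ] A) : StarSubalgebra ℂ A where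
  carrier := {x | ∃ F : Finset ι, ∀ a ∉ F, φ a x = x}
  mul_mem' := by
    classical
    rintro x y ⟨F, hF⟩ ⟨F', hF'⟩
    exact ⟨F ∪ F', fun a ha => by
      rw [map_mul, hF a fun h => ha (Finset.mem_union_left _ h),
        hF' a fun h => ha (Finset.mem_union_right _ h)]⟩
  add_mem' := by
    classical
    rintro x y ⟨F, hF⟩ ⟨F', hF'⟩
    exact ⟨F ∪ F', fun a ha => by
      rw [map_add, hF a fun h => ha (Finset.mem_union_left _ h),
        hF' a fun h => ha (Finset.mem_union_right _ h)]⟩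
  algebraMap_mem' c := ⟨∅, fun a _ => by
    rw [Algebra.algebraMap_eq_smul_one, map_smul, map_one]⟩
  star_mem' := by
    rintro x ⟨F, hF⟩
    exact ⟨F, fun a ha => by rw [map_star, hF a ha]⟩

theorem dense_of_isClosed {B : StarSubalgebra ℂ A}
    (h : ∀ C : StarSubalgebra ℂ A, IsClosed (C : Set A) → B ≤ C → ∀ x, x ∈ C) :
    Dense (B : Set A) := fun x =>
  h _ (StarSubalgebra.isClosed_topologicalClosure B) (StarSubalgebra.le_topologicalClosure B) x

end Inner

namespace SpinSystem

variable {S : SpinSystem}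

/-- The unitaries supported on `X`. -/
def usupp (S : SpinSystem) (X : Set Site) : Subgroup (unitary S.Alg) where
  carrier := {u | (u : S.Alg) ∈ S.supp X}
  mul_mem' hu hv := (S.supp X).mul_mem hu hv
  one_mem' := one_mem (S.supp X)
  inv_mem' hu := (S.supp X).star_mem' hu

theorem usupp_mono {X Y : Set Site} (h : X ⊆ Y) : S.usupp X ≤ S.usupp Y :=
  fun _ hu => supp_mono h hu

theorem usupp_commute {X Y : Set Site} (h : Disjoint X Y) {u v : unitary S.Alg}
    (hu : u ∈ S.usupp X) (hv : v ∈ S.usupp Y) : Commute u v :=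
  commute_coe.1 (commute_of_disjoint h hu hv)

theorem Ad_fix {X Y : Set Site} (h : Disjoint X Y) {u : unitary S.Alg} {x : S.Alg}
    (hu : u ∈ S.usupp X) (hx : x ∈ S.supp Y) : Ad u x = x :=
  Ad_apply_eq_self (commute_of_disjoint h hu hx)

theorem Ad_mem {X : Set Site} {u : unitary S.Alg} {x : S.Alg}
    (hu : u ∈ S.usupp X) (hx : x ∈ S.supp X) : Ad u x ∈ S.supp X :=
  mul_mem (mul_mem hu hx) (star_mem hu)

/-- A pairwise commuting, locally finite family of unitaries has a product. -/
theorem exists_isInfProd_Ad {ι : Type*} {X : ι → Set Site} (hX : ∀ j, {a | j ∈ X a}.Finite)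
    {V : ι → unitary S.Alg} (hV : ∀ a, V a ∈ S.usupp (X a))
    (hc : Pairwise fun a b => Commute (V a) (V b)) :
    ∃ γ : S.Aut, IsInfProd (fun a => Ad (V a)) γ := by
  refine exists_isInfProd (fun a b h => commute_Ad (hc h)) ?_
  refine dense_of_isClosed (B := cofinitelyFixed fun a => Ad (V a)) fun C hC hle x =>
    mem_of_site_mem hC (fun j M => hle ⟨(hX j).toFinset, fun a ha => ?_⟩) x
  refine Ad_fix (Set.disjoint_singleton_right.2 fun h => ha ?_) (hV a)
    (site_mem_supp (Set.mem_singleton j) M)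
  simpa using h

/-! ### Layers and circuits -/

section Layers

variable {P : Set S.Alg} {γ δ : S.Aut}

theorem isLayer_of_isInfProd {ι : Type} {lo hi : ι → Site} {s : Set ι}
    (hle : ∀ a ∈ s, lo a ≤ hi a)
    (hdisj : ∀ a ∈ s, ∀ b ∈ s, a ≠ b → Disjoint (Set.Icc (lo a) (hi a)) (Set.Icc (lo b) (hi b)))
    (hN : ∃ N : ℕ, ∀ a ∈ s, (Set.Icc (lo a) (hi a)).ncard ≤ N)
    {V : ι → unitary S.Alg} (hV : ∀ a ∈ s, V a ∈ S.usupp (Set.Icc (lo a) (hi a)))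
    (hP : ∀ a ∈ s, (V a : S.Alg) ∈ P) (h1 : ∀ a ∉ s, V a = 1) (h1P : (1 : S.Alg) ∈ P)
    (hγ : IsInfProd (fun a => Ad (V a)) γ) : IsLayer P γ := by
  obtain ⟨N, hN⟩ := hN
  -- the sites not covered by the rectangles are blocks of their own, with trivial gates
  let R : Set Site := {j | ∀ a ∈ s, j ∉ Set.Icc (lo a) (hi a)}
  have hfix (a : ι) (ha : a ∈ s) (b : ι) (hb : b ≠ a) (x : S.Alg)
      (hx : x ∈ S.supp (Set.Icc (lo a) (hi a))) : Ad (V b) x = x := by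
    by_cases hbs : b ∈ s
    · exact Ad_fix (hdisj b hbs a ha hb) (hV b hbs) hx
    · rw [h1 b hbs, map_one]; rfl
  have hfix' (j : Site) (hj : j ∈ R) (b : ι) (x : S.Alg)
      (hx : x ∈ S.supp {j}) : Ad (V b) x = x := by
    by_cases hbs : b ∈ s
    · exact Ad_fix (Set.disjoint_singleton_right.2 (hj b hbs)) (hV b hbs) hx
    · rw [h1 b hbs, map_one]; rfl
  refine ⟨s ⊕ R, Sum.elim (fun a => lo a) (fun j => j), Sum.elim (fun a => hi a) (fun j => j),
    Sum.elim (fun a => V a) (fun _ => 1), ?_, ?_, ⟨max N 1, ?_⟩, ?_⟩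
  · rintro (a | j)
    · exact hle a a.2
    · exact le_rfl
  · intro x
    by_cases hx : x ∈ R
    · refine ⟨Sum.inr ⟨x, hx⟩, by simp, ?_⟩
      rintro (a | j) h
      · exact absurd h (hx a a.2)
      · have : x = j := by simpa using h
        exact congrArg Sum.inr (Subtype.ext this.symm)
    · obtain ⟨a, ha, hxa⟩ : ∃ a ∈ s, x ∈ Set.Icc (lo a) (hi a) := by
        by_contra hcon
        exact hx fun a ha hxa => hcon ⟨a, ha, hxa⟩
      refine ⟨Sum.inl ⟨a, ha⟩, hxa, ?_⟩
      rintro (b | j) h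
      · refine congrArg Sum.inl (Subtype.ext ?_)
        by_contra hba
        exact (hdisj b b.2 a ha hba).ne_of_mem h hxa rfl
      · have : x = j := by simpa using h
        exact absurd (this ▸ j.2) hx
  · rintro (a | j)
    · exact (hN a a.2).trans (le_max_left _ _)
    · simp
  · rintro (a | j)
    · refine ⟨(V a).2, hV a a.2, hP a a.2, fun x hx => ?_⟩
      rw [hγ.apply_eq_single (a : ι) fun b hb => hfix a a.2 b hb x hx]
      rfl
    · refine ⟨one_mem _, one_mem _, h1P, fun x hx => ?_⟩
      have hx' : x ∈ S.supp {(j : Site)} := by simpa using hx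
      rw [hγ.apply_eq_self fun b => hfix' j j.2 b x hx']
      simp

theorem IsLayer.inv (hP : ∀ V ∈ P, star V ∈ P) (h : IsLayer P γ) : IsLayer P γ⁻¹ := by
  obtain ⟨ι, lo, hi, V, h1, h2, h3, h4⟩ := h
  refine ⟨ι, lo, hi, fun a => star (V a), h1, h2, h3, fun a => ?_⟩
  obtain ⟨hu, hs, hp, hx⟩ := h4 a
  refine ⟨Unitary.star_mem hu, star_mem hs, hP _ hp, fun x hxs => ?_⟩
  have h5 : γ (star (V a) * x * V a) = x := by
    rw [hx _ (mul_mem (mul_mem (star_mem hs) hxs) hs)]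
    calc _ = (V a * star (V a)) * x * (V a * star (V a)) := by simp only [mul_assoc]
      _ = x := by rw [Unitary.mul_star_self_of_mem hu, one_mul, mul_one]
  rw [star_star]
  conv_lhs => rw [← h5]
  exact StarAlgEquiv.symm_apply_apply γ _

theorem IsLayer.isCircuit (h : IsLayer P γ) : IsCircuit P γ :=
  ⟨[γ], by simpa using h, by simp⟩

theorem isCircuit_one : IsCircuit P (1 : S.Aut) := ⟨[], by simp, rfl⟩

theorem IsCircuit.mul (h : IsCircuit P γ) (h' : IsCircuit P δ) : IsCircuit P (γ * δ) := by
  obtain ⟨L, hL, rfl⟩ := h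
  obtain ⟨L', hL', rfl⟩ := h'
  refine ⟨L ++ L', fun l hl => ?_, by simp⟩
  rcases List.mem_append.1 hl with hl | hl
  · exact hL l hl
  · exact hL' l hl

theorem IsCircuit.inv (hP : ∀ V ∈ P, star V ∈ P) (h : IsCircuit P γ) : IsCircuit P γ⁻¹ := by
  obtain ⟨L, hL, rfl⟩ := h
  refine ⟨(L.map fun x => x⁻¹).reverse, fun l hl => ?_, by rw [List.prod_inv_reverse]⟩
  obtain ⟨k, hk, rfl⟩ := List.mem_map.1 (List.mem_reverse.1 hl)
  exact (hL k hk).inv hP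

/-- A product of commuting gates on rectangles of bounded size is a circuit if the rectangles can
be coloured with finitely many colours so that rectangles of the same colour are disjoint. -/
theorem isCircuit_of_isInfProd {ι : Type} {lo hi : ι → Site} {s : Set ι} {m : ℕ} {c : ι → ℕ}
    (hcm : ∀ a, c a < m) (hle : ∀ a ∈ s, lo a ≤ hi a)
    (hdisj : ∀ a ∈ s, ∀ b ∈ s, a ≠ b → c a = c b →
      Disjoint (Set.Icc (lo a) (hi a)) (Set.Icc (lo b) (hi b)))
    (hN : ∃ N : ℕ, ∀ a ∈ s, (Set.Icc (lo a) (hi a)).ncard ≤ N)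
    {V : ι → unitary S.Alg} (hV : ∀ a ∈ s, V a ∈ S.usupp (Set.Icc (lo a) (hi a)))
    (hP : ∀ a ∈ s, (V a : S.Alg) ∈ P) (h1 : ∀ a ∉ s, V a = 1) (h1P : (1 : S.Alg) ∈ P)
    (hcomm : Pairwise fun a b => Commute (V a) (V b))
    (hγ : IsInfProd (fun a => Ad (V a)) γ) : IsCircuit P γ := by
  classical
  have hfin (j : Site) : {a | j ∈ if a ∈ s then Set.Icc (lo a) (hi a) else ∅}.Finite := by
    refine Set.Finite.of_injOn (t := Set.Iio m) (f := c) (fun a _ => hcm a) ?_ (Set.finite_Iio m)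
    intro a ha b hb hab
    by_contra hne
    by_cases has : a ∈ s <;> by_cases hbs : b ∈ s <;>
      simp only [Set.mem_ofPred_eq, has, hbs, if_true, if_false, Set.mem_empty_iff_false] at ha hb
    exact (hdisj a has b hbs hne hab).ne_of_mem ha hb rfl
  have hmem (V' : ι → unitary S.Alg) (hV' : ∀ a, V' a = V a ∨ V' a = 1) (a : ι) :
      V' a ∈ S.usupp (if a ∈ s then Set.Icc (lo a) (hi a) else ∅) := by
    by_cases has : a ∈ s
    · rw [if_pos has]
      rcases hV' a with h | h
      · rw [h]; exact hV a has
      · rw [h]; exact one_mem _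
    · rcases hV' a with h | h
      · rw [h, h1 a has]; exact one_mem _
      · rw [h]; exact one_mem _
  have hsub (p q : Prop) [Decidable p] [Decidable q] (a b : ι) (hab : a ≠ b) :
      Commute (if p then V a else 1) (if q then V b else 1) := by
    split_ifs
    · exact hcomm hab
    all_goals exact Commute.one_right _
  have key : ∀ k : ℕ, ∀ δ : S.Aut,
      IsInfProd (fun a => Ad (if c a < k then V a else 1)) δ → IsCircuit P δ := by
    intro k
    induction k with
    | zero =>
      intro δ hδ
      have : δ = 1 := hδ.unique (by simpa using (IsInfProd.one (A := S.Alg) (ι := ι)))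
      rw [this]
      exact isCircuit_one
    | succ k ih =>
      intro δ hδ
      obtain ⟨δ₁, hδ₁⟩ := exists_isInfProd_Ad hfin
        (hmem (fun a => if c a < k then V a else 1) fun a => by split_ifs <;> simp)
        (fun a b hab => hsub _ _ a b hab)
      obtain ⟨δ₂, hδ₂⟩ := exists_isInfProd_Ad hfin
        (hmem (fun a => if c a = k then V a else 1) fun a => by split_ifs <;> simp)
        (fun a b hab => hsub _ _ a b hab)
      have hmul := hδ₁.mul hδ₂ fun a b hab => commute_Ad (hsub _ _ a b hab)
      have heq : δ = δ₁ * δ₂ := by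
        refine hδ.unique ?_
        convert hmul using 2 with a
        rw [← map_mul]
        congr 1
        rcases lt_trichotomy (c a) k with h | h | h
        · simp [h, h.ne, h.trans (Nat.lt_succ_self k)]
        · simp [h]
        · simp [h.ne', not_lt.2 h.le, not_lt.2 (Nat.succ_le_of_lt h)]
      rw [heq]
      refine (ih δ₁ hδ₁).mul (IsLayer.isCircuit ?_)
      refine isLayer_of_isInfProd (s := {a | a ∈ s ∧ c a = k}) (fun a ha => hle a ha.1)
        (fun a ha b hb hab => hdisj a ha.1 b hb.1 hab (ha.2.trans hb.2.symm))
        (hN.imp fun N hN a ha => hN a ha.1) (fun a ha => ?_) (fun a ha => ?_) (fun a ha => ?_)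
        h1P hδ₂
      · rw [if_pos ha.2]; exact hV a ha.1
      · rw [if_pos ha.2]; exact hP a ha.1
      · by_cases h : c a = k
        · rw [if_pos h]; exact h1 a fun h' => ha ⟨h', h⟩
        · rw [if_neg h]
  refine key m γ ?_
  convert hγ using 3 with a
  rw [if_pos (hcm a)]

/-- A layer is the product of its gates. -/
theorem IsLayer.exists_isInfProd (h : IsLayer P γ) :
    ∃ (ι : Type) (lo hi : ι → Site) (V : ι → unitary S.Alg),
      (∀ a, lo a ≤ hi a) ∧
      (∀ x, ∃! a, x ∈ Set.Icc (lo a) (hi a)) ∧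
      (∃ N : ℕ, ∀ a, (Set.Icc (lo a) (hi a)).ncard ≤ N) ∧
      (∀ a, V a ∈ S.usupp (Set.Icc (lo a) (hi a)) ∧ (V a : S.Alg) ∈ P) ∧
      (∀ a b, a ≠ b → Disjoint (Set.Icc (lo a) (hi a)) (Set.Icc (lo b) (hi b))) ∧
      (∀ a, ∀ x ∈ S.supp (Set.Icc (lo a) (hi a)), γ x = Ad (V a) x) ∧
      IsInfProd (fun a => Ad (V a)) γ := by
  obtain ⟨ι, lo, hi, V, hle, hpart, hN, hV⟩ := h
  let W (a : ι) : unitary S.Alg := ⟨V a, (hV a).1⟩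
  have hdisj (a b : ι) (hab : a ≠ b) :
      Disjoint (Set.Icc (lo a) (hi a)) (Set.Icc (lo b) (hi b)) :=
    Set.disjoint_left.2 fun x ha hb => hab ((hpart x).unique ha hb)
  have hW (a : ι) : W a ∈ S.usupp (Set.Icc (lo a) (hi a)) := (hV a).2.1
  have hWx (a : ι) (x : S.Alg) (hx : x ∈ S.supp (Set.Icc (lo a) (hi a))) : γ x = Ad (W a) x :=
    (hV a).2.2.2 x hx
  obtain ⟨δ, hδ⟩ := exists_isInfProd_Ad (X := fun a => Set.Icc (lo a) (hi a)) (V := W)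
    (fun j => Set.Subsingleton.finite fun a ha b hb => (hpart j).unique ha hb) hW
    (fun a b hab => usupp_commute (hdisj a b hab) (hW a) (hW b))
  have heq : γ = δ := by
    refine aut_ext fun j M => ?_
    obtain ⟨a, ha, -⟩ := hpart j
    rw [hWx a _ (site_mem_supp ha M), hδ.apply_eq_single a fun b hb =>
      Ad_fix (hdisj b a hb) (hW b) (site_mem_supp ha M)]
  exact ⟨ι, lo, hi, W, hle, hpart, hN, fun a => ⟨hW a, (hV a).2.2.1⟩, hdisj, hWx, heq ▸ hδ⟩

end Layers

end SpinSystem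

/-! ### Phases and the action of automorphisms on unitaries -/

section Phase

variable {A : Type*} [CStarAlgebra A]

/-- The action of the automorphisms on the unitary group. -/
def uaut : (A ≃⋆ₐ[ℂ] A) →* Monoid.End (unitary A) where
  toFun f := umap (f : A →⋆ₐ[ℂ] A)
  map_one' := rfl
  map_mul' _ _ := rfl

theorem coe_uaut (f : A ≃⋆ₐ[ℂ] A) (u : unitary A) : (uaut f u : A) = f u := rfl

theorem aut_Ad (f : A ≃⋆ₐ[ℂ] A) (u : unitary A) (x : A) : f (Ad u x) = Ad (uaut f u) (f x) :=
  map_Ad (f : A →⋆ₐ[ℂ] A) u x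

theorem aut_mul_Ad (f : A ≃⋆ₐ[ℂ] A) (u : unitary A) : f * Ad u = Ad (uaut f u) * f :=
  StarAlgEquiv.ext fun x => aut_Ad f u x

theorem Ad_mul_apply (u v : unitary A) (x : A) : Ad (u * v) x = Ad u (Ad v x) := by
  rw [map_mul]; rfl

theorem Ad_inv_apply (u : unitary A) (x : A) : Ad u⁻¹ (Ad u x) = x := by
  rw [← Ad_mul_apply, inv_mul_cancel, map_one]; rfl

theorem commute_of_Ad_eq {u : unitary A} {x : A} (h : Ad u x = x) : Commute (u : A) x := by
  rw [Unitary.conjStarAlgAut_apply] at h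
  have := congrArg (· * (u : A)) h
  change (u : A) * x = x * u
  simpa [mul_assoc, Unitary.star_mul_self_of_mem u.2] using this

theorem commute_inv_mul {u v : unitary A} {x : A} (h : Ad u x = Ad v x) :
    Commute ((u⁻¹ * v : unitary A) : A) x := by
  refine commute_of_Ad_eq ?_
  rw [Ad_mul_apply, ← h, Ad_inv_apply]

/-- The scalar unitaries. -/
def phase : Circle →* unitary A where
  toFun c := ⟨algebraMap ℂ A c, by
    rw [Unitary.mem_iff, ← algebraMap_star_comm, ← map_mul, ← map_mul, mul_comm, and_self]
    simp [Complex.mul_conj, Circle.normSq_coe]⟩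
  map_one' := Subtype.ext (by simp)
  map_mul' _ _ := Subtype.ext (by simp)

theorem coe_phase (c : Circle) : ((phase c : unitary A) : A) = algebraMap ℂ A c := rfl

theorem phase_commute (c : Circle) (u : unitary A) : Commute (phase c) u :=
  commute_coe.1 (Algebra.commutes _ _)

theorem uaut_phase (f : A ≃⋆ₐ[ℂ] A) (c : Circle) : uaut f (phase c) = phase c :=
  Subtype.ext (by
    rw [coe_uaut, coe_phase, Algebra.algebraMap_eq_smul_one, map_smul, map_one])

theorem umap_phase {B : Type*} [CStarAlgebra B] (f : A →⋆ₐ[ℂ] B) (c : Circle) :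
    umap f (phase c) = phase c :=
  Subtype.ext (by rw [coe_umap, coe_phase, coe_phase, AlgHomClass.commutes])

theorem exists_phase [Nontrivial A] {u : unitary A} {c : ℂ} (h : (u : A) = algebraMap ℂ A c) :
    ∃ z : Circle, u = phase z := by
  have h1 : star (u : A) * u = 1 := Unitary.star_mul_self_of_mem u.2
  rw [h, ← algebraMap_star_comm, ← map_mul, ← map_one (algebraMap ℂ A)] at h1
  have h2 : star c * c = 1 := (algebraMap ℂ A).injective h1
  refine ⟨⟨c, mem_sphere_zero_iff_norm.2 ?_⟩, Subtype.ext h⟩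
  have h3 := congrArg norm h2
  rw [norm_mul, norm_star, norm_one] at h3
  nlinarith [norm_nonneg c]

theorem phase_injective [Nontrivial A] : Function.Injective (phase : Circle → unitary A) :=
  fun _ _ h => Subtype.ext ((algebraMap ℂ A).injective (congrArg Subtype.val h))

end Phase

namespace SpinSystem

variable {S : SpinSystem}

theorem exists_phase_of_mem {u : unitary S.Alg} (h : u ∈ S.usupp ∅) : ∃ z : Circle, u = phase z :=
  let ⟨_, hc⟩ := mem_supp_empty h
  exists_phase hc

theorem phase_mem (c : Circle) (X : Set Site) : phase c ∈ S.usupp X :=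
  algebraMap_mem (S.supp X) (c : ℂ)

theorem usupp_inter {X Y Z : Set Site} (hX : X.Finite) {u : unitary S.Alg} (hx : u ∈ S.usupp X)
    (hy : u ∈ S.usupp Y) (h : X ∩ Y ⊆ Z) : u ∈ S.usupp Z :=
  mem_supp_of_subset hX hx hy h

/-- A unitary that commutes with everything on the finite region that supports it is a phase. -/
theorem exists_phase_of_commute {X : Set Site} (hX : X.Finite) {u : unitary S.Alg}
    (hu : u ∈ S.usupp X) (h : ∀ x ∈ S.supp X, Commute (u : S.Alg) x) :
    ∃ z : Circle, u = phase z := by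
  refine exists_phase_of_mem ?_
  have := mem_supp_diff hX hu h
  rwa [Set.sdiff_self] at this

/-! ### Automorphisms preserving a region -/

/-- The automorphisms that map the observables supported on `X` onto themselves. -/
def stab (S : SpinSystem) (X : Set Site) : Subgroup S.Aut where
  carrier := {γ | ∀ x ∈ S.supp X, γ x ∈ S.supp X ∧ γ⁻¹ x ∈ S.supp X}
  mul_mem' := by
    intro γ δ hγ hδ x hx
    rw [mul_inv_rev]
    exact ⟨(hγ _ (hδ x hx).1).1, (hδ _ (hγ x hx).2).2⟩
  one_mem' := fun x hx => ⟨hx, hx⟩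
  inv_mem' := by
    intro γ hγ x hx
    rw [inv_inv]
    exact (hγ x hx).symm

theorem stab_apply {X : Set Site} {γ : S.Aut} (h : γ ∈ S.stab X) {x : S.Alg}
    (hx : x ∈ S.supp X) : γ x ∈ S.supp X := (h x hx).1

theorem Ad_mem_stab {X : Set Site} {u : unitary S.Alg} (hu : u ∈ S.usupp X) : Ad u ∈ S.stab X := by
  intro x hx
  rw [← map_inv]
  exact ⟨Ad_mem hu hx, Ad_mem (inv_mem hu) hx⟩

theorem mem_stab_of_fix {X : Set Site} {γ : S.Aut} (h : ∀ x ∈ S.supp X, γ x = x) :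
    γ ∈ S.stab X := by
  intro x hx
  refine ⟨by rwa [h x hx], ?_⟩
  have : γ⁻¹ x = x := by conv_lhs => rw [← h x hx, aut_inv_apply]
  rwa [this]

theorem Ad_mem_stab_of_disjoint {X Y : Set Site} (hXY : Disjoint Y X) {u : unitary S.Alg}
    (hu : u ∈ S.usupp Y) : Ad u ∈ S.stab X :=
  mem_stab_of_fix fun _ hx => Ad_fix hXY hu hx

theorem uaut_mem {X : Set Site} {γ : S.Aut} (h : γ ∈ S.stab X) {u : unitary S.Alg}
    (hu : u ∈ S.usupp X) : uaut γ u ∈ S.usupp X := stab_apply h hu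

theorem noncommProd_mem_stab {ι : Type*} {φ : ι → S.Aut} {X : Set Site} (F : Finset ι) (comm)
    (h : ∀ a, φ a ∈ S.stab X) : F.noncommProd φ comm ∈ S.stab X :=
  Subgroup.noncommProd_mem _ _ fun a _ => h a

theorem _root_.SpinSys.IsInfProd.mem_stab {ι : Type*} {φ : ι → S.Aut} {γ : S.Aut}
    (hγ : IsInfProd φ γ) {X : Set Site} (h : ∀ a, φ a ∈ S.stab X) : γ ∈ S.stab X := by
  have key {φ : ι → S.Aut} {γ : S.Aut} (hγ : IsInfProd φ γ) (h : ∀ a, φ a ∈ S.stab X)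
      {x : S.Alg} (hx : x ∈ S.supp X) : γ x ∈ S.supp X :=
    (S.instIsClosedSupp X).mem_of_tendsto (hγ.tendsto x) <| Filter.Eventually.of_forall fun F =>
      stab_apply (noncommProd_mem_stab F _ h) hx
  exact fun x hx => ⟨key hγ h hx, key hγ.inv (fun a => inv_mem (h a)) hx⟩

theorem _root_.SpinSys.OnSiteSymmetry.mem_stab {G : Type*} [Group G] (β : OnSiteSymmetry G S)
    (g : G) (X : Set Site) : β.toHom g ∈ S.stab X := by
  obtain ⟨U, hU⟩ := β.onSite
  have key (g : G) {x : S.Alg} (hx : x ∈ S.supp X) : β.toHom g x ∈ S.supp X :=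
    aut_map_mem_of_site (S.instIsClosedSupp X)
      (fun j hj M => by rw [hU]; exact site_mem_supp hj _) hx
  intro x hx
  rw [← map_inv]
  exact ⟨key g hx, key g⁻¹ hx⟩

/-! ### Truncation of a circuit -/

/-- The half plane below the cut at height `y`. -/
def low (y : ℤ) : Set Site := {j | j.2 ≤ y}

/-- The half plane above the cut at height `y`. -/
def up (y : ℤ) : Set Site := {j | y < j.2}

theorem disjoint_low_up (y : ℤ) : Disjoint (low y) (up y) :=
  Set.disjoint_left.2 fun j (h : j.2 ≤ y) (h' : y < j.2) => not_lt.2 h h'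

theorem layer_fix {X Y : Set Site} (hXY : Disjoint X Y) {l : S.Aut} (h : IsLayer (S.supp X) l)
    {x : S.Alg} (hx : x ∈ S.supp Y) : l x = x := by
  obtain ⟨ι, lo, hi, V, -, -, -, hV, -, -, hl⟩ := h.exists_isInfProd
  exact hl.apply_eq_self fun a => Ad_fix hXY (hV a).2 hx

theorem layer_mem_stab {X : Set Site} {l : S.Aut} (h : IsLayer (S.supp X) l) : l ∈ S.stab X := by
  obtain ⟨ι, lo, hi, V, -, -, -, hV, -, -, hl⟩ := h.exists_isInfProd
  exact hl.mem_stab fun a => Ad_mem_stab (hV a).2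

theorem layer_finite {P : Set S.Alg} {l : S.Aut} (h : IsLayer P l) {X : Set Site} (hX : X.Finite) :
    ∃ Y : Set Site, Y.Finite ∧ ∀ x ∈ S.supp X, l x ∈ S.supp Y := by
  obtain ⟨ι, lo, hi, V, -, hpart, -, hV, -, hx, -⟩ := h.exists_isInfProd
  choose a ha using fun x => (hpart x).exists
  refine ⟨⋃ j ∈ X, Set.Icc (lo (a j)) (hi (a j)), hX.biUnion fun _ _ => Set.finite_Icc _ _,
    fun x => ?_⟩
  refine aut_map_mem_of_site (S.instIsClosedSupp _) fun j hj M => ?_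
  rw [hx (a j) _ (site_mem_supp (ha j) M)]
  refine supp_mono (Set.subset_biUnion_of_mem hj) (Ad_mem (hV (a j)).1 (site_mem_supp (ha j) M))

theorem circuit_fix {X Y : Set Site} (hXY : Disjoint X Y) {γ : S.Aut} (h : IsCircuit (S.supp X) γ)
    {x : S.Alg} (hx : x ∈ S.supp Y) : γ x = x := by
  obtain ⟨L, hL, rfl⟩ := h
  induction L with
  | nil => rfl
  | cons l L ih =>
    rw [List.prod_cons, StarAlgEquiv.mul_apply, ih fun k hk => hL k (List.mem_cons_of_mem _ hk),
      layer_fix hXY (hL l List.mem_cons_self) hx]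

theorem circuit_mem_stab {X : Set Site} {γ : S.Aut} (h : IsCircuit (S.supp X) γ) :
    γ ∈ S.stab X := by
  obtain ⟨L, hL, rfl⟩ := h
  exact Subgroup.list_prod_mem _ fun l hl => layer_mem_stab (hL l hl)

/-- Removing the finitely many gates that cross the cut from a layer on a strip. -/
theorem layer_truncate {m n : ℤ} {l : S.Aut} (h : IsLayer (S.supp (SymmetricEntangler.strip m n)) l)
    (y : ℤ) : ∃ (F : Set Site) (u : unitary S.Alg), F.Finite ∧ F ⊆ SymmetricEntangler.strip m n ∧
      u ∈ S.usupp F ∧ Ad u * l ∈ S.stab (low y) ∧ Ad u * l ∈ S.stab (up y) := by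
  classical
  obtain ⟨ι, lo, hi, V, -, hpart, -, hV, hdisj, -, hl⟩ := h.exists_isInfProd
  have hVX (a : ι) : V a ∈ S.usupp (Set.Icc (lo a) (hi a) ∩ SymmetricEntangler.strip m n) :=
    usupp_inter (Set.finite_Icc _ _) (hV a).1 (hV a).2 subset_rfl
  let C : Set ι := {a | ∃ x ∈ Set.Icc m n, (x, y) ∈ Set.Icc (lo a) (hi a)}
  have hC : C.Finite := by
    choose a ha ha' using hpart
    refine ((Set.finite_Icc m n).image fun x => a (x, y)).subset ?_
    rintro b ⟨x, hx, hb⟩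
    exact ⟨x, hx, (ha' (x, y) b hb).symm⟩
  let V₁ (a : ι) : unitary S.Alg := if a ∈ C then V a else 1
  let V₂ (a : ι) : unitary S.Alg := if a ∈ C then 1 else V a
  have hfin (j : Site) : {a | j ∈ Set.Icc (lo a) (hi a)}.Finite :=
    Set.Subsingleton.finite fun a ha b hb => (hpart j).unique ha hb
  have h₁ (a : ι) : V₁ a ∈ S.usupp (Set.Icc (lo a) (hi a)) := by
    by_cases ha : a ∈ C
    · simpa only [V₁, if_pos ha] using (hV a).1
    · simpa only [V₁, if_neg ha] using one_mem _
  have h₂ (a : ι) : V₂ a ∈ S.usupp (Set.Icc (lo a) (hi a)) := by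
    by_cases ha : a ∈ C
    · simpa only [V₂, if_pos ha] using one_mem _
    · simpa only [V₂, if_neg ha] using (hV a).1
  have hc₁ : Pairwise fun a b => Commute (V₁ a) (V₁ b) := fun a b hab =>
    usupp_commute (hdisj a b hab) (h₁ a) (h₁ b)
  obtain ⟨δ₁, hδ₁⟩ := exists_isInfProd_Ad hfin h₁ hc₁
  obtain ⟨δ₂, hδ₂⟩ := exists_isInfProd_Ad hfin h₂ fun a b hab =>
    usupp_commute (hdisj a b hab) (h₂ a) (h₂ b)
  have hmul : l = δ₁ * δ₂ := by
    refine hl.unique ?_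
    have := hδ₁.mul hδ₂ fun a b hab => commute_Ad (usupp_commute (hdisj a b hab) (h₂ a) (h₁ b))
    convert this using 2 with a
    rw [← map_mul]
    by_cases ha : a ∈ C
    · simp only [V₁, V₂, if_pos ha, mul_one]
    · simp only [V₁, V₂, if_neg ha, one_mul]
  let v := hC.toFinset.noncommProd V₁ (hc₁.set_pairwise _)
  have hv : δ₁ = Ad v := by
    refine StarAlgEquiv.ext fun x => ?_
    rw [hδ₁.apply_eq hC.toFinset fun a ha => ?_]
    · rw [Finset.map_noncommProd]
    · have ha : a ∉ C := by simpa using ha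
      simp only [V₁, if_neg ha, map_one]
      rfl
  have hside (a : ι) (ha : a ∉ C) : V a ∈ S.usupp (low y) ∨ V a ∈ S.usupp (up y) := by
    by_cases hlow : Set.Icc (lo a) (hi a) ∩ SymmetricEntangler.strip m n ⊆ low y
    · exact Or.inl (usupp_mono hlow (hVX a))
    · refine Or.inr (usupp_mono (fun j hj => ?_) (hVX a))
      obtain ⟨i, hi', hiy⟩ := Set.not_subset.1 hlow
      by_contra hjy
      -- a rectangle meeting both half planes within the strip contains a site at height `y`
      refine ha ⟨j.1, hj.2, ⟨hj.1.1.1, ?_⟩, ⟨hj.1.2.1, ?_⟩⟩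
      · exact hj.1.1.2.trans (not_lt.1 hjy)
      · exact (not_le.1 hiy).le.trans hi'.1.2.2
  have hstab (X : Set Site) (hX : ∀ a ∉ C, Ad (V a) ∈ S.stab X) : Ad v⁻¹ * l ∈ S.stab X := by
    rw [hmul, hv, ← mul_assoc, ← map_mul, inv_mul_cancel, map_one, one_mul]
    refine hδ₂.mem_stab fun a => ?_
    by_cases ha : a ∈ C
    · simp only [V₂, if_pos ha, map_one, one_mem]
    · simpa only [V₂, if_neg ha] using hX a ha
  refine ⟨⋃ a ∈ C, Set.Icc (lo a) (hi a) ∩ SymmetricEntangler.strip m n, v⁻¹,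
    hC.biUnion fun _ _ => (Set.finite_Icc _ _).inter_of_left _,
    Set.iUnion₂_subset fun _ _ => Set.inter_subset_right, inv_mem ?_, ?_, ?_⟩
  · refine Subgroup.noncommProd_mem _ _ fun a ha => ?_
    have ha : a ∈ C := by simpa using ha
    simp only [V₁, if_pos ha]
    exact usupp_mono (Set.subset_biUnion_of_mem (u := fun a => Set.Icc (lo a) (hi a) ∩
      SymmetricEntangler.strip m n) ha) (hVX a)
  · refine hstab _ fun a ha => ?_
    rcases hside a ha with h | h
    · exact Ad_mem_stab h
    · exact Ad_mem_stab_of_disjoint (disjoint_low_up y).symm h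
  · refine hstab _ fun a ha => ?_
    rcases hside a ha with h | h
    · exact Ad_mem_stab_of_disjoint (disjoint_low_up y) h
    · exact Ad_mem_stab h

/-- A circuit on a strip can be cut at a given height: up to a local unitary it preserves the
observables above and below the cut. -/
theorem circuit_truncate {m n : ℤ} {γ : S.Aut}
    (h : IsCircuit (S.supp (SymmetricEntangler.strip m n)) γ)
    (y : ℤ) : ∃ (F : Set Site) (u : unitary S.Alg), F.Finite ∧ F ⊆ SymmetricEntangler.strip m n ∧
      u ∈ S.usupp F ∧ Ad u * γ ∈ S.stab (low y) ∧ Ad u * γ ∈ S.stab (up y) := by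
  obtain ⟨L, hL, rfl⟩ := h
  induction L with
  | nil => exact ⟨∅, 1, Set.finite_empty, Set.empty_subset _, one_mem _, by simp, by simp⟩
  | cons l L ih =>
    obtain ⟨F, u, hF, hFs, hu, hlow, hup⟩ := ih fun k hk => hL k (List.mem_cons_of_mem _ hk)
    have hl := hL l List.mem_cons_self
    obtain ⟨F', v, hF', hFs', hv, hlow', hup'⟩ := layer_truncate hl y
    obtain ⟨Y, hY, hlY⟩ := layer_finite hl hF
    have heq : Ad (v * uaut l u) * (l * L.prod) = (Ad v * l) * (Ad u * L.prod) := by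
      rw [map_mul, mul_assoc, ← mul_assoc (Ad (uaut l u)), ← aut_mul_Ad]
      simp only [mul_assoc]
    refine ⟨F' ∪ Y ∩ SymmetricEntangler.strip m n, v * uaut l u, hF'.union (hY.inter_of_left _),
      Set.union_subset hFs' Set.inter_subset_right, mul_mem
        (usupp_mono Set.subset_union_left hv) (usupp_mono Set.subset_union_right ?_), ?_, ?_⟩
    · exact usupp_inter hY (hlY _ hu) (stab_apply (layer_mem_stab hl) (supp_mono hFs hu)) subset_rfl
    · rw [List.prod_cons, heq]
      exact mul_mem hlow' hlow
    · rw [List.prod_cons, heq]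
      exact mul_mem hup' hup

/-! ### Cutting a circuit on a strip -/

/-- The rectangle `[m, n] × (a, b]`. -/
def box (m n a b : ℤ) : Set Site := {j | (m ≤ j.1 ∧ j.1 ≤ n) ∧ a < j.2 ∧ j.2 ≤ b}

theorem mem_box {m n a b : ℤ} {j : Site} :
    j ∈ box m n a b ↔ (m ≤ j.1 ∧ j.1 ≤ n) ∧ a < j.2 ∧ j.2 ≤ b := Iff.rfl

theorem finite_box (m n a b : ℤ) : (box m n a b).Finite :=
  (Set.finite_Icc (m, a) (n, b)).subset fun _ h => ⟨⟨h.1.1, h.2.1.le⟩, h.1.2, h.2.2⟩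

theorem box_eq_Icc (m n a b : ℤ) : box m n a b = Set.Icc (m, a + 1) (n, b) := by
  ext j
  simp only [mem_box, Set.mem_Icc, Prod.le_def, Int.add_one_le_iff]
  tauto

theorem box_disjoint {m n a b m' n' c d : ℤ} (h : b ≤ c) :
    Disjoint (box m n a b) (box m' n' c d) :=
  Set.disjoint_left.2 fun j hj hj' => by
    rw [mem_box] at hj hj'
    omega

theorem fatten_up_subset (y : ℤ) (r : ℕ) : fatten (up y) r ⊆ up (y - r) := by
  rintro j ⟨k, hk, h⟩
  have h1 : dist j.2 k.2 ≤ r := (le_max_right _ _).trans h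
  rw [Int.dist_eq, abs_le] at h1
  have hk : y < k.2 := hk
  have h2 : (k.2 : ℝ) - j.2 ≤ r := by linarith [h1.1]
  have h3 : k.2 - j.2 ≤ (r : ℤ) := by exact_mod_cast h2
  change y - r < j.2
  omega

theorem fatten_low_subset (y : ℤ) (r : ℕ) : fatten (low y) r ⊆ low (y + r) := by
  rintro j ⟨k, hk, h⟩
  have h1 : dist j.2 k.2 ≤ r := (le_max_right _ _).trans h
  rw [Int.dist_eq, abs_le] at h1
  have hk : k.2 ≤ y := hk
  have h2 : (j.2 : ℝ) - k.2 ≤ r := by linarith [h1.2]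
  have h3 : j.2 - k.2 ≤ (r : ℤ) := by exact_mod_cast h2
  change j.2 ≤ y + r
  omega

/-- A unitary whose adjoint action maps `𝒜_X` into `𝒜_Z` agrees on `𝒜_X` with a unitary supported
on `Z`. -/
theorem exists_unitary_of_Ad {X Z : Set Site} (hXZ : X ⊆ Z) (hZ : Z.Finite) (u : unitary S.Alg)
    (h : ∀ x ∈ S.supp X, Ad u x ∈ S.supp Z) :
    ∃ v ∈ S.usupp Z, ∀ x ∈ S.supp X, Commute ((v⁻¹ * u : unitary S.Alg) : S.Alg) x := by
  obtain ⟨v, hv, hx⟩ := exists_unitary_conj hXZ hZ (Ad u) h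
  exact ⟨v, hv, fun x hxX => commute_inv_mul (hx x hxX).symm⟩

theorem usupp_diff {X Y Z : Set Site} (hX : X.Finite) {u : unitary S.Alg} (hu : u ∈ S.usupp Y)
    (h : ∀ x ∈ S.supp X, Commute (u : S.Alg) x) (hZ : Y \ X ⊆ Z) : u ∈ S.usupp Z :=
  supp_mono hZ (mem_supp_diff hX hu h)

/-- The lower part of a cutting unitary can be removed: at a distance of more than `r` below the cut,
its adjoint action does not lead across the cut, because these observables commute with the image of
the upper half plane under `γ`. There it agrees with a unitary below the cut, which can be divided
out. -/
theorem exists_cut_lower {γ : S.Aut} {r : ℕ} (hr : RangeLE γ r) {y : ℤ} {F : Set Site}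
    (hF : F.Finite) {u : unitary S.Alg} (hu : u ∈ S.usupp F)
    (hlow : Ad u * γ ∈ S.stab (low y)) (hup : Ad u * γ ∈ S.stab (up y)) :
    ∃ v ∈ S.usupp (F ∩ up (y - r)), Ad v * γ ∈ S.stab (low y) ∧ Ad v * γ ∈ S.stab (up y) := by
  have hX : (F ∩ low (y - r)).Finite := hF.inter_of_left _
  have hZ : (F ∩ low y).Finite := hF.inter_of_left _
  have hXZ : F ∩ low (y - r) ⊆ F ∩ low y := fun j hj => ⟨hj.1, by
    have h1 : j.2 ≤ y - r := hj.2
    change j.2 ≤ y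
    omega⟩
  obtain ⟨z, hz, hzc⟩ := exists_unitary_of_Ad hXZ hZ u fun x hx => by
    have hxF : Ad u x ∈ S.supp F := Ad_mem hu (supp_mono Set.inter_subset_left hx)
    have := mem_supp_diff (X := F ∩ up y) (hF.inter_of_left _) hxF fun b hb => by
      obtain ⟨b', hb', rfl⟩ : ∃ b' ∈ S.supp (up y), (Ad u * γ) b' = b :=
        ⟨_, (hup b (supp_mono Set.inter_subset_right hb)).2, aut_apply_inv _ _⟩
      have hcomm : Commute x (γ b') := commute_of_disjoint
        ((disjoint_low_up (y - r)).mono Set.inter_subset_right (fatten_up_subset y r))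
        hx (hr _ _ hb')
      rw [StarAlgEquiv.mul_apply]
      exact hcomm.map (Ad u)
    have hsub : F \ (F ∩ up y) ⊆ F ∩ low y := fun j hj =>
      ⟨hj.1, show j.2 ≤ y from not_lt.1 fun hlt => hj.2 ⟨hj.1, hlt⟩⟩
    exact supp_mono hsub this
  have hzlow : z⁻¹ ∈ S.usupp (low y) := inv_mem (usupp_mono Set.inter_subset_right hz)
  refine ⟨z⁻¹ * u, ?_, ?_, ?_⟩
  · refine usupp_diff hX (mul_mem (inv_mem (usupp_mono Set.inter_subset_left hz)) hu) hzc ?_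
    exact fun j hj => ⟨hj.1, show y - r < j.2 from not_le.1 fun hle => hj.2 ⟨hj.1, hle⟩⟩
  · rw [map_mul, mul_assoc]
    exact mul_mem (Ad_mem_stab hzlow) hlow
  · rw [map_mul, mul_assoc]
    exact mul_mem (Ad_mem_stab_of_disjoint (disjoint_low_up y) hzlow) hup

/-- The upper part of a cutting unitary can be removed: as `γ` has range `r`, the inverse of its adjoint
action maps the observables below the cut into those up to `r` above the cut, and agrees there with a
unitary `w`. The original unitary differs from `w⁻¹` by a unitary above the cut. -/
theorem exists_cut_upper {m n : ℤ} {γ : S.Aut} {r : ℕ} (hr : RangeLE γ r) {y : ℤ} {F : Set Site}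
    (hF : F.Finite) (hFs : F ⊆ SymmetricEntangler.strip m n)
    (hbox : box m n (y - r) (y + r) ⊆ F)
    {u : unitary S.Alg} (hu : u ∈ S.usupp (F ∩ up (y - r)))
    (hlow : Ad u * γ ∈ S.stab (low y)) (hup : Ad u * γ ∈ S.stab (up y)) :
    ∃ v ∈ S.usupp (box m n (y - r) (y + r)),
      Ad v * γ ∈ S.stab (low y) ∧ Ad v * γ ∈ S.stab (up y) := by
  have hXZ : box m n (y - r) y ⊆ box m n (y - r) (y + r) := fun j hj => by
    rw [mem_box] at hj ⊢
    omega
  have hXF : box m n (y - r) (y + r) ⊆ F ∩ up (y - r) := fun j hj => ⟨hbox hj, hj.2.1⟩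
  have hXlow : box m n (y - r) y ⊆ low y := fun j hj => hj.2.2
  obtain ⟨w, hw, hwc⟩ := exists_unitary_of_Ad hXZ (finite_box _ _ _ _) u⁻¹ fun x hx => by
    have hxF : Ad u⁻¹ x ∈ S.supp (F ∩ up (y - r)) := Ad_mem (inv_mem hu)
      (supp_mono (hXZ.trans hXF) hx)
    obtain ⟨a, ha, rfl⟩ : ∃ a ∈ S.supp (low y), (Ad u * γ) a = x :=
      ⟨_, (hlow x (supp_mono hXlow hx)).2, aut_apply_inv _ _⟩
    have h2 : Ad u⁻¹ ((Ad u * γ) a) ∈ S.supp (low (y + r)) := by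
      rw [StarAlgEquiv.mul_apply, Ad_inv_apply]
      exact supp_mono (fatten_low_subset y r) (hr _ _ ha)
    exact mem_supp_of_subset (hF.inter_of_left _) hxF h2 fun j hj =>
      ⟨hFs hj.1.1, hj.1.2, hj.2⟩
  have hv : w⁻¹ * u⁻¹ ∈ S.usupp (up y) := by
    refine usupp_diff (finite_box _ _ _ _) (mul_mem (inv_mem (usupp_mono hXF hw)) (inv_mem hu))
      hwc fun j hj => ?_
    exact not_le.1 fun hle => hj.2 ⟨hFs hj.1.1, hj.1.2, hle⟩
  have hw' : w⁻¹ = w⁻¹ * u⁻¹ * u := (inv_mul_cancel_right _ _).symm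
  refine ⟨w⁻¹, inv_mem hw, ?_, ?_⟩
  · rw [hw', map_mul, mul_assoc]
    exact mul_mem (Ad_mem_stab_of_disjoint (disjoint_low_up y).symm hv) hlow
  · rw [hw', map_mul, mul_assoc]
    exact mul_mem (Ad_mem_stab hv) hup

/-- A circuit of range `r` on a strip can be cut at height `y` with a unitary that is supported
within distance `r` of the cut. -/
theorem exists_cut {m n : ℤ} {γ : S.Aut} {r : ℕ}
    (h : IsCircuit (S.supp (SymmetricEntangler.strip m n)) γ) (hr : RangeLE γ r) (y : ℤ) :
    ∃ w ∈ S.usupp (box m n (y - r) (y + r)),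
      Ad w * γ ∈ S.stab (low y) ∧ Ad w * γ ∈ S.stab (up y) := by
  obtain ⟨F, u, hF, hFs, hu, hlow, hup⟩ := circuit_truncate h y
  have hF' : (F ∪ box m n (y - r) (y + r)).Finite := hF.union (finite_box _ _ _ _)
  obtain ⟨v, hv, hlow', hup'⟩ := exists_cut_lower hr hF' (usupp_mono Set.subset_union_left hu)
    hlow hup
  exact exists_cut_upper hr hF' (Set.union_subset hFs fun j hj => hj.1) Set.subset_union_right
    hv hlow' hup'

/-- A unitary near a cut whose adjoint action preserves both sides of the cut is a product of
unitaries on the two sides. -/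
theorem exists_factorization {m n a b : ℤ} (y : ℤ) (hb : y ≤ b) {c : unitary S.Alg}
    (hc : c ∈ S.usupp (box m n a b)) (hlow : Ad c ∈ S.stab (low y)) :
    ∃ p ∈ S.usupp (box m n a y), ∃ q ∈ S.usupp (box m n y b), c = p * q := by
  have hsub : box m n a y ⊆ box m n a b := fun j hj => ⟨hj.1, hj.2.1, hj.2.2.trans hb⟩
  obtain ⟨p, hp, hpc⟩ := exists_unitary_of_Ad (X := box m n a y) (Z := box m n a y) subset_rfl
    (finite_box _ _ _ _) c fun x hx => by
      have h1 : Ad c x ∈ S.supp (box m n a b) := Ad_mem hc (supp_mono hsub hx)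
      have h2 : Ad c x ∈ S.supp (low y) := stab_apply hlow (supp_mono (fun j hj => hj.2.2) hx)
      exact mem_supp_of_subset (finite_box _ _ _ _) h1 h2 fun j hj => ⟨hj.1.1, hj.1.2.1, hj.2⟩
  refine ⟨p, hp, p⁻¹ * c, ?_, (mul_inv_cancel_left p c).symm⟩
  have h1 : p⁻¹ * c ∈ S.usupp (box m n a b) := mul_mem (inv_mem (usupp_mono hsub hp)) hc
  refine usupp_diff (finite_box m n a y) h1 hpc fun j hj => ?_
  have h2 := hj.1
  have h3 := hj.2
  rw [mem_box] at h2 h3 ⊢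
  omega

end SpinSystem

/-! ### The cohomological data of a striped entangler -/

section Group

variable {U : Type*} [Group U]

theorem mul_inv_eq_of_factor {p q p' q' P Q : U} (h : p * q * (p' * q') = P * Q)
    (hc : Commute q p') : P⁻¹ * (p * p') = Q * (q * q')⁻¹ := by
  rw [eq_mul_inv_iff_mul_eq, mul_assoc, mul_assoc, ← mul_assoc p', ← hc.eq]
  rw [mul_assoc q, ← mul_assoc p, h, inv_mul_cancel_left]

/-- Every family indexed by `ℤ` has a discrete primitive. It serves to shift phases along a strip, and
to shift cocycles across the columns, to infinity. -/
theorem exists_primitive {C : Type*} [Group C] (χ : ℤ → C) :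
    ∃ μ : ℤ → C, ∀ k, μ (k + 1) = χ k * μ k := by
  refine ⟨fun k => Int.inductionOn' (motive := fun _ => C) k 0 1 (fun k _ c => χ k * c)
    (fun k _ c => (χ (k - 1))⁻¹ * c), fun k => ?_⟩
  rcases le_or_gt 0 k with hk | hk
  · exact Int.inductionOn'_add_one hk
  · have h : k + 1 ≤ 0 := hk
    have := Int.inductionOn'_sub_one (motive := fun _ => C) (b := 0) (zero := 1)
      (succ := fun k _ c => χ k * c) (pred := fun k _ c => (χ (k - 1))⁻¹ * c) h
    rw [add_sub_cancel_right] at this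
    change _ = χ k * Int.inductionOn' (motive := fun _ => C) k 0 1 (fun k _ c => χ k * c)
      (fun k _ c => (χ (k - 1))⁻¹ * c)
    rw [this, mul_inv_cancel_left]

end Group

namespace SpinSystem

variable {S : SpinSystem} {G : Type*} [Group G] {β : OnSiteSymmetry G S}

theorem uaut_toHom_mul (β : OnSiteSymmetry G S) (g h : G) (u : unitary S.Alg) :
    uaut (β.toHom (g * h)) u = uaut (β.toHom g) (uaut (β.toHom h) u) := by
  rw [map_mul]; rfl

/-- The action of a factorized coboundary on its factors has a scalar cocycle. -/
theorem exists_cocycle {m n y a b : ℤ} {w : unitary S.Alg} {p q : G → unitary S.Alg}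
    (hp : ∀ g, p g ∈ S.usupp (box m n a y)) (hq : ∀ g, q g ∈ S.usupp (box m n y b))
    (hw : ∀ g, w = p g * q g * uaut (β.toHom g) w) :
    ∃ ω : G → G → Circle, ∀ g h,
      p g * uaut (β.toHom g) (p h) = phase (ω g h) * p (g * h) ∧
      phase (ω g h) * (q g * uaut (β.toHom g) (q h)) = q (g * h) := by
  have key (g h : G) : ∃ z : Circle, p g * uaut (β.toHom g) (p h) = phase z * p (g * h) ∧
      phase z * (q g * uaut (β.toHom g) (q h)) = q (g * h) := by
    have hp' := uaut_mem (β.mem_stab g _) (hp h)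
    have hq' := uaut_mem (β.mem_stab g _) (hq h)
    have h1 : p g * q g * (uaut (β.toHom g) (p h) * uaut (β.toHom g) (q h)) =
        p (g * h) * q (g * h) := by
      refine mul_right_cancel (b := uaut (β.toHom (g * h)) w) ?_
      rw [← hw (g * h), uaut_toHom_mul, mul_assoc, ← map_mul, ← map_mul, ← hw h, ← hw g]
    have h2 := mul_inv_eq_of_factor h1
      (usupp_commute (box_disjoint le_rfl).symm (hq g) hp')
    have h3 : (p (g * h))⁻¹ * (p g * uaut (β.toHom g) (p h)) ∈ S.usupp (box m n a y) :=
      mul_mem (inv_mem (hp _)) (mul_mem (hp _) hp')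
    have h4 : (p (g * h))⁻¹ * (p g * uaut (β.toHom g) (p h)) ∈ S.usupp (box m n y b) := by
      rw [h2]
      exact mul_mem (hq _) (inv_mem (mul_mem (hq _) hq'))
    obtain ⟨z, hz⟩ := exists_phase_of_mem (usupp_inter (finite_box _ _ _ _) h3 h4
      (Set.disjoint_iff.1 (box_disjoint le_rfl)))
    refine ⟨z, ?_, ?_⟩
    · rw [(phase_commute z _).eq, ← hz, mul_inv_cancel_left]
    · rw [← hz, h2, inv_mul_cancel_right]
  choose ω hω using key
  exact ⟨ω, hω⟩

/-- The data obtained by cutting a symmetric circuit of range `r` on the strip `[m, n] × ℤ` at the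
heights `2rk`. The cutting unitaries `W k` turn the circuit into a product of the unitaries `X k`
between the cuts. The symmetry moves `W k` by the product of a unitary `p k g` below the cut and a
unitary `q k g` above the cut. Both are projective for the action of the symmetry, with cocycle `ω`
resp. `ω⁻¹`. -/
structure StripData (β : OnSiteSymmetry G S) (m n : ℤ) (r : ℕ) where
  W : ℤ → unitary S.Alg
  X : ℤ → unitary S.Alg
  p : ℤ → G → unitary S.Alg
  q : ℤ → G → unitary S.Alg
  ω : G → G → Circle
  W_mem : ∀ k, W k ∈ S.usupp (box m n (2 * r * k - r) (2 * r * k + r))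
  X_mem : ∀ k, X k ∈ S.usupp (box m n (2 * r * k) (2 * r * (k + 1)))
  p_mem : ∀ k g, p k g ∈ S.usupp (box m n (2 * r * k - r) (2 * r * k))
  q_mem : ∀ k g, q k g ∈ S.usupp (box m n (2 * r * k) (2 * r * k + r))
  W_eq : ∀ k g, W k = p k g * q k g * uaut (β.toHom g) (W k)
  p_mul : ∀ k g h, p k g * uaut (β.toHom g) (p k h) = phase (ω g h) * p k (g * h)
  q_mul : ∀ k g h, phase (ω g h) * (q k g * uaut (β.toHom g) (q k h)) = q k (g * h)
  X_eq : ∀ k g, X k = q k g * p (k + 1) g * uaut (β.toHom g) (X k)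

/-- The data of the identity circuit. -/
def StripData.trivial (β : OnSiteSymmetry G S) (m n : ℤ) (r : ℕ) : StripData β m n r where
  W _ := 1
  X _ := 1
  p _ _ := 1
  q _ _ := 1
  ω _ _ := 1
  W_mem _ := one_mem _
  X_mem _ := one_mem _
  p_mem _ _ := one_mem _
  q_mem _ _ := one_mem _
  W_eq _ _ := by simp
  p_mul _ _ _ := by simp
  q_mul _ _ _ := by simp
  X_eq _ _ := by simp

section

variable {m n : ℤ} {r : ℕ} {γ : S.Aut}

/-- Between two cuts, a circuit is implemented by a unitary. -/
theorem exists_block {W : ℤ → unitary S.Alg} (hr0 : 0 < r)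
    (h : IsCircuit (S.supp (SymmetricEntangler.strip m n)) γ) (hr : RangeLE γ r)
    (hW : ∀ k, W k ∈ S.usupp (box m n (2 * r * k - r) (2 * r * k + r)))
    (hlow : ∀ k, Ad (W k) * γ ∈ S.stab (low (2 * r * k)))
    (hup : ∀ k, Ad (W k) * γ ∈ S.stab (up (2 * r * k))) (k : ℤ) :
    ∃ X ∈ S.usupp (box m n (2 * r * k) (2 * r * (k + 1))),
      ∀ x ∈ S.supp (box m n (2 * r * k) (2 * r * (k + 1))),
        Ad (W k * W (k + 1)) (γ x) = Ad X x := by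
  have hy : 2 * (r : ℤ) * (k + 1) = 2 * r * k + r + r := by ring
  have hcomm : Commute (W k) (W (k + 1)) :=
    usupp_commute (box_disjoint (by rw [hy]; omega)) (hW k) (hW (k + 1))
  have hWs (k : ℤ) : W k ∈ S.usupp (SymmetricEntangler.strip m n) :=
    usupp_mono (fun j hj => hj.1) (hW k)
  obtain ⟨Y, hY, hYx⟩ : ∃ Y : Set Site, Y.Finite ∧ ∀ x ∈
      S.supp (box m n (2 * r * k) (2 * r * (k + 1))), Ad (W k * W (k + 1)) (γ x) ∈ S.supp Y := by
    obtain ⟨L, hL, rfl⟩ := h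
    have : ∀ L : List S.Aut, (∀ l ∈ L, IsLayer (S.supp (SymmetricEntangler.strip m n)) l) →
        ∃ Y : Set Site, Y.Finite ∧ ∀ x ∈
          S.supp (box m n (2 * r * k) (2 * r * (k + 1))), L.prod x ∈ S.supp Y := by
      intro L hL
      induction L with
      | nil => exact ⟨_, finite_box _ _ _ _, fun x hx => hx⟩
      | cons l L ih =>
        obtain ⟨Y, hY, hx⟩ := ih fun k hk => hL k (List.mem_cons_of_mem _ hk)
        obtain ⟨Y', hY', hx'⟩ := layer_finite (hL l List.mem_cons_self) hY
        exact ⟨Y', hY', fun x hxs => by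
          rw [List.prod_cons, StarAlgEquiv.mul_apply]; exact hx' _ (hx x hxs)⟩
    obtain ⟨Y, hY, hx⟩ := this L hL
    refine ⟨Y ∪ (box m n (2 * r * k - r) (2 * r * k + r) ∪
      box m n (2 * r * (k + 1) - r) (2 * r * (k + 1) + r)),
      hY.union ((finite_box _ _ _ _).union (finite_box _ _ _ _)), fun x hxs => Ad_mem (mul_mem
        (usupp_mono ?_ (hW k)) (usupp_mono ?_ (hW (k + 1))))
        (supp_mono Set.subset_union_left (hx x hxs))⟩
    · exact Set.subset_union_left.trans Set.subset_union_right
    · exact Set.subset_union_right.trans Set.subset_union_right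
  obtain ⟨X, hX, hXx⟩ := exists_unitary_conj (X := box m n (2 * r * k) (2 * r * (k + 1)))
    subset_rfl (finite_box _ _ _ _) (Ad (W k * W (k + 1)) * γ) fun x hx => by
      rw [StarAlgEquiv.mul_apply]
      have h1 := hYx x hx
      have h2 : Ad (W k * W (k + 1)) (γ x) ∈ S.supp (SymmetricEntangler.strip m n) :=
        Ad_mem (mul_mem (hWs _) (hWs _))
          (stab_apply (circuit_mem_stab h) (supp_mono (fun j hj => hj.1) hx))
      have h3 : Ad (W k * W (k + 1)) (γ x) ∈ S.supp (up (2 * r * k)) := by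
        rw [hcomm.eq, Ad_mul_apply]
        refine Ad_mem (usupp_mono (fun j hj => ?_) (hW (k + 1)))
          (stab_apply (hup k) (supp_mono (fun j hj => hj.2.1) hx))
        have := hj.2.1
        change 2 * r * k < j.2
        omega
      have h4 : Ad (W k * W (k + 1)) (γ x) ∈ S.supp (low (2 * r * (k + 1))) := by
        rw [Ad_mul_apply]
        refine Ad_mem (usupp_mono (fun j hj => ?_) (hW k))
          (stab_apply (hlow (k + 1)) (supp_mono (fun j hj => hj.2.2) hx))
        have := hj.2.2
        change j.2 ≤ 2 * r * (k + 1)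
        omega
      have h5 := mem_supp_inter hY h1 h2
      have h6 := mem_supp_inter (hY.inter_of_left _) h5 h3
      refine mem_supp_of_subset ((hY.inter_of_left _).inter_of_left _) h6 h4 fun j hj => ?_
      exact ⟨hj.1.1.2, hj.1.2, hj.2⟩
  exact ⟨X, hX, hXx⟩

/-- The symmetry acts on the unitary `X` between two cuts through the factors of the coboundaries
of the cutting unitaries `W` and `W'` that are supported between the cuts. -/
theorem exists_block_phase {y₀ y₁ y₂ y₃ y₄ y₅ : ℤ} (h12 : y₂ ≤ y₃) {g : G}
    {W W' X p q p' q' : unitary S.Alg} (h23 : y₁ ≤ y₂) (h34 : y₃ ≤ y₄)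
    (hW : W ∈ S.usupp (box m n y₀ y₂))
    (hX : X ∈ S.usupp (box m n y₁ y₄))
    (hp : p ∈ S.usupp (box m n y₀ y₁)) (hq : q ∈ S.usupp (box m n y₁ y₂))
    (hp' : p' ∈ S.usupp (box m n y₃ y₄)) (hq' : q' ∈ S.usupp (box m n y₄ y₅))
    (hWe : W = p * q * uaut (β.toHom g) W) (hWe' : W' = p' * q' * uaut (β.toHom g) W')
    (hγ : γ * β.toHom g = β.toHom g * γ)
    (hx : ∀ x ∈ S.supp (box m n y₁ y₄), Ad (W * W') (γ x) = Ad X x) :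
    ∃ z : Circle, q * p' * uaut (β.toHom g) X = phase z * X := by
  have hqb : q ∈ S.usupp (box m n y₁ y₄) :=
    usupp_mono (fun j hj => by rw [mem_box] at hj ⊢; omega) hq
  have hpb' : p' ∈ S.usupp (box m n y₁ y₄) :=
    usupp_mono (fun j hj => by rw [mem_box] at hj ⊢; omega) hp'
  have hXg := uaut_mem (β.mem_stab g _) hX
  have hWg := uaut_mem (β.mem_stab g _) hW
  have hr : q * p' * uaut (β.toHom g) X ∈ S.usupp (box m n y₁ y₄) :=
    mul_mem (mul_mem hqb hpb') hXg
  have hWW : W * W' = p * q' * (q * p') * uaut (β.toHom g) (W * W') := by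
    have e1 : Commute (uaut (β.toHom g) W) (p' * q') :=
      (usupp_commute (box_disjoint h12) hWg hp').mul_right
        (usupp_commute (box_disjoint (h12.trans h34)) hWg hq')
    have e2 : Commute q' (q * p') :=
      (usupp_commute (box_disjoint le_rfl) (mul_mem hqb hpb') hq').symm
    calc W * W' = p * q * uaut (β.toHom g) W * (p' * q' * uaut (β.toHom g) W') := by
          rw [← hWe, ← hWe']
      _ = p * (q * p' * q') * (uaut (β.toHom g) W * uaut (β.toHom g) W') := by
          rw [mul_assoc (p * q), ← mul_assoc _ (p' * q'), e1.eq]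
          simp only [mul_assoc]
      _ = _ := by rw [← e2.eq, map_mul]; simp only [mul_assoc]
  have key (x : S.Alg) (hxb : x ∈ S.supp (box m n y₁ y₄)) :
      Ad X x = Ad (q * p' * uaut (β.toHom g) X) x := by
    have hx0 := stab_apply (inv_mem (β.mem_stab g (box m n y₁ y₄))) hxb
    have hy : x = β.toHom g ((β.toHom g)⁻¹ x) := (aut_apply_inv _ _).symm
    have hc : Commute (p * q') (q * p' * uaut (β.toHom g) X) :=
      (usupp_commute (box_disjoint le_rfl) hp hr).mul_left
        (usupp_commute (box_disjoint le_rfl) hr hq').symm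
    have hz : Ad (p * q') x = x := by
      rw [Ad_mul_apply, Ad_fix (box_disjoint le_rfl).symm hq' hxb,
        Ad_fix (box_disjoint le_rfl) hp hxb]
    have hγ' (x : S.Alg) : γ (β.toHom g x) = β.toHom g (γ x) :=
      congrArg (fun f : S.Aut => f x) hγ
    calc Ad X x = Ad (W * W') (γ x) := (hx x hxb).symm
      _ = Ad (p * q' * (q * p')) (Ad (uaut (β.toHom g) (W * W'))
            (β.toHom g (γ ((β.toHom g)⁻¹ x)))) := by
          rw [← hγ', ← hy, ← Ad_mul_apply, ← hWW]
      _ = Ad (p * q' * (q * p')) (β.toHom g (Ad X ((β.toHom g)⁻¹ x))) := by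
          rw [← aut_Ad, hx _ hx0]
      _ = Ad (p * q' * (q * p' * uaut (β.toHom g) X)) x := by
          rw [aut_Ad, ← hy, ← Ad_mul_apply]
          simp only [mul_assoc]
      _ = _ := by rw [hc.eq, Ad_mul_apply, hz]
  obtain ⟨z, hz⟩ := exists_phase_of_commute (finite_box m n y₁ y₄)
    (u := X⁻¹ * (q * p' * uaut (β.toHom g) X)) (mul_mem (inv_mem hX) hr)
    fun x hxb => commute_inv_mul (key x hxb)
  exact ⟨z, by rw [(phase_commute z _).eq, ← hz, mul_inv_cancel_left]⟩

/-- The cocycles at two consecutive cuts agree. -/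
theorem cocycle_eq {y₁ y₂ y₃ y₄ : ℤ} (h23 : y₂ ≤ y₃) {X : unitary S.Alg}
    {p q : G → unitary S.Alg} {ω ω' : G → G → Circle}
    (hq : ∀ g, q g ∈ S.usupp (box m n y₁ y₂)) (hp : ∀ g, p g ∈ S.usupp (box m n y₃ y₄))
    (hX : ∀ g, X = q g * p g * uaut (β.toHom g) X)
    (hωq : ∀ g h, phase (ω g h) * (q g * uaut (β.toHom g) (q h)) = q (g * h))
    (hωp : ∀ g h, p g * uaut (β.toHom g) (p h) = phase (ω' g h) * p (g * h)) : ω' = ω := by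
  funext g h
  refine phase_injective (A := S.Alg) ?_
  have hc : Commute (p g) (uaut (β.toHom g) (q h)) :=
    usupp_commute (box_disjoint h23).symm (hp g) (uaut_mem (β.mem_stab g _) (hq h))
  have h1 : X = q g * uaut (β.toHom g) (q h) * (p g * uaut (β.toHom g) (p h)) *
      uaut (β.toHom (g * h)) X := by
    calc X = q g * p g * uaut (β.toHom g) (q h * p h * uaut (β.toHom h) X) := by
          rw [← hX h, ← hX g]
      _ = q g * (p g * uaut (β.toHom g) (q h)) * uaut (β.toHom g) (p h) *
          uaut (β.toHom g) (uaut (β.toHom h) X) := by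
          rw [map_mul, map_mul]; simp only [mul_assoc]
      _ = _ := by rw [hc.eq, uaut_toHom_mul]; simp only [mul_assoc]
  have h2 : phase (ω g h) * X = phase (ω' g h) * X := by
    calc phase (ω g h) * X = phase (ω g h) * (q g * uaut (β.toHom g) (q h)) *
          (p g * uaut (β.toHom g) (p h)) * uaut (β.toHom (g * h)) X := by
          conv_lhs => rw [h1]
          simp only [mul_assoc]
      _ = phase (ω' g h) * (q (g * h) * p (g * h) * uaut (β.toHom (g * h)) X) := by
          rw [hωq, hωp, ← mul_assoc (q (g * h)), ← (phase_commute _ (q (g * h))).eq]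
          simp only [mul_assoc]
      _ = _ := by rw [← hX]
  exact (mul_right_cancel h2).symm

/-- A symmetric circuit on a strip, decomposed into cutting unitaries and the unitaries between
the cuts. -/
theorem exists_stripData (hr0 : 0 < r)
    (h : IsCircuit (S.supp (SymmetricEntangler.strip m n)) γ) (hr : RangeLE γ r)
    (hγ : ∀ g, γ * β.toHom g = β.toHom g * γ) :
    ∃ D : StripData β m n r, ∀ k, ∀ x ∈ S.supp (box m n (2 * r * k) (2 * r * (k + 1))),
      Ad (D.W k * D.W (k + 1)) (γ x) = Ad (D.X k) x := by
  choose W hW hlow hup using fun k : ℤ => exists_cut h hr (2 * r * k)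
  choose X hX hXx using exists_block hr0 h hr hW hlow hup
  have hfac (k : ℤ) (g : G) : ∃ p ∈ S.usupp (box m n (2 * r * k - r) (2 * r * k)),
      ∃ q ∈ S.usupp (box m n (2 * r * k) (2 * r * k + r)),
        W k * (uaut (β.toHom g) (W k))⁻¹ = p * q := by
    refine exists_factorization (2 * r * k) (by omega)
      (mul_mem (hW k) (inv_mem (uaut_mem (β.mem_stab g _) (hW k)))) ?_
    have h1 : Ad (uaut (β.toHom g) (W k)) = β.toHom g * Ad (W k) * (β.toHom g)⁻¹ := by
      rw [aut_mul_Ad, mul_inv_cancel_right]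
    have h2 : Ad (W k * (uaut (β.toHom g) (W k))⁻¹) =
        (Ad (W k) * γ) * β.toHom g * (Ad (W k) * γ)⁻¹ * (β.toHom g)⁻¹ := by
      rw [map_mul, map_inv, h1, mul_assoc (Ad (W k)), hγ]
      group
    rw [h2]
    have h3 := β.mem_stab g (low (2 * r * k))
    exact mul_mem (mul_mem (mul_mem (hlow k) h3) (inv_mem (hlow k))) (inv_mem h3)
  choose p hp q hq hpq using hfac
  have hWe (k : ℤ) (g : G) : W k = p k g * q k g * uaut (β.toHom g) (W k) := by
    rw [← hpq, inv_mul_cancel_right]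
  have hy (k : ℤ) : 2 * (r : ℤ) * (k + 1) = 2 * r * k + r + r := by ring
  have hχ (k : ℤ) (g : G) : ∃ z : Circle,
      q k g * p (k + 1) g * uaut (β.toHom g) (X k) = phase z * X k :=
    exists_block_phase (by rw [hy]; omega) (by omega) (by omega) (hW k) (hX k) (hp k g) (hq k g)
      (hp (k + 1) g) (hq (k + 1) g) (hWe k g) (hWe (k + 1) g) (hγ g) (hXx k)
  choose χ hχ using hχ
  -- shift all phases `χ` to infinity along the strip
  obtain ⟨μ, hμ⟩ := exists_primitive fun k => (χ k)⁻¹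
  let p' (k : ℤ) (g : G) : unitary S.Alg := phase (μ k g) * p k g
  let q' (k : ℤ) (g : G) : unitary S.Alg := phase (μ k g)⁻¹ * q k g
  have hp' (k : ℤ) (g : G) : p' k g ∈ S.usupp (box m n (2 * r * k - r) (2 * r * k)) :=
    mul_mem (phase_mem _ _) (hp k g)
  have hq' (k : ℤ) (g : G) : q' k g ∈ S.usupp (box m n (2 * r * k) (2 * r * k + r)) :=
    mul_mem (phase_mem _ _) (hq k g)
  have hWe' (k : ℤ) (g : G) : W k = p' k g * q' k g * uaut (β.toHom g) (W k) := by
    have : p' k g * q' k g = p k g * q k g := by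
      change phase (μ k g) * p k g * (phase (μ k g)⁻¹ * q k g) = _
      rw [(phase_commute _ (p k g)).eq, mul_assoc, ← mul_assoc (phase (μ k g)), ← map_mul,
        mul_inv_cancel, map_one, one_mul]
    rw [this, ← hWe]
  have hXe' (k : ℤ) (g : G) : X k = q' k g * p' (k + 1) g * uaut (β.toHom g) (X k) := by
    have : q' k g * p' (k + 1) g = phase (χ k g)⁻¹ * (q k g * p (k + 1) g) := by
      change phase (μ k g)⁻¹ * q k g * (phase (μ (k + 1) g) * p (k + 1) g) = _
      have h4 : (μ k g)⁻¹ * μ (k + 1) g = (χ k g)⁻¹ := by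
        rw [hμ]
        simp only [Pi.mul_apply, Pi.inv_apply]
        rw [mul_comm, mul_inv_cancel_right]
      rw [mul_assoc, ← mul_assoc (q k g), ← (phase_commute _ (q k g)).eq, ← h4, map_mul]
      simp only [mul_assoc]
    rw [this, mul_assoc, hχ, ← mul_assoc, ← map_mul, inv_mul_cancel, map_one, one_mul]
  choose ω hω using fun k => exists_cocycle (hp' k) (hq' k) (hWe' k)
  have hstep (k : ℤ) : ω (k + 1) = ω k :=
    cocycle_eq (by rw [hy]; omega) (hq' k) (hp' (k + 1)) (hXe' k) (fun g h => (hω k g h).2)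
      (fun g h => (hω (k + 1) g h).1)
  have hconst (k : ℤ) : ω k = ω 0 := by
    induction k using Int.induction_on with
    | zero => rfl
    | succ k ih => rw [hstep, ih]
    | pred k ih => rw [← ih, ← hstep, sub_add_cancel]
  exact ⟨{
    W := W
    X := X
    p := p'
    q := q'
    ω := ω 0
    W_mem := hW
    X_mem := hX
    p_mem := hp'
    q_mem := hq'
    W_eq := hWe'
    p_mul := fun k g h => by rw [(hω k g h).1, hconst]
    q_mul := fun k g h => by rw [← hconst k, (hω k g h).2]
    X_eq := hXe' }, hXx⟩

end

end SpinSystem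

/-! ### Controlled unitaries -/

section Control

variable {A : Type*} [CStarAlgebra A] {G : Type*} [Fintype G]

/-- A partition of unity into orthogonal projections. -/
structure IsPartition (e : G → A) : Prop where
  mul_self : ∀ h, e h * e h = e h
  mul_of_ne : ∀ h h', h ≠ h' → e h * e h' = 0
  star_eq : ∀ h, star (e h) = e h
  sum_eq_one : ∑ h, e h = 1

theorem IsPartition.sum_mul_sum {e : G → A} (he : IsPartition e) {u v : G → A}
    (hu : ∀ h h', Commute (u h) (e h')) :
    (∑ h, e h * u h) * ∑ h, e h * v h = ∑ h, e h * (u h * v h) := by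
  classical
  rw [Finset.sum_mul]
  refine Finset.sum_congr rfl fun h _ => ?_
  rw [Finset.mul_sum, Finset.sum_eq_single h (fun b _ hb => ?_) (by simp)]
  · rw [mul_assoc, ← mul_assoc (u h), (hu h h).eq, ← mul_assoc, ← mul_assoc, he.mul_self,
      mul_assoc]
  · rw [mul_assoc, ← mul_assoc (u h), (hu h b).eq, ← mul_assoc, ← mul_assoc,
      he.mul_of_ne _ _ hb.symm, zero_mul, zero_mul]

theorem IsPartition.star_sum {e : G → A} (he : IsPartition e) {u : G → A}
    (hu : ∀ h h', Commute (u h) (e h')) :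
    star (∑ h, e h * u h) = ∑ h, e h * star (u h) := by
  rw [_root_.star_sum]
  refine Finset.sum_congr rfl fun h _ => ?_
  have := (hu h h).star_star
  rw [he.star_eq] at this
  rw [star_mul, he.star_eq, this.eq]

theorem IsPartition.sum_mem_unitary {e : G → A} (he : IsPartition e) {u : G → unitary A}
    (hu : ∀ h h', Commute (u h : A) (e h')) : ∑ h, e h * u h ∈ unitary A := by
  have hu' (h h') : Commute (star (u h : A)) (e h') := by
    have := (hu h h').star_star
    rwa [he.star_eq] at this
  rw [Unitary.mem_iff, he.star_sum hu]
  constructor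
  · rw [he.sum_mul_sum hu']
    simp [he.sum_eq_one]
  · rw [he.sum_mul_sum hu]
    simp [he.sum_eq_one]

theorem IsPartition.map {B : Type*} [CStarAlgebra B] {e : G → A}
    (he : IsPartition e) (f : A →⋆ₐ[ℂ] B) : IsPartition fun h => f (e h) where
  mul_self h := by rw [← map_mul, he.mul_self]
  mul_of_ne h h' hh := by rw [← map_mul, he.mul_of_ne _ _ hh, map_zero]
  star_eq h := by rw [← map_star, he.star_eq]
  sum_eq_one := by rw [← map_sum, he.sum_eq_one, map_one]

theorem isPartition_matrix {n : ℕ} (e : G ≃ Fin n)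
    (f : Matrix (Fin n) (Fin n) ℂ →⋆ₐ[ℂ] A) :
    IsPartition fun h => f (Matrix.single (e h) (e h) 1) where
  mul_self h := by rw [← map_mul, Matrix.single_mul_single_same, one_mul]
  mul_of_ne h h' hh := by
    rw [← map_mul, Matrix.single_mul_single_of_ne _ _ _ _ (e.injective.ne hh), map_zero]
  star_eq h := by
    rw [← map_star, Matrix.star_eq_conjTranspose, Matrix.conjTranspose_single, star_one]
  sum_eq_one := by
    rw [← map_sum, e.sum_comp fun i => Matrix.single i i (1 : ℂ), Matrix.sum_single_one, map_one]

end Control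

/-! ### Cocycles and links -/

/-- The group of 2-cocycles with values in the circle. -/
def cocycles (G : Type*) [Group G] : Subgroup (G → G → Circle) where
  carrier := {n | ∀ a b c, n a b * n (a * b) c = n b c * n a (b * c)}
  mul_mem' {n n'} hn hn' a b c := by
    change n a b * n' a b * (n (a * b) c * n' (a * b) c) =
      n b c * n' b c * (n a (b * c) * n' a (b * c))
    rw [mul_mul_mul_comm, hn, hn', mul_mul_mul_comm]
  one_mem' _ _ _ := rfl
  inv_mem' {n} hn a b c := by
    change (n a b)⁻¹ * (n (a * b) c)⁻¹ = (n b c)⁻¹ * (n a (b * c))⁻¹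
    rw [← mul_inv, hn, mul_inv]

/-- The algebraic properties of controlled unitaries: `ctrl j w` applies `w h` if the control at
`j` is in the state `h`, where `G` acts on the controls by left multiplication. The homomorphism `ph`
embeds the scalars, and `act` is the action of the symmetry. The target of a control is required to
commute with all controls, so that `ctrl j` is a homomorphism. -/
structure Control (G I C : Type*) [Group G] [Group C] where
  ctrl : I → (G → C) →* C
  ph : Circle →* C
  act : G → C →* C
  ctrl_const : ∀ j u, ctrl j (fun _ => u) = u
  ph_commute : ∀ z u, Commute (ph z) u
  act_act : ∀ g h u, act g (act h u) = act (g * h) u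
  act_ph : ∀ g z, act g (ph z) = ph z
  act_ctrl : ∀ g j w, act g (ctrl j w) = ctrl j fun h => act g (w (g⁻¹ * h))

namespace Control

variable {G I C : Type*} [Group G] [Group C] (c : Control G I C)

theorem ctrl_mul (j : I) (w w' : G → C) :
    c.ctrl j w * c.ctrl j w' = c.ctrl j fun h => w h * w' h := (map_mul (c.ctrl j) w w').symm

theorem ctrl_inv (j : I) (w : G → C) : (c.ctrl j w)⁻¹ = c.ctrl j fun h => (w h)⁻¹ :=
  (map_inv (c.ctrl j) w).symm

theorem ctrl_one (j : I) : c.ctrl j (fun _ => 1) = 1 := c.ctrl_const j 1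

theorem ctrl_commute (j : I) {w : G → C} {u : C} (h : ∀ g, Commute u (w g)) :
    Commute u (c.ctrl j w) := by
  rw [← c.ctrl_const j u]
  exact Commute.map (show Commute (fun _ => u) w from funext fun g => h g) (c.ctrl j)

/-- The charge that the cocycle `n` assigns to the group element `g`, at the site `j`. -/
def charge (j : I) (g : G) (n : G → G → Circle) : C := c.ctrl j fun h => c.ph (n g (g⁻¹ * h))

/-- The link unitary `∑ n(h, h⁻¹h') eₕ ⊗ eₕ'` between the controls `i` and `j`. -/
def link (i j : I) (n : G → G → Circle) : C :=
  c.ctrl i fun h => c.ctrl j fun h' => c.ph (n h (h⁻¹ * h'))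

theorem link_one (i j : I) : c.link i j 1 = 1 := by
  simp [link, ctrl_one]

theorem link_mul (i j : I) (n n' : G → G → Circle) :
    c.link i j (n * n') = c.link i j n * c.link i j n' := by
  simp only [link, ctrl_mul, Pi.mul_apply, map_mul]

theorem link_commute (i j : I) (n : G → G → Circle) (u : C) : Commute (c.link i j n) u :=
  (c.ctrl_commute i fun _ => c.ctrl_commute j fun _ => (c.ph_commute _ u).symm).symm

theorem charge_commute (j : I) (g : G) (n : G → G → Circle) (u : C) :
    Commute (c.charge j g n) u :=
  (c.ctrl_commute j fun _ => (c.ph_commute _ u).symm).symm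

/-- By the cocycle identity, the symmetry changes a link unitary by charges at its ends. -/
theorem act_link (g : G) (i j : I) {n : G → G → Circle} (hn : n ∈ cocycles G) :
    c.act g (c.link i j n) = c.link i j n * (c.charge i g n * (c.charge j g n)⁻¹) := by
  have h2 : c.charge i g n = c.ctrl i fun h => c.ctrl j fun _ => c.ph (n g (g⁻¹ * h)) :=
    congrArg _ (funext fun h => (c.ctrl_const j _).symm)
  have h3 : (c.charge j g n)⁻¹ = c.ctrl i fun _ => c.ctrl j fun h' =>
      (c.ph (n g (g⁻¹ * h')))⁻¹ := by
    rw [c.ctrl_const, charge, ctrl_inv]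
  rw [h2, h3, link, act_ctrl, ctrl_mul, ctrl_mul]
  refine congrArg _ (funext fun h => ?_)
  rw [act_ctrl, ctrl_mul, ctrl_mul]
  refine congrArg _ (funext fun h' => ?_)
  rw [act_ph, ← map_inv, ← map_mul, ← map_mul]
  refine congrArg _ ?_
  have h4 := hn g (g⁻¹ * h) (h⁻¹ * h')
  have h5 : g⁻¹ * h * (h⁻¹ * h') = g⁻¹ * h' := by group
  have h6 : (g⁻¹ * h)⁻¹ * (g⁻¹ * h') = h⁻¹ * h' := by group
  rw [mul_inv_cancel_left, h5] at h4
  rw [h6, ← mul_assoc, eq_mul_inv_iff_mul_eq, ← h4, mul_comm]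

/-- The symmetrization of `w`. -/
def symm (j : I) (w : C) : C := c.ctrl j fun h => c.act h w

theorem act_symm (g : G) (j : I) (w : C) : c.act g (c.symm j w) = c.symm j w := by
  rw [symm, act_ctrl]
  simp only [act_act, mul_inv_cancel_left]

theorem symm_eq {w : C} {p q : G → C} (h : ∀ g, w = p g * q g * c.act g w) (j : I) :
    c.symm j w = c.ctrl j (fun g => (q g)⁻¹) * (c.ctrl j (fun g => (p g)⁻¹) * w) := by
  conv_rhs => rw [← c.ctrl_const j w]
  rw [ctrl_mul, ctrl_mul, symm]
  refine congrArg _ (funext fun g => ?_)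
  rw [← mul_assoc, ← mul_inv_rev, eq_inv_mul_iff_mul_eq, ← h g]

/-- A projective family, used as a control, transforms by right multiplication with the family and
a charge. -/
theorem act_ctrl_inv {p : G → C} {ω : G → G → Circle}
    (hp : ∀ g h, p g * c.act g (p h) = c.ph (ω g h) * p (g * h)) (g : G) (j : I) :
    c.act g (c.ctrl j fun h => (p h)⁻¹) =
      (c.ctrl j fun h => (p h)⁻¹) * p g * (c.charge j g ω)⁻¹ := by
  conv_rhs => rw [← c.ctrl_const j (p g)]
  rw [charge, ctrl_inv, ctrl_mul, ctrl_mul, act_ctrl]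
  refine congrArg _ (funext fun h => ?_)
  have h1 := hp g (g⁻¹ * h)
  rw [mul_inv_cancel_left] at h1
  rw [map_inv, inv_eq_iff_eq_inv, mul_inv_rev, mul_inv_rev, inv_inv, inv_inv,
    ← mul_assoc, (c.ph_commute _ (p g)⁻¹).eq, mul_assoc, ← h1,
    inv_mul_cancel_left]

/-- The unitary between two cuts, dressed by controls at the two cuts and the link between them. -/
def dressed (i j : I) (p q : G → C) (x : C) (ω : G → G → Circle) : C :=
  (c.link i j ω)⁻¹ * ((c.ctrl i fun h => (q h)⁻¹) * (c.ctrl j fun h => (p h)⁻¹) * x)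

theorem act_dressed {p q : G → C} {x : C} {ω : G → G → Circle} (hω : ω ∈ cocycles G)
    (hp : ∀ g h, p g * c.act g (p h) = c.ph (ω g h) * p (g * h))
    (hq : ∀ g h, c.ph (ω g h) * (q g * c.act g (q h)) = q (g * h))
    (hx : ∀ g, x = q g * p g * c.act g x) (hc : ∀ g h, Commute (q g) (p h)) (g : G) (i j : I) :
    c.act g (c.dressed i j p q x ω) = c.dressed i j p q x ω := by
  have hq' (g h : G) : q g * c.act g (q h) = c.ph (ω⁻¹ g h) * q (g * h) := by
    rw [← hq g h, ← mul_assoc (c.ph _), ← map_mul]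
    simp
  have hi : c.charge i g ω⁻¹ = (c.charge i g ω)⁻¹ := by
    rw [charge, charge, ctrl_inv]
    exact congrArg _ (funext fun h => by rw [← map_inv]; rfl)
  have hx' : c.act g x = (p g)⁻¹ * ((q g)⁻¹ * x) := by
    conv_rhs => rw [hx g]
    group
  have hqs : Commute (q g) (c.ctrl j fun h => (p h)⁻¹) :=
    c.ctrl_commute j fun h => (hc g h).inv_right
  rw [dressed, map_mul, map_inv, c.act_link g i j hω, map_mul, map_mul, c.act_ctrl_inv hq' g i,
    c.act_ctrl_inv hp g j, hx', hi, inv_inv]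
  have e1 := c.charge_commute i g ω
  have e2 := (c.charge_commute j g ω)
  generalize c.charge i g ω = a at *
  generalize c.charge j g ω = b at *
  generalize c.link i j ω = l
  generalize (c.ctrl j fun h => (p h)⁻¹) = s at *
  generalize (c.ctrl i fun h => (q h)⁻¹) = t
  have e3 : t * q g * a * (s * p g * b⁻¹) = a * b⁻¹ * (t * q g * (s * p g)) := by
    rw [← (e1 _).eq, ← ((e2 (s * p g)).inv_left).eq, mul_assoc a, mul_assoc a, ← mul_assoc (t * q g),
      ← ((e2 (t * q g)).inv_left).eq, mul_assoc b⁻¹]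
  have e4 : (l * (a * b⁻¹))⁻¹ = l⁻¹ * (a * b⁻¹)⁻¹ := by
    rw [← ((e1 l).mul_left (e2 l).inv_left).eq, mul_inv_rev]
  rw [e3, e4]
  calc l⁻¹ * (a * b⁻¹)⁻¹ * (a * b⁻¹ * (t * q g * (s * p g)) * ((p g)⁻¹ * ((q g)⁻¹ * x)))
      = l⁻¹ * (t * (q g * s) * (q g)⁻¹ * x) := by group
    _ = l⁻¹ * (t * s * x) := by rw [hqs.eq]; group

/-- The product of the link unitaries around a plaquette. -/
def plaquette (i j k l : I) (n : G → G → Circle) : C :=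
  c.link i j n * c.link j k n * (c.link l k n)⁻¹ * (c.link i l n)⁻¹

theorem act_plaquette (g : G) (i j k l : I) {n : G → G → Circle} (hn : n ∈ cocycles G) :
    c.act g (c.plaquette i j k l n) = c.plaquette i j k l n := by
  have hi := c.charge_commute i g n
  have hj := c.charge_commute j g n
  have hk := c.charge_commute k g n
  have hl := c.charge_commute l g n
  rw [plaquette, map_mul, map_mul, map_mul, map_inv, map_inv, c.act_link g i j hn,
    c.act_link g j k hn, c.act_link g l k hn, c.act_link g i l hn]
  have e1 := c.link_commute i l n
  have e2 := c.link_commute l k n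
  have e3 := c.link_commute j k n
  generalize c.charge i g n = a at *
  generalize c.charge j g n = b at *
  generalize c.charge k g n = d at *
  generalize c.charge l g n = f at *
  generalize c.link i l n = u at *
  generalize c.link l k n = v at *
  generalize c.link j k n = w at *
  generalize c.link i j n = t at *
  calc t * (a * b⁻¹) * (w * (b * d⁻¹)) * (v * (f * d⁻¹))⁻¹ * (u * (a * f⁻¹))⁻¹
      = t * (a * (b⁻¹ * w) * b * d⁻¹ * d * f⁻¹ * v⁻¹ * f * a⁻¹ * u⁻¹) := by group
    _ = t * (a * w * (f⁻¹ * v⁻¹ * f) * a⁻¹ * u⁻¹) := by rw [((hj w).inv_left).eq]; group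
    _ = t * (a * (w * v⁻¹) * a⁻¹ * u⁻¹) := by rw [((hl v).inv_inv).eq]; group
    _ = t * w * v⁻¹ * u⁻¹ := by rw [(hi (w * v⁻¹)).eq]; group

end Control

namespace SpinSystem

variable {S : SpinSystem} {G : Type*} [Group G] [Fintype G] {β : OnSiteSymmetry G S}

/-! ### Clocks -/

/-- At every site, a system of projections labelled by the group elements that are permuted by the
symmetry. This is a copy of the regular representation in the on-site representation. -/
structure Clock (β : OnSiteSymmetry G S) where
  e : Site → G → S.Alg
  mem : ∀ j h, e j h ∈ S.supp {j}
  partition : ∀ j, IsPartition (e j)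
  act_e : ∀ g j h, β.toHom g (e j h) = e j (g * h)

namespace Clock

variable (c : Clock β)

theorem e_commute (i j : Site) (h h' : G) : Commute (c.e i h) (c.e j h') := by
  by_cases hij : i = j
  · subst hij
    by_cases hh : h = h'
    · subst hh; exact Commute.refl _
    · rw [Commute, SemiconjBy, (c.partition i).mul_of_ne _ _ hh,
        (c.partition i).mul_of_ne _ _ (Ne.symm hh)]
  · exact commute_of_disjoint (Set.disjoint_singleton.2 hij) (c.mem i h) (c.mem j h')

/-- The unitaries that commute with all clock projections. -/
def C : Subgroup (unitary S.Alg) where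
  carrier := {u | ∀ j h, Commute (u : S.Alg) (c.e j h)}
  mul_mem' hu hv j h := (hu j h).mul_left (hv j h)
  one_mem' _ _ := Commute.one_left _
  inv_mem' {u} hu j h := by
    have := (hu j h).star_star
    rwa [(c.partition j).star_eq] at this

/-- The controlled unitary `∑ₕ eₕ w(h)` at the site `j`. -/
def ctrl (j : Site) : (G → c.C) →* c.C where
  toFun w := ⟨⟨∑ h, c.e j h * (w h : unitary S.Alg),
      (c.partition j).sum_mem_unitary fun h h' => (w h).2 j h'⟩, fun i h' =>
      Commute.sum_left _ _ _ fun h _ => (c.e_commute j i h h').mul_left ((w h).2 i h')⟩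
  map_one' := Subtype.ext <| Subtype.ext <| by
    simp [(c.partition j).sum_eq_one]
  map_mul' w w' := Subtype.ext <| Subtype.ext <|
    ((c.partition j).sum_mul_sum fun h h' => (w h).2 j h').symm

theorem coe_ctrl (j : Site) (w : G → c.C) :
    ((c.ctrl j w : unitary S.Alg) : S.Alg) = ∑ h, c.e j h * (w h : unitary S.Alg) := rfl

theorem ctrl_const (j : Site) (u : c.C) : c.ctrl j (fun _ => u) = u :=
  Subtype.ext <| Subtype.ext <| by
    rw [coe_ctrl, ← Finset.sum_mul, (c.partition j).sum_eq_one, one_mul]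

theorem ctrl_mem {X : Set Site} {j : Site} (hj : j ∈ X) {w : G → c.C}
    (hw : ∀ h, (w h : unitary S.Alg) ∈ S.usupp X) : (c.ctrl j w : unitary S.Alg) ∈ S.usupp X := by
  change ∑ h, c.e j h * (w h : unitary S.Alg) ∈ S.supp X
  exact sum_mem fun h _ => mul_mem (supp_mono (by simpa using hj) (c.mem j h)) (hw h)

/-- The action of the symmetry on the commutant of the clock projections. -/
def act (g : G) : c.C →* c.C where
  toFun u := ⟨uaut (β.toHom g) u, fun j h => by
    have := (u.2 j (g⁻¹ * h)).map (β.toHom g)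
    rwa [c.act_e, mul_inv_cancel_left] at this⟩
  map_one' := Subtype.ext (map_one _)
  map_mul' _ _ := Subtype.ext (map_mul _ _ _)

theorem act_act (g h : G) (u : c.C) : c.act g (c.act h u) = c.act (g * h) u :=
  Subtype.ext (uaut_toHom_mul β g h u).symm

theorem act_ctrl (g : G) (j : Site) (w : G → c.C) :
    c.act g (c.ctrl j w) = c.ctrl j fun h => c.act g (w (g⁻¹ * h)) := by
  refine Subtype.ext <| Subtype.ext ?_
  change β.toHom g (∑ h, c.e j h * (w h : unitary S.Alg)) = _
  rw [map_sum, coe_ctrl]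
  refine Fintype.sum_equiv (Equiv.mulLeft g) _ _ fun h => ?_
  rw [map_mul, c.act_e, Equiv.coe_mulLeft, inv_mul_cancel_left]
  rfl

/-- The scalar unitaries. -/
def ph : Circle →* c.C where
  toFun z := ⟨phase z, fun _ _ => Algebra.commutes _ _⟩
  map_one' := Subtype.ext (map_one _)
  map_mul' _ _ := Subtype.ext (map_mul _ _ _)

theorem ph_commute (z : Circle) (u : c.C) : Commute (c.ph z) u :=
  Subtype.ext (phase_commute z u.1)

theorem act_ph (g : G) (z : Circle) : c.act g (c.ph z) = c.ph z := Subtype.ext (uaut_phase _ z)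

/-- The controlled unitaries of a clock. -/
def control : Control G Site c.C where
  ctrl := c.ctrl
  ph := c.ph
  act := c.act
  ctrl_const := c.ctrl_const
  ph_commute := c.ph_commute
  act_act := c.act_act
  act_ph := c.act_ph
  act_ctrl := c.act_ctrl

/-- The unitaries supported on `K`, among those commuting with the clock projections. -/
def csupp (K : Set Site) : Subgroup c.C := (S.usupp K).subgroupOf c.C

/-- The unitaries that are supported on `K` up to controls, described as a double commutant. Using
unitaries of the core as targets of a control does not leave the core, wherever the control is, and
the cores of disjoint regions commute. -/
def core (K : Set Site) : Subgroup c.C :=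
  Subgroup.centralizer (Subgroup.centralizer (c.csupp K : Set c.C) : Set c.C)

theorem mem_core {K : Set Site} {u : c.C} (hu : (u : unitary S.Alg) ∈ S.usupp K) :
    u ∈ c.core K := by
  intro v hv
  exact (hv u (show u ∈ c.csupp K from hu)).symm

theorem ctrl_mem_core {K : Set Site} (j : Site) {w : G → c.C} (hw : ∀ h, w h ∈ c.core K) :
    c.ctrl j w ∈ c.core K := by
  intro v hv
  exact (c.control.ctrl_commute j fun g => (hw g v hv))

theorem core_commute {K K' : Set Site} (h : Disjoint K K') {u v : c.C} (hu : u ∈ c.core K)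
    (hv : v ∈ c.core K') : Commute u v := by
  refine hv u fun w hw => ?_
  refine (hu w fun w' hw' => ?_)
  exact Subtype.ext (usupp_commute h hw' hw)

theorem ph_mem_core (z : Circle) (K : Set Site) : c.ph z ∈ c.core K :=
  c.mem_core (phase_mem z K)

theorem link_mem_core (i j : Site) (n : G → G → Circle) (K : Set Site) :
    c.control.link i j n ∈ c.core K :=
  c.ctrl_mem_core i fun _ => c.ctrl_mem_core j fun _ => c.ph_mem_core _ K

theorem link_mem {X : Set Site} {i j : Site} (hi : i ∈ X) (hj : j ∈ X) (n : G → G → Circle) :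
    (c.control.link i j n : unitary S.Alg) ∈ S.usupp X :=
  c.ctrl_mem hi fun _ => c.ctrl_mem hj fun _ => phase_mem _ X

end Clock

end SpinSystem

namespace SpinSystem

variable {S : SpinSystem} {G : Type*} [Group G] {β : OnSiteSymmetry G S}

/-! ### Families of strips -/

theorem StripData.ω_mem_cocycles {m n : ℤ} {r : ℕ} (D : StripData β m n r) :
    D.ω ∈ cocycles G := by
  intro a b c
  refine phase_injective (A := S.Alg) ?_
  refine mul_right_cancel (b := D.p 0 (a * (b * c))) ?_
  calc phase (D.ω a b * D.ω (a * b) c) * D.p 0 (a * (b * c))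
      = phase (D.ω a b) * (D.p 0 (a * b) * uaut (β.toHom (a * b)) (D.p 0 c)) := by
        rw [D.p_mul, map_mul, mul_assoc, mul_assoc a]
    _ = D.p 0 a * uaut (β.toHom a) (D.p 0 b * uaut (β.toHom b) (D.p 0 c)) := by
        rw [← mul_assoc, ← D.p_mul, uaut_toHom_mul, map_mul, mul_assoc]
    _ = phase (D.ω b c) * (D.p 0 a * uaut (β.toHom a) (D.p 0 (b * c))) := by
        rw [D.p_mul, map_mul, uaut_phase, ← mul_assoc, ← (phase_commute _ (D.p 0 a)).eq, mul_assoc]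
    _ = phase (D.ω b c * D.ω a (b * c)) * D.p 0 (a * (b * c)) := by
        rw [D.p_mul, map_mul, mul_assoc]

/-- The next cut of the same strip. -/
def above : ℤ × ℤ ≃ ℤ × ℤ := (Equiv.refl ℤ).prodCongr (Equiv.addRight 1)

/-- The neighbouring column. -/
def right : ℤ × ℤ ≃ ℤ × ℤ := (Equiv.addRight 1).prodCongr (Equiv.refl ℤ)

theorem above_apply (a : ℤ × ℤ) : above a = (a.1, a.2 + 1) := rfl

theorem right_apply (a : ℤ × ℤ) : right a = (a.1 + 1, a.2) := rfl

theorem ne_or_lt {a b : ℤ × ℤ} (h : a ≠ b) : a.1 ≠ b.1 ∨ a.2 < b.2 ∨ b.2 < a.2 := by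
  by_contra hcon
  push Not at hcon
  exact h (Prod.ext hcon.1 (le_antisymm hcon.2.2 hcon.2.1))

/-- Decompositions of symmetric circuits on disjoint strips `[x, N x] × ℤ` of bounded width. The
strips are labelled by their left ends `x ∈ s`; the data at all other `x` are trivial. -/
structure Stripes (β : OnSiteSymmetry G S) where
  s : Set ℤ
  N : ℤ → ℤ
  width : ℕ
  r : ℕ
  r_pos : 0 < r
  le : ∀ x, x ≤ N x
  N_le : ∀ x, N x ≤ x + width
  disj : ∀ x ∈ s, ∀ x' ∈ s, x ≠ x' → Disjoint (Set.Icc x (N x)) (Set.Icc x' (N x'))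
  D : ∀ x, StripData β x (N x) r
  trivial : ∀ x ∉ s, D x = StripData.trivial β x (N x) r

namespace Stripes

variable (F : Stripes β)

/-- The site of the control for the cut `a.2` of the strip with left end `a.1`. -/
def anc (a : ℤ × ℤ) : Site := (a.1, 2 * F.r * a.2)

/-- The part of the strip with left end `x` between the heights `a` and `b`. -/
def blk (x a b : ℤ) : Set Site := {j | x ∈ F.s ∧ j ∈ box x (F.N x) a b}

theorem blk_disjoint {x a b x' a' b' : ℤ} (h : x ≠ x' ∨ b ≤ a' ∨ b' ≤ a) :
    Disjoint (F.blk x a b) (F.blk x' a' b') := by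
  rw [Set.disjoint_left]
  rintro j ⟨hx, hj⟩ ⟨hx', hj'⟩
  by_cases hxx : x = x'
  · rw [mem_box] at hj hj'
    omega
  · exact (F.disj x hx x' hx' hxx).ne_of_mem hj.1 hj'.1 rfl

/-- The surroundings of a cut. -/
def nearCut (a : ℤ × ℤ) : Set Site :=
  F.blk a.1 (2 * F.r * a.2 - F.r) (2 * F.r * a.2 + F.r)

/-- The sites between two cuts. -/
def between (a : ℤ × ℤ) : Set Site := F.blk a.1 (2 * F.r * a.2) (2 * F.r * (a.2 + 1))

theorem cut_le {k k' : ℤ} (h : k < k') : 2 * (F.r : ℤ) * (k + 1) ≤ 2 * F.r * k' := by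
  have : (0 : ℤ) ≤ F.r := by positivity
  exact mul_le_mul_of_nonneg_left h (by positivity)

theorem cut_add (k : ℤ) : 2 * (F.r : ℤ) * (k + 1) = 2 * F.r * k + F.r + F.r := by ring

theorem nearCut_disjoint : Pairwise fun a b => Disjoint (F.nearCut a) (F.nearCut b) := by
  intro a b hab
  refine F.blk_disjoint ((ne_or_lt hab).imp_right (Or.imp (fun h => ?_) fun h => ?_)) <;>
  · have h1 := F.cut_le h
    rw [F.cut_add] at h1
    omega

theorem between_disjoint : Pairwise fun a b => Disjoint (F.between a) (F.between b) := by
  intro a b hab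
  exact F.blk_disjoint ((ne_or_lt hab).imp_right (Or.imp F.cut_le F.cut_le))

/-- A bounded region around the cut `a.2` in the column `a.1`. -/
def nbhd (a : ℤ × ℤ) : Set Site :=
  {j | (a.1 ≤ j.1 ∧ j.1 ≤ a.1 + F.width + 1) ∧
    2 * F.r * a.2 - F.r ≤ j.2 ∧ j.2 ≤ 2 * F.r * (a.2 + 1) + F.r}

theorem finite_nbhd (j : Site) : {a | j ∈ F.nbhd a}.Finite := by
  refine (Set.finite_Icc ((j.1 - F.width - 1, -(|j.2| + F.r + 1)) : ℤ × ℤ)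
    (j.1, |j.2| + F.r + 1)).subset ?_
  rintro a ⟨⟨h1, h2⟩, h3, h4⟩
  have hr : (1 : ℤ) ≤ F.r := by exact_mod_cast F.r_pos
  refine ⟨⟨by omega, ?_⟩, ⟨h1, ?_⟩⟩
  · change -(|j.2| + F.r + 1) ≤ a.2
    by_contra hcon
    have h5 : a.2 + 1 < 0 := by
      have := abs_nonneg j.2
      omega
    have h6 : 2 * (F.r : ℤ) * (a.2 + 1) ≤ 1 * (a.2 + 1) :=
      mul_le_mul_of_nonpos_right (by omega) h5.le
    have := neg_abs_le j.2
    omega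
  · change a.2 ≤ |j.2| + F.r + 1
    by_contra hcon
    have h5 : 0 < a.2 := by
      have := abs_nonneg j.2
      omega
    have h6 : 1 * a.2 ≤ 2 * (F.r : ℤ) * a.2 :=
      mul_le_mul_of_nonneg_right (by omega) h5.le
    have := le_abs_self j.2
    omega

theorem box_subset_nbhd (a : ℤ × ℤ) {m n b d : ℤ} (hm : a.1 ≤ m) (hn : n ≤ F.N a.1)
    (hb : 2 * F.r * a.2 - F.r ≤ b) (hd : d ≤ 2 * F.r * (a.2 + 1) + F.r) :
    box m n b d ⊆ F.nbhd a := by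
  intro j hj
  have := F.N_le a.1
  rw [mem_box] at hj
  refine ⟨⟨?_, ?_⟩, ?_, ?_⟩ <;> omega

theorem anc_mem_nbhd (a : ℤ × ℤ) : F.anc a ∈ F.nbhd a := by
  have h := F.cut_add a.2
  refine ⟨⟨le_rfl, ?_⟩, ?_, ?_⟩ <;> simp only [anc] <;> omega

theorem anc_above_mem_nbhd (a : ℤ × ℤ) : F.anc (above a) ∈ F.nbhd a := by
  have h := F.cut_add a.2
  refine ⟨⟨le_rfl, ?_⟩, ?_, ?_⟩ <;> simp only [anc, above_apply] <;> omega

theorem anc_right_mem_nbhd (a : ℤ × ℤ) : F.anc (right a) ∈ F.nbhd a := by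
  have h := F.cut_add a.2
  refine ⟨⟨?_, ?_⟩, ?_, ?_⟩ <;> simp only [anc, right_apply] <;> omega

/-- A unitary on a strip that is trivial unless the strip is present. -/
theorem mem_blk {x a b : ℤ} {u : unitary S.Alg} (hu : u ∈ S.usupp (box x (F.N x) a b))
    (h1 : x ∉ F.s → u = 1) : u ∈ S.usupp (F.blk x a b) := by
  by_cases hx : x ∈ F.s
  · have hsub : box x (F.N x) a b ⊆ F.blk x a b := fun j hj => ⟨hx, hj⟩
    exact usupp_mono hsub hu
  · rw [h1 hx]
    exact one_mem _

end Stripes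

variable [Fintype G]

/-- Decompositions of symmetric circuits on strips that commute with a clock. -/
structure StripeFamily (c : Clock β) extends Stripes β where
  W_mem_C : ∀ x k, (D x).W k ∈ c.C
  X_mem_C : ∀ x k, (D x).X k ∈ c.C
  p_mem_C : ∀ x k g, (D x).p k g ∈ c.C
  q_mem_C : ∀ x k g, (D x).q k g ∈ c.C

namespace StripeFamily

variable {c : Clock β} (F : StripeFamily c)

/-- The cutting unitary at the cut `a.2` of the strip with left end `a.1`. -/
def W (a : ℤ × ℤ) : c.C := ⟨(F.D a.1).W a.2, F.W_mem_C _ _⟩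

/-- The unitary between the cuts `a.2` and `a.2 + 1` of the strip with left end `a.1`. -/
def X (a : ℤ × ℤ) : c.C := ⟨(F.D a.1).X a.2, F.X_mem_C _ _⟩

/-- The factor of the coboundary of `W a` supported below the cut. -/
def p (a : ℤ × ℤ) (g : G) : c.C := ⟨(F.D a.1).p a.2 g, F.p_mem_C _ _ _⟩

/-- The factor of the coboundary of `W a` supported above the cut. -/
def q (a : ℤ × ℤ) (g : G) : c.C := ⟨(F.D a.1).q a.2 g, F.q_mem_C _ _ _⟩

theorem W_eq (a : ℤ × ℤ) (g : G) : F.W a = F.p a g * F.q a g * c.act g (F.W a) :=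
  Subtype.ext ((F.D a.1).W_eq a.2 g)

theorem p_mul (a : ℤ × ℤ) (g h : G) :
    F.p a g * c.act g (F.p a h) = c.ph ((F.D a.1).ω g h) * F.p a (g * h) :=
  Subtype.ext ((F.D a.1).p_mul a.2 g h)

theorem q_mul (a : ℤ × ℤ) (g h : G) :
    c.ph ((F.D a.1).ω g h) * (F.q a g * c.act g (F.q a h)) = F.q a (g * h) :=
  Subtype.ext ((F.D a.1).q_mul a.2 g h)

theorem X_eq (a : ℤ × ℤ) (g : G) : F.X a = F.q a g * F.p (above a) g * c.act g (F.X a) :=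
  Subtype.ext ((F.D a.1).X_eq a.2 g)

theorem mem_core_blk {x a b a' b' : ℤ} {u : c.C}
    (hu : (u : unitary S.Alg) ∈ S.usupp (box x (F.N x) a b))
    (h1 : x ∉ F.s → u = 1) (ha : a' ≤ a) (hb : b ≤ b') : u ∈ c.core (F.blk x a' b') := by
  by_cases hx : x ∈ F.s
  · have hsub : box x (F.N x) a b ⊆ F.blk x a' b' := fun j hj =>
      ⟨hx, hj.1, ha.trans_lt hj.2.1, hj.2.2.trans hb⟩
    exact c.mem_core (usupp_mono hsub hu)
  · rw [h1 hx]
    exact one_mem _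

theorem W_eq_one {a : ℤ × ℤ} (h : a.1 ∉ F.s) : F.W a = 1 :=
  Subtype.ext (by change (F.D a.1).W a.2 = 1; rw [F.trivial _ h]; rfl)

theorem X_eq_one {a : ℤ × ℤ} (h : a.1 ∉ F.s) : F.X a = 1 :=
  Subtype.ext (by change (F.D a.1).X a.2 = 1; rw [F.trivial _ h]; rfl)

theorem p_eq_one {a : ℤ × ℤ} (h : a.1 ∉ F.s) (g : G) : F.p a g = 1 :=
  Subtype.ext (by change (F.D a.1).p a.2 g = 1; rw [F.trivial _ h]; rfl)

theorem q_eq_one {a : ℤ × ℤ} (h : a.1 ∉ F.s) (g : G) : F.q a g = 1 :=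
  Subtype.ext (by change (F.D a.1).q a.2 g = 1; rw [F.trivial _ h]; rfl)

theorem ω_eq_one {x : ℤ} (h : x ∉ F.s) : (F.D x).ω = 1 := by
  rw [F.trivial _ h]; rfl

theorem W_core (a : ℤ × ℤ) : F.W a ∈ c.core (F.nearCut a) :=
  F.mem_core_blk ((F.D a.1).W_mem a.2) F.W_eq_one le_rfl le_rfl

theorem X_core (a : ℤ × ℤ) : F.X a ∈ c.core (F.between a) :=
  F.mem_core_blk ((F.D a.1).X_mem a.2) F.X_eq_one le_rfl le_rfl

theorem p_core (a : ℤ × ℤ) (g : G) : F.p a g ∈ c.core (F.nearCut a) :=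
  F.mem_core_blk ((F.D a.1).p_mem a.2 g) (fun h => F.p_eq_one h g) le_rfl (by omega)

theorem q_core (a : ℤ × ℤ) (g : G) : F.q a g ∈ c.core (F.nearCut a) :=
  F.mem_core_blk ((F.D a.1).q_mem a.2 g) (fun h => F.q_eq_one h g) (by omega) le_rfl

theorem q_core' (a : ℤ × ℤ) (g : G) : F.q a g ∈ c.core (F.between a) :=
  F.mem_core_blk ((F.D a.1).q_mem a.2 g) (fun h => F.q_eq_one h g) le_rfl
    (by rw [F.cut_add]; omega)

theorem p_core' (a : ℤ × ℤ) (g : G) : F.p (above a) g ∈ c.core (F.between a) :=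
  F.mem_core_blk ((F.D a.1).p_mem (a.2 + 1) g) (fun h => F.p_eq_one (a := above a) h g)
    (by rw [F.cut_add]; omega) le_rfl

theorem q_commute_p (a : ℤ × ℤ) (g h : G) : Commute (F.q a g) (F.p (above a) h) := by
  refine c.core_commute (F.nearCut_disjoint fun h => ?_) (F.q_core a g) (F.p_core (above a) h)
  have := congrArg Prod.snd h
  rw [above_apply] at this
  omega

theorem W_nbhd (a : ℤ × ℤ) : (F.W a : unitary S.Alg) ∈ S.usupp (F.nbhd a) := by
  have h := F.cut_add a.2
  exact usupp_mono (F.box_subset_nbhd a le_rfl le_rfl le_rfl (by omega)) ((F.D a.1).W_mem a.2)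

theorem X_nbhd (a : ℤ × ℤ) : (F.X a : unitary S.Alg) ∈ S.usupp (F.nbhd a) :=
  usupp_mono (F.box_subset_nbhd a le_rfl le_rfl (by omega) (by omega)) ((F.D a.1).X_mem a.2)

theorem p_nbhd (a : ℤ × ℤ) (g : G) : (F.p a g : unitary S.Alg) ∈ S.usupp (F.nbhd a) := by
  have h := F.cut_add a.2
  exact usupp_mono (F.box_subset_nbhd a le_rfl le_rfl le_rfl (by omega)) ((F.D a.1).p_mem a.2 g)

theorem q_nbhd (a : ℤ × ℤ) (g : G) : (F.q a g : unitary S.Alg) ∈ S.usupp (F.nbhd a) := by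
  have h := F.cut_add a.2
  exact usupp_mono (F.box_subset_nbhd a le_rfl le_rfl (by omega) (by omega))
    ((F.D a.1).q_mem a.2 g)

end StripeFamily

/-! ### Products of families of unitaries -/

/-- `γ` is the product of the inner automorphisms given by the family `u`. -/
def IsProd (c : Clock β) (u : ℤ × ℤ → c.C) (γ : S.Aut) : Prop :=
  IsInfProd (fun a => Ad (u a : unitary S.Alg)) γ

namespace IsProd

variable {c : Clock β} {u v : ℤ × ℤ → c.C} {γ δ : S.Aut}

theorem commute_Ad_coe {x y : c.C} (h : Commute x y) :
    Commute (Ad (x : unitary S.Alg)) (Ad (y : unitary S.Alg)) :=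
  commute_Ad (h.map c.C.subtype)

theorem unique (h : IsProd c u γ) (h' : IsProd c v δ) (huv : ∀ a, u a = v a) : γ = δ := by
  obtain rfl : u = v := funext huv
  exact IsInfProd.unique h h'

theorem congr (h : IsProd c u γ) (huv : ∀ a, u a = v a) : IsProd c v γ := by
  obtain rfl : u = v := funext huv
  exact h

theorem mul (h : IsProd c u γ) (h' : IsProd c v δ)
    (hc : Pairwise fun a b => Commute (v a) (u b)) : IsProd c (fun a => u a * v a) (γ * δ) := by
  have := IsInfProd.mul h h' fun a b hab => commute_Ad_coe (hc hab)
  change IsInfProd (fun a => Ad ((u a : unitary S.Alg) * (v a : unitary S.Alg))) _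
  simpa only [map_mul] using this

theorem inv (h : IsProd c u γ) : IsProd c (fun a => (u a)⁻¹) γ⁻¹ := by
  have := IsInfProd.inv h
  change IsInfProd (fun a => Ad (u a : unitary S.Alg)⁻¹) _
  simpa only [map_inv] using this

theorem reindex (h : IsProd c u γ) (e : ℤ × ℤ ≃ ℤ × ℤ) : IsProd c (fun a => u (e a)) γ :=
  IsInfProd.reindex h e

theorem exists_of_nbhd (F : StripeFamily c) (hu : ∀ a, (u a : unitary S.Alg) ∈ S.usupp (F.nbhd a))
    (hc : Pairwise fun a b => Commute (u a) (u b)) : ∃ γ, IsProd c u γ :=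
  exists_isInfProd_Ad F.finite_nbhd hu fun _ _ hab => (hc hab).map c.C.subtype

end IsProd

end SpinSystem

namespace SpinSystem

variable {S : SpinSystem} {G : Type*} [Group G] {β : OnSiteSymmetry G S} [Fintype G]

theorem Clock.pairwise_commute (c : Clock β) {K : ℤ × ℤ → Set Site}
    (hK : Pairwise fun a b => Disjoint (K a) (K b)) {u v : ℤ × ℤ → c.C}
    (hu : ∀ a, u a ∈ c.core (K a)) (hv : ∀ a, v a ∈ c.core (K a)) :
    Pairwise fun a b => Commute (u a) (v b) := fun a b hab =>
  c.core_commute (hK hab) (hu a) (hv b)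

namespace StripeFamily

variable {c : Clock β} (F : StripeFamily c)

/-! ### Symmetric gates -/

/-- The controlled unitary built from the factors of the coboundaries above the cut. -/
def qc (a : ℤ × ℤ) : c.C := c.control.ctrl (F.anc a) fun g => (F.q a g)⁻¹

/-- The controlled unitary built from the factors of the coboundaries below the cut. -/
def pc (a : ℤ × ℤ) : c.C := c.control.ctrl (F.anc a) fun g => (F.p a g)⁻¹

/-- The symmetrization of the cutting unitary. -/
def Z (a : ℤ × ℤ) : c.C := c.control.symm (F.anc a) (F.W a)

/-- The link unitary along the strip. -/
def vlink (n : ℤ → G → G → Circle) (a : ℤ × ℤ) : c.C :=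
  c.control.link (F.anc a) (F.anc (above a)) (n a.1)

/-- The link unitary between neighbouring columns. -/
def hlink (n : ℤ → G → G → Circle) (a : ℤ × ℤ) : c.C :=
  c.control.link (F.anc a) (F.anc (right a)) (n a.1)

/-- The symmetric version of the unitary between two cuts. -/
def Xs (a : ℤ × ℤ) : c.C :=
  c.control.dressed (F.anc a) (F.anc (above a)) (F.p (above a)) (F.q a) (F.X a) (F.D a.1).ω

/-- The plaquette unitary between neighbouring columns. -/
def P (n : ℤ → G → G → Circle) (a : ℤ × ℤ) : c.C :=
  c.control.plaquette (F.anc a) (F.anc (above a)) (F.anc (above (right a))) (F.anc (right a))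
    (n a.1)

theorem Z_eq (a : ℤ × ℤ) : F.Z a = F.qc a * (F.pc a * F.W a) :=
  c.control.symm_eq (F.W_eq a) (F.anc a)

theorem Xs_eq (a : ℤ × ℤ) :
    F.Xs a = (F.vlink (fun x => (F.D x).ω) a)⁻¹ * (F.qc a * F.pc (above a) * F.X a) := rfl

theorem P_eq (n : ℤ → G → G → Circle) (a : ℤ × ℤ) :
    F.P n a = F.vlink n a * F.hlink n (above a) *
      (F.vlink (fun x => n (x - 1)) (right a))⁻¹ * (F.hlink n a)⁻¹ := by
  rw [P, Control.plaquette, vlink, vlink, hlink, hlink]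
  have h1 : n ((right a).1 - 1) = n a.1 := by rw [right_apply, add_sub_cancel_right]
  rw [h1]
  rfl

theorem act_Z (g : G) (a : ℤ × ℤ) : c.act g (F.Z a) = F.Z a := c.control.act_symm g _ _

theorem act_Xs (g : G) (a : ℤ × ℤ) : c.act g (F.Xs a) = F.Xs a :=
  c.control.act_dressed (F.D a.1).ω_mem_cocycles (F.p_mul (above a)) (F.q_mul a) (F.X_eq a)
    (F.q_commute_p a) g _ _

theorem act_P {n : ℤ → G → G → Circle} (hn : ∀ x, n x ∈ cocycles G) (g : G) (a : ℤ × ℤ) :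
    c.act g (F.P n a) = F.P n a := c.control.act_plaquette g _ _ _ _ (hn a.1)

theorem qc_core (a : ℤ × ℤ) : F.qc a ∈ c.core (F.nearCut a) :=
  c.ctrl_mem_core _ fun g => inv_mem (F.q_core a g)

theorem qc_core' (a : ℤ × ℤ) : F.qc a ∈ c.core (F.between a) :=
  c.ctrl_mem_core _ fun g => inv_mem (F.q_core' a g)

theorem pc_core (a : ℤ × ℤ) : F.pc a ∈ c.core (F.nearCut a) :=
  c.ctrl_mem_core _ fun g => inv_mem (F.p_core a g)

theorem pc_core' (a : ℤ × ℤ) : F.pc (above a) ∈ c.core (F.between a) :=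
  c.ctrl_mem_core _ fun g => inv_mem (F.p_core' a g)

theorem vlink_commute (n : ℤ → G → G → Circle) (a : ℤ × ℤ) (u : c.C) :
    Commute (F.vlink n a) u := c.control.link_commute _ _ _ u

theorem hlink_commute (n : ℤ → G → G → Circle) (a : ℤ × ℤ) (u : c.C) :
    Commute (F.hlink n a) u := c.control.link_commute _ _ _ u

theorem qc_nbhd (a : ℤ × ℤ) : (F.qc a : unitary S.Alg) ∈ S.usupp (F.nbhd a) :=
  c.ctrl_mem (F.anc_mem_nbhd a) fun g => inv_mem (F.q_nbhd a g)

theorem pc_nbhd (a : ℤ × ℤ) : (F.pc a : unitary S.Alg) ∈ S.usupp (F.nbhd a) :=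
  c.ctrl_mem (F.anc_mem_nbhd a) fun g => inv_mem (F.p_nbhd a g)

theorem vlink_nbhd (n : ℤ → G → G → Circle) (a : ℤ × ℤ) :
    (F.vlink n a : unitary S.Alg) ∈ S.usupp (F.nbhd a) :=
  c.link_mem (F.anc_mem_nbhd a) (F.anc_above_mem_nbhd a) _

theorem hlink_nbhd (n : ℤ → G → G → Circle) (a : ℤ × ℤ) :
    (F.hlink n a : unitary S.Alg) ∈ S.usupp (F.nbhd a) :=
  c.link_mem (F.anc_mem_nbhd a) (F.anc_right_mem_nbhd a) _

/-- The product of the link unitaries along the strips is a product of plaquette unitaries: the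
links between neighbouring columns cancel, and the links along a column add up to its cocycle. -/
theorem exists_prod_P {n : ℤ → G → G → Circle} (hn : ∀ x, n x = (F.D x).ω * n (x - 1)) :
    ∃ L, IsProd c (F.vlink fun x => (F.D x).ω) L ∧ IsProd c (F.P n) L := by
  obtain ⟨L, hL⟩ := IsProd.exists_of_nbhd F (F.vlink_nbhd fun x => (F.D x).ω)
    fun a b _ => F.vlink_commute _ a _
  obtain ⟨V, hV⟩ := IsProd.exists_of_nbhd F (F.vlink_nbhd fun x => n (x - 1))
    fun a b _ => F.vlink_commute _ a _
  obtain ⟨H, hH⟩ := IsProd.exists_of_nbhd F (F.hlink_nbhd n) fun a b _ => F.hlink_commute _ a _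
  have hLV := hL.mul hV fun a b _ => F.vlink_commute _ a _
  have hVr := hV.reindex right
  have hHa := hH.reindex above
  have h1 := ((hLV.mul hHa fun a b _ => F.hlink_commute _ _ _).mul hVr.inv
    fun a b _ => (F.vlink_commute _ _ _).inv_left).mul hH.inv
      fun a b _ => (F.hlink_commute _ _ _).inv_left
  have hVH : V * H = H * V := (hV.mul hH fun a b _ => F.hlink_commute _ _ _).unique
    (hH.mul hV fun a b _ => F.vlink_commute _ _ _) fun a => F.vlink_commute _ a _
  have hcancel : L * V * H * V⁻¹ * H⁻¹ = L := by
    rw [mul_assoc L, hVH]; group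
  rw [hcancel] at h1
  refine ⟨L, hL, ?_⟩
  refine h1.congr fun a => ?_
  have h2 : F.vlink n a = F.vlink (fun x => (F.D x).ω) a * F.vlink (fun x => n (x - 1)) a := by
    rw [vlink, hn a.1]
    exact c.control.link_mul _ _ _ _
  rw [P_eq, h2]

/-- The striped automorphism is a product of two automorphisms with symmetric gates and of the links
along the strips: the controlled unitaries of `p⁻¹` and `q⁻¹` that symmetrize the cutting unitaries
cancel against those that dress the unitaries between the cuts. -/
theorem eq_prod {A B L : S.Aut} (hA : IsProd c F.W A) (hB : IsProd c F.X B)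
    (hL : IsProd c (F.vlink fun x => (F.D x).ω) L) :
    ∃ Y Y', IsProd c F.Z Y ∧ IsProd c F.Xs Y' ∧ A⁻¹ * B = Y⁻¹ * L * Y' := by
  have hN := F.nearCut_disjoint
  have hM := F.between_disjoint
  obtain ⟨Q, hQ⟩ := IsProd.exists_of_nbhd F F.qc_nbhd
    (c.pairwise_commute hN F.qc_core F.qc_core)
  obtain ⟨R, hR⟩ := IsProd.exists_of_nbhd F F.pc_nbhd
    (c.pairwise_commute hN F.pc_core F.pc_core)
  have hZ := hQ.mul (hR.mul hA (c.pairwise_commute hN F.W_core F.pc_core))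
    (c.pairwise_commute hN (fun a => mul_mem (F.pc_core a) (F.W_core a)) F.qc_core)
  have hX := hL.inv.mul ((hQ.mul (hR.reindex above)
    (c.pairwise_commute hM F.pc_core' F.qc_core')).mul hB
      (c.pairwise_commute hM F.X_core fun a => mul_mem (F.qc_core' a) (F.pc_core' a)))
    fun a b _ => (F.vlink_commute _ b _).symm.inv_right
  refine ⟨_, _, hZ.congr fun a => (F.Z_eq a).symm, hX.congr fun a => (F.Xs_eq a).symm, ?_⟩
  group

/-! ### The symmetric circuit -/

theorem isSymmetric_coe {u : c.C} (h : ∀ g, c.act g u = u) (g : G) :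
    β.toHom g ((u : unitary S.Alg) : S.Alg) = (u : unitary S.Alg) :=
  congrArg (fun v : c.C => ((v : unitary S.Alg) : S.Alg)) (h g)

theorem ncard_Icc_le {lo hi : Site} {A B : ℕ} (h1 : hi.1 ≤ lo.1 + A) (h2 : hi.2 ≤ lo.2 + B) :
    (Set.Icc lo hi).ncard ≤ (A + 1) * (B + 1) := by
  rw [← Finset.coe_Icc, Set.ncard_coe_finset, Finset.card_Icc_prod, Int.card_Icc, Int.card_Icc]
  exact Nat.mul_le_mul (by omega) (by omega)

theorem Icc_disjoint_of_snd {lo hi lo' hi' : Site} (h : hi.2 < lo'.2 ∨ hi'.2 < lo.2) :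
    Disjoint (Set.Icc lo hi) (Set.Icc lo' hi') :=
  Set.disjoint_left.2 fun j hj hj' => by
    have h1 := hj.1.2
    have h2 := hj.2.2
    have h3 := hj'.1.2
    have h4 := hj'.2.2
    omega

theorem Icc_disjoint_of_fst {lo hi lo' hi' : Site}
    (h : Disjoint (Set.Icc lo.1 hi.1) (Set.Icc lo'.1 hi'.1)) :
    Disjoint (Set.Icc lo hi) (Set.Icc lo' hi') :=
  Set.disjoint_left.2 fun _ hj hj' => h.ne_of_mem ⟨hj.1.1, hj.2.1⟩ ⟨hj'.1.1, hj'.2.1⟩ rfl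

/-- Products of symmetric gates on finitely coloured bounded rectangles are symmetric circuits. -/
theorem isSymmetricCircuit_of_isProd {u : ℤ × ℤ → c.C} {γ : S.Aut} (hγ : IsProd c u γ)
    (hu : ∀ g a, c.act g (u a) = u a) {lo hi : ℤ × ℤ → Site} {s : Set (ℤ × ℤ)} {m : ℕ}
    {col : ℤ × ℤ → ℕ} (hcm : ∀ a, col a < m) (hle : ∀ a ∈ s, lo a ≤ hi a)
    (hdisj : ∀ a ∈ s, ∀ b ∈ s, a ≠ b → col a = col b →
      Disjoint (Set.Icc (lo a) (hi a)) (Set.Icc (lo b) (hi b)))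
    {A B : ℕ} (hN : ∀ a ∈ s, (hi a).1 ≤ (lo a).1 + A ∧ (hi a).2 ≤ (lo a).2 + B)
    (hV : ∀ a ∈ s, (u a : unitary S.Alg) ∈ S.usupp (Set.Icc (lo a) (hi a)))
    (h1 : ∀ a ∉ s, u a = 1) (hcomm : Pairwise fun a b => Commute (u a) (u b)) :
    SymmetricEntangler.IsSymmetricCircuit β γ :=
  isCircuit_of_isInfProd hcm hle hdisj
    ⟨(A + 1) * (B + 1), fun a ha => ncard_Icc_le (hN a ha).1 (hN a ha).2⟩ hV
    (fun a _ => isSymmetric_coe fun g => hu g a) (fun a ha => by rw [h1 a ha]; rfl)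
    (fun g => map_one (β.toHom g)) (fun _ _ hab => (hcomm hab).map c.C.subtype) hγ

theorem Z_circuit {γ : S.Aut} (hγ : IsProd c F.Z γ) :
    SymmetricEntangler.IsSymmetricCircuit β γ := by
  have hr : (1 : ℤ) ≤ F.r := by exact_mod_cast F.r_pos
  refine isSymmetricCircuit_of_isProd hγ F.act_Z
    (lo := fun a => (a.1, 2 * F.r * a.2 - F.r + 1)) (hi := fun a => (F.N a.1, 2 * F.r * a.2 + F.r))
    (s := {a | a.1 ∈ F.s}) (m := 1) (col := fun _ => 0) (A := F.width) (B := 2 * F.r)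
    (fun _ => one_pos) (fun a _ => ⟨F.le a.1, ?_⟩) (fun a ha b hb hab _ => ?_)
    (fun a _ => ⟨F.N_le a.1, ?_⟩) (fun a _ => ?_) (fun a ha => ?_)
    (c.pairwise_commute F.nearCut_disjoint ?_ ?_)
  · simp only; omega
  · by_cases h1 : a.1 = b.1
    · refine Icc_disjoint_of_snd ((ne_or_lt hab).resolve_left (fun h => h h1) |>.imp
        (fun h => ?_) fun h => ?_) <;>
      · have h2 := F.cut_le h
        rw [F.cut_add] at h2
        simp only
        omega
    · exact Icc_disjoint_of_fst (F.disj a.1 ha b.1 hb h1)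
  · simp only; push_cast; omega
  · rw [← box_eq_Icc]
    refine c.ctrl_mem ?_ fun g => uaut_mem (β.mem_stab g _) ((F.D a.1).W_mem a.2)
    have := F.le a.1
    refine ⟨⟨le_rfl, this⟩, ?_, ?_⟩ <;> simp only [Stripes.anc] <;> omega
  · have h2 : ∀ g, c.control.act g 1 = 1 := fun g => map_one _
    rw [Z, F.W_eq_one ha, Control.symm]
    simp only [h2]
    exact c.control.ctrl_one _
  all_goals
    intro a
    rw [F.Z_eq]
    exact mul_mem (F.qc_core a) (mul_mem (F.pc_core a) (F.W_core a))

theorem qc_eq_one {a : ℤ × ℤ} (h : a.1 ∉ F.s) : F.qc a = 1 := by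
  simp only [qc, F.q_eq_one h, inv_one]
  exact c.control.ctrl_one _

theorem pc_eq_one {a : ℤ × ℤ} (h : a.1 ∉ F.s) : F.pc a = 1 := by
  simp only [pc, F.p_eq_one h, inv_one]
  exact c.control.ctrl_one _

theorem Xs_circuit {γ : S.Aut} (hγ : IsProd c F.Xs γ) :
    SymmetricEntangler.IsSymmetricCircuit β γ := by
  -- two colours, as the supports of consecutive gates of a strip share the control at the common cut
  have hr : (1 : ℤ) ≤ F.r := by exact_mod_cast F.r_pos
  refine isSymmetricCircuit_of_isProd hγ F.act_Xs
    (lo := fun a => (a.1, 2 * F.r * a.2)) (hi := fun a => (F.N a.1, 2 * F.r * (a.2 + 1)))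
    (s := {a | a.1 ∈ F.s}) (m := 2) (col := fun a => (a.2 % 2).toNat) (A := F.width)
    (B := 2 * F.r) (fun _ => by omega) (fun a _ => ⟨F.le a.1, ?_⟩) (fun a ha b hb hab hc => ?_)
    (fun a _ => ⟨F.N_le a.1, ?_⟩) (fun a _ => ?_) (fun a ha => ?_)
    (c.pairwise_commute F.between_disjoint ?_ ?_)
  · simp only [F.cut_add]; omega
  · by_cases h1 : a.1 = b.1
    · refine Icc_disjoint_of_snd ((ne_or_lt hab).resolve_left (fun h => h h1) |>.imp
        (fun h => ?_) fun h => ?_)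
      · have h2 := F.cut_le (k := a.2 + 1) (k' := b.2) (by omega)
        rw [F.cut_add] at h2
        simp only
        omega
      · have h2 := F.cut_le (k := b.2 + 1) (k' := a.2) (by omega)
        rw [F.cut_add] at h2
        simp only
        omega
    · exact Icc_disjoint_of_fst (F.disj a.1 ha b.1 hb h1)
  · simp only [F.cut_add]; push_cast; omega
  · have h2 := F.cut_add a.2
    have h3 := F.le a.1
    have hsub {b d : ℤ} (hb : 2 * F.r * a.2 ≤ b) (hd : d ≤ 2 * F.r * (a.2 + 1)) :
        box a.1 (F.N a.1) b d ⊆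
          Set.Icc ((a.1, 2 * F.r * a.2) : Site) (F.N a.1, 2 * F.r * (a.2 + 1)) := by
      rintro j ⟨⟨j1, j2⟩, j3, j4⟩
      exact ⟨⟨j1, by simp only; omega⟩, j2, by simp only; omega⟩
    have hanc : F.anc a ∈ Set.Icc ((a.1, 2 * F.r * a.2) : Site) (F.N a.1, 2 * F.r * (a.2 + 1)) :=
      ⟨le_rfl, h3, by simp only [Stripes.anc]; omega⟩
    have hanc' : F.anc (above a) ∈
        Set.Icc ((a.1, 2 * F.r * a.2) : Site) (F.N a.1, 2 * F.r * (a.2 + 1)) :=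
      ⟨⟨le_rfl, by simp only [Stripes.anc, above_apply]; omega⟩, h3, le_rfl⟩
    rw [F.Xs_eq]
    refine mul_mem (inv_mem (c.link_mem hanc hanc' _)) (mul_mem (mul_mem ?_ ?_) ?_)
    · exact c.ctrl_mem hanc fun g => inv_mem
        (usupp_mono (hsub le_rfl (by omega)) ((F.D a.1).q_mem a.2 g))
    · exact c.ctrl_mem hanc' fun g => inv_mem
        (usupp_mono (hsub (by omega) le_rfl) ((F.D a.1).p_mem (a.2 + 1) g))
    · exact usupp_mono (hsub le_rfl le_rfl) ((F.D a.1).X_mem a.2)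
  · have h2 : F.vlink (fun x => (F.D x).ω) a = 1 := by
      rw [vlink, F.ω_eq_one ha]
      exact c.control.link_one _ _
    rw [F.Xs_eq, h2, F.qc_eq_one ha, F.pc_eq_one (a := above a) ha, F.X_eq_one ha]
    simp
  all_goals
    intro a
    rw [F.Xs_eq]
    exact mul_mem (inv_mem (c.link_mem_core _ _ _ _))
      (mul_mem (mul_mem (F.qc_core' a) (F.pc_core' a)) (F.X_core a))

theorem P_circuit {n : ℤ → G → G → Circle} (hn : ∀ x, n x ∈ cocycles G) {γ : S.Aut}
    (hγ : IsProd c (F.P n) γ) : SymmetricEntangler.IsSymmetricCircuit β γ := by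
  -- four colours, as neighbouring plaquettes share a link or a corner
  have hr : (1 : ℤ) ≤ F.r := by exact_mod_cast F.r_pos
  have hcore (a : ℤ × ℤ) (K : Set Site) : F.P n a ∈ c.core K :=
    mul_mem (mul_mem (mul_mem (c.link_mem_core _ _ _ _) (c.link_mem_core _ _ _ _))
      (inv_mem (c.link_mem_core _ _ _ _))) (inv_mem (c.link_mem_core _ _ _ _))
  refine isSymmetricCircuit_of_isProd hγ (F.act_P hn)
    (lo := fun a => (a.1, 2 * F.r * a.2)) (hi := fun a => (a.1 + 1, 2 * F.r * (a.2 + 1)))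
    (s := Set.univ) (m := 4) (col := fun a => (a.1 % 2).toNat + 2 * (a.2 % 2).toNat) (A := 1)
    (B := 2 * F.r) (fun _ => by omega) (fun a _ => ⟨?_, ?_⟩) (fun a _ b _ hab hc => ?_)
    (fun a _ => ⟨le_rfl, ?_⟩) (fun a _ => ?_) (fun a ha => absurd (Set.mem_univ a) ha)
    (c.pairwise_commute F.between_disjoint (fun a => hcore a _) fun a => hcore a _)
  · simp only; omega
  · simp only [F.cut_add]; omega
  · by_cases h1 : a.1 = b.1
    · refine Icc_disjoint_of_snd ((ne_or_lt hab).resolve_left (fun h => h h1) |>.imp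
        (fun h => ?_) fun h => ?_)
      · have h2 := F.cut_le (k := a.2 + 1) (k' := b.2) (by omega)
        rw [F.cut_add] at h2
        simp only
        omega
      · have h2 := F.cut_le (k := b.2 + 1) (k' := a.2) (by omega)
        rw [F.cut_add] at h2
        simp only
        omega
    · refine Icc_disjoint_of_fst (Set.disjoint_left.2 fun x hx hx' => ?_)
      have h2 := hx.1
      have h3 := hx.2
      have h4 := hx'.1
      have h5 := hx'.2
      simp only at h2 h3 h4 h5 hc
      omega
  · simp only [F.cut_add]; push_cast; omega
  · have h2 := F.cut_add a.2
    have m1 : F.anc a ∈ Set.Icc ((a.1, 2 * F.r * a.2) : Site) (a.1 + 1, 2 * F.r * (a.2 + 1)) :=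
      ⟨le_rfl, by simp only [Stripes.anc]; omega, by simp only [Stripes.anc]; omega⟩
    have m2 : F.anc (above a) ∈
        Set.Icc ((a.1, 2 * F.r * a.2) : Site) (a.1 + 1, 2 * F.r * (a.2 + 1)) :=
      ⟨⟨le_rfl, by simp only [Stripes.anc, above_apply]; omega⟩,
        by simp only [Stripes.anc, above_apply]; omega, le_rfl⟩
    have m3 : F.anc (above (right a)) ∈
        Set.Icc ((a.1, 2 * F.r * a.2) : Site) (a.1 + 1, 2 * F.r * (a.2 + 1)) :=
      ⟨⟨by simp only [Stripes.anc, above_apply, right_apply]; omega,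
        by simp only [Stripes.anc, above_apply, right_apply]; omega⟩, le_rfl, le_rfl⟩
    have m4 : F.anc (right a) ∈
        Set.Icc ((a.1, 2 * F.r * a.2) : Site) (a.1 + 1, 2 * F.r * (a.2 + 1)) :=
      ⟨⟨by simp only [Stripes.anc, right_apply]; omega, le_rfl⟩, le_rfl,
        by simp only [Stripes.anc, right_apply]; omega⟩
    exact mul_mem (mul_mem (mul_mem (c.link_mem m1 m2 _) (c.link_mem m2 m3 _))
      (inv_mem (c.link_mem m4 m3 _))) (inv_mem (c.link_mem m1 m4 _))

/-- The product over all strips is a circuit with symmetric gates. -/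
theorem isSymmetricCircuit {A B : S.Aut} (hA : IsProd c F.W A) (hB : IsProd c F.X B) :
    SymmetricEntangler.IsSymmetricCircuit β (A⁻¹ * B) := by
  obtain ⟨n, hn⟩ := exists_primitive fun x =>
    (⟨(F.D (x + 1)).ω, (F.D (x + 1)).ω_mem_cocycles⟩ : cocycles G)
  have hn' (x : ℤ) : (n x : G → G → Circle) = (F.D x).ω * n (x - 1) := by
    have := congrArg Subtype.val (hn (x - 1))
    rw [sub_add_cancel] at this
    exact this
  obtain ⟨L, hL, hP⟩ := F.exists_prod_P (n := fun x => n x) hn'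
  obtain ⟨Y, Y', hY, hY', heq⟩ := F.eq_prod hA hB hL
  rw [heq]
  refine IsCircuit.mul (IsCircuit.mul (IsCircuit.inv (fun V hV g => ?_) (F.Z_circuit hY))
    (F.P_circuit (fun x => (n x).2) hP)) (F.Xs_circuit hY')
  rw [map_star, hV g]

end StripeFamily

end SpinSystem

/-! ### Stacking -/

section MapProd

open Filter Topology

variable {A B : Type*} [CStarAlgebra A] [CStarAlgebra B] {ι : Type*}

theorem noncommProd_map (f : A →⋆ₐ[ℂ] B) {φ : ι → A ≃⋆ₐ[ℂ] A} {ψ : ι → B ≃⋆ₐ[ℂ] B}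
    (h : ∀ a x, ψ a (f x) = f (φ a x)) (F : Finset ι) (c₁) (c₂) (x : A) :
    F.noncommProd ψ c₁ (f x) = f (F.noncommProd φ c₂ x) := by
  classical
  induction F using Finset.induction_on with
  | empty => simp
  | insert a F ha ih =>
    rw [Finset.noncommProd_insert_of_notMem _ _ _ _ ha,
      Finset.noncommProd_insert_of_notMem _ _ _ _ ha, StarAlgEquiv.mul_apply,
      StarAlgEquiv.mul_apply, ih _ (c₂.mono (by simp)), h]

/-- A `*`-homomorphism that intertwines two families intertwines their products. -/
theorem IsInfProd.map_apply (f : A →⋆ₐ[ℂ] B) {φ : ι → A ≃⋆ₐ[ℂ] A} {ψ : ι → B ≃⋆ₐ[ℂ] B}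
    {γ : A ≃⋆ₐ[ℂ] A} {δ : B ≃⋆ₐ[ℂ] B} (hγ : IsInfProd φ γ) (hδ : IsInfProd ψ δ)
    (h : ∀ a x, ψ a (f x) = f (φ a x)) (x : A) : δ (f x) = f (γ x) := by
  refine tendsto_nhds_unique (hδ.tendsto (f x)) ?_
  refine (((map_continuous f).tendsto _).comp (hγ.tendsto x)).congr fun F => ?_
  exact (noncommProd_map f h F _ _ x).symm

end MapProd

namespace SpinSystem

variable {S T R : SpinSystem}

/-- A `*`-homomorphism between quasi-local algebras that does not increase supports. -/
def IsLocal (f : S.Alg →⋆ₐ[ℂ] R.Alg) : Prop := ∀ j M, f (S.site j M) ∈ R.supp {j}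

theorem IsLocal.map_mem {f : S.Alg →⋆ₐ[ℂ] R.Alg} (hf : IsLocal f) {X : Set Site} {x : S.Alg}
    (hx : x ∈ S.supp X) : f x ∈ R.supp X :=
  map_mem_of_site f (R.instIsClosedSupp X)
    (fun j hj M => supp_mono (Set.singleton_subset_iff.2 hj) (hf j M)) hx

theorem IsLocal.umap_mem {f : S.Alg →⋆ₐ[ℂ] R.Alg} (hf : IsLocal f) {X : Set Site}
    {u : unitary S.Alg} (hu : u ∈ S.usupp X) : umap f u ∈ R.usupp X := hf.map_mem hu

/-- The on-site algebra of a stacked system. -/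
def stackSite (S T : SpinSystem) (j : Site) :
    Matrix (S.idx j × T.idx j) (S.idx j × T.idx j) ℂ →⋆ₐ[ℂ] (S.stack T).Alg := (S.stack T).site j

theorem inl_stackSite (S T : SpinSystem) (j : Site) (M : Matrix (S.idx j) (S.idx j) ℂ) :
    S.inl T (S.site j M) = S.stackSite T j (M ⊗ₖ 1) := S.inl_site T j M

theorem inr_stackSite (S T : SpinSystem) (j : Site) (M : Matrix (T.idx j) (T.idx j) ℂ) :
    S.inr T (T.site j M) = S.stackSite T j (1 ⊗ₖ M) := S.inr_site T j M

theorem isLocal_inl (S T : SpinSystem) : IsLocal (S.inl T) := fun j M => by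
  rw [inl_site]; exact site_mem_supp (Set.mem_singleton j) _

theorem isLocal_inr (S T : SpinSystem) : IsLocal (S.inr T) := fun j M => by
  rw [inr_site]; exact site_mem_supp (Set.mem_singleton j) _

theorem inl_commute_inr (S T : SpinSystem) (x : S.Alg) (y : T.Alg) :
    Commute (S.inl T x) (S.inr T y) := by
  have hsite (j : Site) (M) (k : Site) (N) :
      Commute (S.inl T (S.site j M)) (S.inr T (T.site k N)) := by
    by_cases h : j = k
    · subst h
      rw [inl_stackSite, inr_stackSite]
      refine Commute.map ?_ (S.stackSite T j)
      rw [Commute, SemiconjBy, ← Matrix.mul_kronecker_mul, ← Matrix.mul_kronecker_mul]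
      simp
    · rw [inl_site, inr_site]
      exact (S.stack T).site_commute h _ _
  have h1 (j : Site) (M) (y : T.Alg) : S.inr T y ∈
      StarSubalgebra.centralizer ℂ {S.inl T (S.site j M)} := by
    refine map_mem_of_site (X := Set.univ) (S.inr T) (isClosed_centralizer _) (fun k _ N => ?_)
      (by rw [supp_univ]; trivial)
    rw [StarSubalgebra.mem_centralizer_iff]
    rintro _ rfl
    refine ⟨(hsite j M k N).eq, ?_⟩
    rw [← map_star, ← map_star]
    exact (hsite j (star M) k N).eq
  have h2 : S.inl T x ∈ StarSubalgebra.centralizer ℂ {S.inr T y} := by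
    refine map_mem_of_site (X := Set.univ) (S.inl T) (isClosed_centralizer _) (fun k _ N => ?_)
      (by rw [supp_univ]; trivial)
    rw [StarSubalgebra.mem_centralizer_iff]
    rintro _ rfl
    refine ⟨((StarSubalgebra.mem_centralizer_iff ℂ).1 (h1 k N y) _ rfl).1.symm, ?_⟩
    rw [← map_star]
    exact ((StarSubalgebra.mem_centralizer_iff ℂ).1 (h1 k N (star y)) _ rfl).1.symm
  exact (((StarSubalgebra.mem_centralizer_iff ℂ).1 h2 _ rfl).1).symm

theorem stackSite_kronecker (j : Site) (M : Matrix (S.idx j) (S.idx j) ℂ)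
    (N : Matrix (T.idx j) (T.idx j) ℂ) :
    S.stackSite T j (M ⊗ₖ N) = S.inl T (S.site j M) * S.inr T (T.site j N) := by
  rw [inl_stackSite, inr_stackSite, ← map_mul, ← Matrix.mul_kronecker_mul, one_mul, mul_one]

theorem stack_aut_ext {c d : (S.stack T).Aut} (hl : ∀ x, c (S.inl T x) = d (S.inl T x))
    (hr : ∀ y, c (S.inr T y) = d (S.inr T y)) : c = d := by
  have key (j : Site) (M : Matrix (S.idx j × T.idx j) (S.idx j × T.idx j) ℂ) :
      c (S.stackSite T j M) = d (S.stackSite T j M) := by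
    induction M using Matrix.induction_on' with
    | h_zero => simp only [map_zero]
    | h_add M N hM hN => simp only [map_add, hM, hN]
    | h_std_basis a b z =>
      have h : Matrix.single a b z =
          Matrix.single a.1 b.1 z ⊗ₖ Matrix.single a.2 b.2 (1 : ℂ) := by
        rw [Matrix.single_kronecker_single, mul_one]
      rw [h, stackSite_kronecker, map_mul, map_mul, hl, hr]
  exact aut_ext key

theorem IsTensor.unique {a : S.Aut} {b : T.Aut} {c d : (S.stack T).Aut} (hc : IsTensor a b c)
    (hd : IsTensor a b d) : c = d :=
  stack_aut_ext (fun x => (hc.1 x).trans (hd.1 x).symm)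
    fun y => (hc.2 y).trans (hd.2 y).symm

theorem IsTensor.mul {a a' : S.Aut} {b b' : T.Aut} {c c' : (S.stack T).Aut} (hc : IsTensor a b c)
    (hc' : IsTensor a' b' c') : IsTensor (a * a') (b * b') (c * c') :=
  ⟨fun x => by rw [StarAlgEquiv.mul_apply, hc'.1, hc.1]; rfl,
    fun y => by rw [StarAlgEquiv.mul_apply, hc'.2, hc.2]; rfl⟩

theorem IsTensor.inv {a : S.Aut} {b : T.Aut} {c : (S.stack T).Aut} (hc : IsTensor a b c) :
    IsTensor a⁻¹ b⁻¹ c⁻¹ :=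
  ⟨fun x => by
      conv_lhs => rw [← aut_apply_inv a x]
      rw [← hc.1, aut_inv_apply],
    fun y => by
      conv_lhs => rw [← aut_apply_inv b y]
      rw [← hc.2, aut_inv_apply]⟩

theorem isTensor_of_site {a : S.Aut} {b : T.Aut} {c : (S.stack T).Aut}
    (hl : ∀ j M, c (S.inl T (S.site j M)) = S.inl T (a (S.site j M)))
    (hr : ∀ j M, c (S.inr T (T.site j M)) = S.inr T (b (T.site j M))) : IsTensor a b c := by
  constructor
  · intro x
    exact congrArg (fun f : S.Alg →⋆ₐ[ℂ] (S.stack T).Alg => f x)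
      (hom_ext (f := (c : (S.stack T).Alg →⋆ₐ[ℂ] (S.stack T).Alg).comp (S.inl T))
        (g := (S.inl T).comp (a : S.Alg →⋆ₐ[ℂ] S.Alg)) hl)
  · intro x
    exact congrArg (fun f : T.Alg →⋆ₐ[ℂ] (S.stack T).Alg => f x)
      (hom_ext (f := (c : (S.stack T).Alg →⋆ₐ[ℂ] (S.stack T).Alg).comp (S.inr T))
        (g := (S.inr T).comp (b : T.Alg →⋆ₐ[ℂ] T.Alg)) hr)

theorem isTensor_Ad (T : SpinSystem) (u : unitary S.Alg) :
    IsTensor (Ad u) (1 : T.Aut) (Ad (umap (S.inl T) u)) :=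
  ⟨fun x => (map_Ad (S.inl T) u x).symm,
    fun y => Ad_apply_eq_self (inl_commute_inr S T u y)⟩

/-- Tensoring a product of inner automorphisms with the identity. -/
theorem isTensor_of_isInfProd {ι : Type*} {u : ι → unitary S.Alg} {γ : S.Aut}
    {δ : (S.stack T).Aut} (hγ : IsInfProd (fun a => Ad (u a)) γ)
    (hδ : IsInfProd (fun a => Ad (umap (S.inl T) (u a))) δ) : IsTensor γ 1 δ :=
  ⟨hγ.map_apply (S.inl T) hδ fun a x => (isTensor_Ad T (u a)).1 x,
    fun y => hδ.apply_eq_self fun a => (isTensor_Ad T (u a)).2 y⟩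

theorem IsLayer.exists_tensor (T : SpinSystem) {P : Set S.Alg} {γ : S.Aut} (h : IsLayer P γ) :
    ∃ δ : (S.stack T).Aut, IsLayer Set.univ δ ∧ IsTensor γ 1 δ := by
  obtain ⟨ι, lo, hi, V, hle, hpart, hN, hV, hdisj, -, hγ⟩ := h.exists_isInfProd
  have hV' (a : ι) : umap (S.inl T) (V a) ∈ (S.stack T).usupp (Set.Icc (lo a) (hi a)) :=
    (isLocal_inl S T).umap_mem (hV a).1
  obtain ⟨δ, hδ⟩ := exists_isInfProd_Ad (X := fun a => Set.Icc (lo a) (hi a))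
    (V := fun a => umap (S.inl T) (V a))
    (fun j => Set.Subsingleton.finite fun a ha b hb => (hpart j).unique ha hb) hV'
    (fun a b hab => usupp_commute (hdisj a b hab) (hV' a) (hV' b))
  exact ⟨δ, isLayer_of_isInfProd (s := Set.univ) (fun a _ => hle a)
    (fun a _ b _ hab => hdisj a b hab) (hN.imp fun N hN a _ => hN a) (fun a _ => hV' a)
    (fun _ _ => trivial) (fun a ha => absurd (Set.mem_univ a) ha) trivial hδ,
    isTensor_of_isInfProd hγ hδ⟩

theorem isTensor_one (S T : SpinSystem) : IsTensor (1 : S.Aut) (1 : T.Aut) 1 :=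
  ⟨fun _ => rfl, fun _ => rfl⟩

theorem IsCircuit.exists_tensor (T : SpinSystem) {P : Set S.Alg} {γ : S.Aut} (h : IsCircuit P γ) :
    ∃ δ : (S.stack T).Aut, IsFDQC δ ∧ IsTensor γ 1 δ := by
  obtain ⟨L, hL, rfl⟩ := h
  induction L with
  | nil => exact ⟨1, isCircuit_one, isTensor_one S T⟩
  | cons l L ih =>
    obtain ⟨δ, hδ, hδt⟩ := ih fun k hk => hL k (List.mem_cons_of_mem _ hk)
    obtain ⟨ε, hε, hεt⟩ := (hL l List.mem_cons_self).exists_tensor T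
    exact ⟨ε * δ, hε.isCircuit.mul hδ, by simpa using hεt.mul hδt⟩

/-! ### On-site symmetries -/

variable {G : Type*} [Group G]

/-- Conjugation by a unitary matrix. -/
def conjMatrix {n : Type*} [Fintype n] [DecidableEq n] (u : Matrix.unitaryGroup n ℂ)
    (M : Matrix n n ℂ) : Matrix n n ℂ := u * M * star (u : Matrix n n ℂ)

theorem exists_onSite (u : ∀ j, Matrix.unitaryGroup (S.idx j) ℂ) :
    ∃ γ : S.Aut, ∀ j M, γ (S.site j M) = S.site j (conjMatrix (u j) M) := by
  let V (j : Site) : unitary S.Alg := ⟨S.site j (u j), Unitary.map_mem (S.site j) (u j).2⟩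
  have hV (j : Site) : V j ∈ S.usupp {j} := site_mem_supp (Set.mem_singleton j) _
  obtain ⟨γ, hγ⟩ := exists_isInfProd_Ad (X := fun j : Site => {j}) (V := V)
    (fun j => Set.Subsingleton.finite fun a ha b hb => ha.symm.trans hb) hV
    (fun a b hab => usupp_commute (Set.disjoint_singleton.2 hab) (hV a) (hV b))
  refine ⟨γ, fun j M => ?_⟩
  rw [hγ.apply_eq_single j fun b hb => Ad_fix (Set.disjoint_singleton.2 hb) (hV b)
    (site_mem_supp (Set.mem_singleton j) M)]
  rw [Unitary.conjStarAlgAut_apply, conjMatrix, map_mul, map_mul, map_star]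

/-- The on-site symmetry given by on-site representations. -/
theorem exists_onSiteSymmetry (U : ∀ j, G →* Matrix.unitaryGroup (S.idx j) ℂ) :
    ∃ β : OnSiteSymmetry G S, ∀ g j M, β.toHom g (S.site j M) =
      S.site j (conjMatrix (U j g) M) := by
  choose γ hγ using fun g => exists_onSite (S := S) fun j => U j g
  refine ⟨⟨⟨⟨γ, ?_⟩, fun g h => ?_⟩, U, fun g j M => hγ g j M⟩, fun g j M => hγ g j M⟩
  · refine aut_ext fun j M => ?_
    rw [hγ, map_one]
    simp [conjMatrix]
  · refine aut_ext fun j M => ?_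
    rw [StarAlgEquiv.mul_apply, hγ, hγ, hγ, map_mul]
    simp [conjMatrix, mul_assoc]

end SpinSystem

namespace SpinSystem

variable {S S' : SpinSystem}

/-! ### Relabelling and transport of circuits -/

theorem amplify_siteOp_relabel (e : ∀ j, S.idx j ≃ S'.idx j) (j : Site)
    (M : Matrix (S.idx j) (S.idx j) ℂ) :
    amplify ((Equiv.piCongrRight e).symm.trans (Equiv.prodPUnit.{0} _).symm) (S.siteOp j M) =
      S'.siteOp j (M.submatrix (e j).symm (e j).symm) := by
  ext Φ ω
  refine Eq.trans (S.siteOp_apply j M (slice _ PUnit.unit Φ) fun i => (e i).symm (ω i))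
    (Eq.trans ?_ (S'.siteOp_apply j _ Φ ω).symm)
  refine Fintype.sum_equiv (e j) _ _ fun k => ?_
  rw [Matrix.submatrix_apply, Equiv.symm_apply_apply]
  refine congrArg (fun z => M ((e j).symm (ω j)) k * Φ z) ?_
  funext i
  change e i (Function.update (fun i => (e i).symm (ω i)) j k i) = _
  by_cases hi : i = j
  · subst hi; simp
  · simp [hi]

/-- The homomorphism of quasi-local algebras given by a relabelling of the on-site bases. -/
def relabelHom (e : ∀ j, S.idx j ≃ S'.idx j) : S.Alg →⋆ₐ[ℂ] S'.Alg :=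
  ((amplify ((Equiv.piCongrRight e).symm.trans (Equiv.prodPUnit.{0} _).symm)).comp
    S.quasiLocal.subtype).codRestrict _
    (map_quasiLocal _ fun j M => ⟨_, amplify_siteOp_relabel e j M⟩)

theorem relabelHom_site (e : ∀ j, S.idx j ≃ S'.idx j) (j : Site)
    (M : Matrix (S.idx j) (S.idx j) ℂ) :
    relabelHom e (S.site j M) = S'.site j (M.submatrix (e j).symm (e j).symm) :=
  Subtype.ext (amplify_siteOp_relabel e j M)

theorem relabelHom_comp (e : ∀ j, S.idx j ≃ S'.idx j) :
    (relabelHom fun j => (e j).symm).comp (relabelHom e) = StarAlgHom.id ℂ S.Alg := by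
  refine hom_ext fun j M => ?_
  rw [StarAlgHom.comp_apply, relabelHom_site, relabelHom_site, Matrix.submatrix_submatrix]
  simp

/-- The isomorphism of quasi-local algebras given by a relabelling of the on-site bases. -/
def relabel (e : ∀ j, S.idx j ≃ S'.idx j) : S.Alg ≃⋆ₐ[ℂ] S'.Alg :=
  StarAlgEquiv.ofStarAlgHom (relabelHom e) (relabelHom fun j => (e j).symm)
    (relabelHom_comp e) (relabelHom_comp fun j => (e j).symm)

theorem relabel_site (e : ∀ j, S.idx j ≃ S'.idx j) (j : Site)
    (M : Matrix (S.idx j) (S.idx j) ℂ) :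
    relabel e (S.site j M) = S'.site j (M.submatrix (e j).symm (e j).symm) :=
  relabelHom_site e j M

theorem relabel_symm_site (e : ∀ j, S.idx j ≃ S'.idx j) (j : Site)
    (M : Matrix (S'.idx j) (S'.idx j) ℂ) :
    (relabel e).symm (S'.site j M) = S.site j (M.submatrix (e j) (e j)) :=
  relabelHom_site (fun j => (e j).symm) j M

theorem relabel_range (e : ∀ j, S.idx j ≃ S'.idx j) (j : Site) :
    relabel e '' Set.range (S.site j) = Set.range (S'.site j) := by
  ext y
  constructor
  · rintro ⟨_, ⟨M, rfl⟩, rfl⟩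
    exact ⟨_, (relabel_site e j M).symm⟩
  · rintro ⟨M, rfl⟩
    exact ⟨_, ⟨_, (relabel_symm_site e j M).symm⟩, StarAlgEquiv.apply_symm_apply _ _⟩

theorem IsLayer.transport {Φ : S.Alg ≃⋆ₐ[ℂ] S'.Alg} (hΦ : IsLocal (Φ : S.Alg →⋆ₐ[ℂ] S'.Alg))
    (hΦ' : IsLocal (Φ.symm : S'.Alg →⋆ₐ[ℂ] S.Alg)) {P : Set S.Alg} {P' : Set S'.Alg}
    (hP : ∀ V ∈ P, Φ V ∈ P') {γ : S.Aut} (h : IsLayer P γ) :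
    IsLayer P' ((Φ.symm.trans γ).trans Φ) := by
  obtain ⟨ι, lo, hi, V, h1, h2, h3, h4⟩ := h
  refine ⟨ι, lo, hi, fun a => Φ (V a), h1, h2, h3, fun a => ?_⟩
  obtain ⟨hu, hs, hp, hx⟩ := h4 a
  refine ⟨Unitary.map_mem Φ hu, hΦ.map_mem hs, hP _ hp, fun x hxs => ?_⟩
  change Φ (γ (Φ.symm x)) = _
  have h5 : Φ.symm x ∈ S.supp (Set.Icc (lo a) (hi a)) := hΦ'.map_mem hxs
  rw [hx _ h5, map_mul, map_mul, map_star, StarAlgEquiv.apply_symm_apply]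

theorem IsCircuit.transport {Φ : S.Alg ≃⋆ₐ[ℂ] S'.Alg} (hΦ : IsLocal (Φ : S.Alg →⋆ₐ[ℂ] S'.Alg))
    (hΦ' : IsLocal (Φ.symm : S'.Alg →⋆ₐ[ℂ] S.Alg)) {P : Set S.Alg} {P' : Set S'.Alg}
    (hP : ∀ V ∈ P, Φ V ∈ P') {γ : S.Aut} (h : IsCircuit P γ) :
    IsCircuit P' ((Φ.symm.trans γ).trans Φ) := by
  obtain ⟨L, hL, rfl⟩ := h
  induction L with
  | nil =>
    have : (Φ.symm.trans (1 : S.Aut)).trans Φ = 1 :=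
      StarAlgEquiv.ext fun x => StarAlgEquiv.apply_symm_apply Φ x
    rw [List.prod_nil, this]
    exact isCircuit_one
  | cons l L ih =>
    have : (Φ.symm.trans (l * L.prod)).trans Φ =
        ((Φ.symm.trans l).trans Φ) * ((Φ.symm.trans L.prod).trans Φ) :=
      StarAlgEquiv.ext fun x => by
        change Φ (l (L.prod (Φ.symm x))) = Φ (l (Φ.symm (Φ (L.prod (Φ.symm x)))))
        rw [StarAlgEquiv.symm_apply_apply]
    rw [List.prod_cons, this]
    exact ((hL l List.mem_cons_self).transport hΦ hΦ' hP).isCircuit.mul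
      (ih fun k hk => hL k (List.mem_cons_of_mem _ hk))

/-! ### Decomposition of a striped entangler -/

variable {G : Type*} [Group G]

theorem Stripes.W_mem_nearCut {β : OnSiteSymmetry G S} (F : Stripes β) (a : ℤ × ℤ) :
    (F.D a.1).W a.2 ∈ S.usupp (F.nearCut a) :=
  F.mem_blk ((F.D a.1).W_mem a.2) fun h => by rw [F.trivial _ h]; rfl

theorem Stripes.X_mem_between {β : OnSiteSymmetry G S} (F : Stripes β) (a : ℤ × ℤ) :
    (F.D a.1).X a.2 ∈ S.usupp (F.between a) :=
  F.mem_blk ((F.D a.1).X_mem a.2) fun h => by rw [F.trivial _ h]; rfl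

theorem exists_between_cuts {r : ℕ} (hr : 0 < r) (y : ℤ) :
    ∃ k : ℤ, 2 * r * k < y ∧ y ≤ 2 * r * (k + 1) := by
  have hr' : (0 : ℤ) < 2 * r := by exact_mod_cast Nat.mul_pos two_pos hr
  refine ⟨(y - 1) / (2 * r), ?_, ?_⟩
  · have := Int.mul_ediv_self_le (x := y - 1) hr'.ne'
    omega
  · have := Int.lt_mul_ediv_self_add (x := y - 1) hr'
    rw [mul_add, mul_one]
    omega

/-- If on every strip the automorphism is turned by the cutting unitaries into the product of the
unitaries between the cuts, then it is the quotient of the corresponding infinite products. -/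
theorem Stripes.exists_prod {β : OnSiteSymmetry G S} (F : Stripes β) {α : S.Aut}
    (hα : ∀ x ∈ F.s, ∀ k, ∀ z ∈ S.supp (box x (F.N x) (2 * F.r * k) (2 * F.r * (k + 1))),
      Ad ((F.D x).W k * (F.D x).W (k + 1)) (α z) = Ad ((F.D x).X k) z)
    (hα' : ∀ j : Site, (∀ x ∈ F.s, j.1 ∉ Set.Icc x (F.N x)) → ∀ M, α (S.site j M) = S.site j M) :
    ∃ A B : S.Aut, IsInfProd (fun a : ℤ × ℤ => Ad ((F.D a.1).W a.2)) A ∧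
      IsInfProd (fun a : ℤ × ℤ => Ad ((F.D a.1).X a.2)) B ∧ α = A⁻¹ * B := by
  have hfin1 (j : Site) : {a | j ∈ F.nearCut a}.Finite :=
    Set.Subsingleton.finite fun a ha b hb => by
      by_contra hab
      exact (F.nearCut_disjoint hab).ne_of_mem ha hb rfl
  have hfin2 (j : Site) : {a | j ∈ F.between a}.Finite :=
    Set.Subsingleton.finite fun a ha b hb => by
      by_contra hab
      exact (F.between_disjoint hab).ne_of_mem ha hb rfl
  obtain ⟨A, hA⟩ := exists_isInfProd_Ad hfin1 F.W_mem_nearCut fun a b hab =>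
    usupp_commute (F.nearCut_disjoint hab) (F.W_mem_nearCut a) (F.W_mem_nearCut b)
  obtain ⟨B, hB⟩ := exists_isInfProd_Ad hfin2 F.X_mem_between fun a b hab =>
    usupp_commute (F.between_disjoint hab) (F.X_mem_between a) (F.X_mem_between b)
  refine ⟨A, B, hA, hB, ?_⟩
  rw [eq_inv_mul_iff_mul_eq]
  refine aut_ext fun j M => ?_
  rw [StarAlgEquiv.mul_apply]
  by_cases hj : ∃ x ∈ F.s, j.1 ∈ Set.Icc x (F.N x)
  · obtain ⟨x, hx, hjx⟩ := hj
    obtain ⟨k, hk, hk'⟩ := exists_between_cuts F.r_pos j.2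
    have hjb : j ∈ F.between (x, k) := ⟨hx, hjx, hk, hk'⟩
    have hz := site_mem_supp hjb M
    rw [hB.apply_eq_single (x, k) fun b hb =>
      Ad_fix (F.between_disjoint hb) (F.X_mem_between b) hz]
    have hsub : F.between (x, k) ⊆ box x (F.N x) (2 * F.r * k) (2 * F.r * (k + 1)) :=
      fun i hi => hi.2
    have h1 := hα x hx k _ (supp_mono hsub hz)
    obtain ⟨w, hw⟩ : ∃ w, w = (F.D x).W k * (F.D x).W (k + 1) := ⟨_, rfl⟩
    have h2 : α (S.site j M) = Ad w⁻¹ (Ad ((F.D x).X k) (S.site j M)) := by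
      rw [← h1, hw, Ad_inv_apply]
    have hXz : Ad ((F.D x).X k) (S.site j M) ∈ S.supp (F.between (x, k)) :=
      Ad_mem (F.X_mem_between (x, k)) hz
    rw [hA.apply_eq_pair (a := (x, k)) (b := (x, k + 1)) (by simp) (fun b hb hb' => ?_)]
    · exact (Ad_mul_apply _ _ _).symm.trans h1
    · have hd : Disjoint (F.nearCut b) (F.between (x, k)) := by
        have hne : b.1 ≠ x ∨ b.2 < k ∨ k + 1 < b.2 := by
          by_contra hcon
          push Not at hcon
          rcases eq_or_lt_of_le hcon.2.1 with h | h
          · exact hb (Prod.ext hcon.1 h.symm)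
          · exact hb' (Prod.ext hcon.1 (le_antisymm hcon.2.2 h))
        refine F.blk_disjoint (hne.imp_right (Or.imp (fun h => ?_) fun h => ?_))
        · have h3 := F.cut_le h
          rw [F.cut_add] at h3
          simp only
          omega
        · have h3 := F.cut_le h
          rw [F.cut_add] at h3
          simp only
          omega
      have hc : Commute ((F.D b.1).W b.2) w := by
        rw [hw]
        exact (usupp_commute (F.nearCut_disjoint hb) (F.W_mem_nearCut b)
          (F.W_mem_nearCut (x, k))).mul_right (usupp_commute (F.nearCut_disjoint hb')
            (F.W_mem_nearCut b) (F.W_mem_nearCut (x, k + 1)))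
      rw [h2, ← Ad_mul_apply, hc.inv_right.eq, Ad_mul_apply, Ad_fix hd (F.W_mem_nearCut b) hXz]
  · push Not at hj
    rw [hα' j hj M]
    have hz := site_mem_supp (Set.mem_singleton j) M
    rw [hA.apply_eq_self fun a => Ad_fix (Set.disjoint_singleton_right.2 fun h =>
        hj a.1 h.1 h.2.1) (F.W_mem_nearCut a) hz,
      hB.apply_eq_self fun a => Ad_fix (Set.disjoint_singleton_right.2 fun h =>
        hj a.1 h.1 h.2.1) (F.X_mem_between a) hz]

theorem rangeLE_mono {α : S.Aut} {r r' : ℕ} (h : r ≤ r') (hα : RangeLE α r) : RangeLE α r' :=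
  fun X x hx => by
    have hsub : fatten X r ⊆ fatten X r' := fun _ ⟨k, hk, hd⟩ =>
      ⟨k, hk, hd.trans (by exact_mod_cast h)⟩
    exact supp_mono hsub (hα X x hx)

/-- A striped entangler is a quotient of infinite products of cutting unitaries and of unitaries
between the cuts. -/
theorem _root_.SpinSys.SymmetricEntangler.IsStriped.exists_stripes {E : SymmetricEntangler G S}
    (hE : E.IsStriped) : ∃ (F : Stripes E.β) (A B : S.Aut),
      IsInfProd (fun a : ℤ × ℤ => Ad ((F.D a.1).W a.2)) A ∧
      IsInfProd (fun a : ℤ × ℤ => Ad ((F.D a.1).X a.2)) B ∧ E.α = A⁻¹ * B := by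
  classical
  obtain ⟨m, n, a, hdisj, ⟨N₀, hN₀⟩, ⟨r₀, hr₀⟩, hcirc, hα, hα'⟩ := hE
  let s : Set ℤ := {x | ∃ i, m i = x ∧ m i ≤ n i}
  have hi : ∀ x, ∃ i, x ∈ s → m i = x ∧ m i ≤ n i := fun x => by
    by_cases hx : x ∈ s
    · obtain ⟨i, hi⟩ := hx
      exact ⟨i, fun _ => hi⟩
    · exact ⟨0, fun h => absurd h hx⟩
  choose i hi using hi
  let N (x : ℤ) : ℤ := if x ∈ s then n (i x) else x
  have hNs {x : ℤ} (hx : x ∈ s) : N x = n (i x) := if_pos hx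
  have hN (x : ℤ) : x ≤ N x := by
    by_cases hx : x ∈ s
    · rw [hNs hx]; exact (hi x hx).1.symm.le.trans (hi x hx).2
    · exact (if_neg hx).ge
  have hstrip {x : ℤ} (hx : x ∈ s) :
      SymmetricEntangler.strip (m (i x)) (n (i x)) = SymmetricEntangler.strip x (N x) := by
    rw [hNs hx, (hi x hx).1]
  have hcomm (l : ℤ) (g : G) : a l * E.β.toHom g = E.β.toHom g * a l := by
    refine aut_ext fun j M => ?_
    rw [StarAlgEquiv.mul_apply, StarAlgEquiv.mul_apply]
    have hz := site_mem_supp (Set.mem_singleton j) M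
    by_cases hj : j ∈ SymmetricEntangler.strip (m l) (n l)
    · have hz' := supp_mono (Set.singleton_subset_iff.2 hj) hz
      rw [← hα l _ (stab_apply (E.β.mem_stab g _) hz'), ← hα l _ hz']
      exact congrArg (fun f : S.Aut => f (S.site j M)) (E.equivariant g)
    · rw [circuit_fix (Set.disjoint_singleton_right.2 hj) (hcirc l) hz,
        circuit_fix (Set.disjoint_singleton_right.2 hj) (hcirc l)
          (stab_apply (E.β.mem_stab g _) hz)]
  have hD (x : ℤ) : ∃ D : StripData E.β x (N x) (r₀ + 1),
      (x ∈ s → ∀ k, ∀ z ∈ S.supp (box x (N x) (2 * (r₀ + 1 : ℕ) * k) (2 * (r₀ + 1 : ℕ) * (k + 1))),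
        Ad (D.W k * D.W (k + 1)) (E.α z) = Ad (D.X k) z) ∧
      (x ∉ s → D = StripData.trivial E.β x (N x) (r₀ + 1)) := by
    by_cases hx : x ∈ s
    · have hc := hcirc (i x)
      rw [hstrip hx] at hc
      obtain ⟨D, hD⟩ := exists_stripData (β := E.β) (Nat.succ_pos r₀) hc
        (rangeLE_mono (Nat.le_succ r₀) (hr₀ (i x))) (hcomm (i x))
      refine ⟨D, fun _ k z hz => ?_, fun h => absurd hx h⟩
      have hsub : box x (N x) (2 * (r₀ + 1 : ℕ) * k) (2 * (r₀ + 1 : ℕ) * (k + 1)) ⊆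
          SymmetricEntangler.strip (m (i x)) (n (i x)) := by
        rw [hstrip hx]
        exact fun j hj => hj.1
      rw [hα (i x) z (supp_mono hsub hz)]
      exact hD k z hz
    · exact ⟨StripData.trivial E.β x (N x) (r₀ + 1), fun h => absurd h hx, fun _ => rfl⟩
  choose D hD hD' using hD
  let F : Stripes E.β :=
    { s := s
      N := N
      width := N₀
      r := r₀ + 1
      r_pos := Nat.succ_pos r₀
      le := hN
      N_le := fun x => by
        by_cases hx : x ∈ s
        · have h1 := hN₀ (i x)
          rw [← Finset.coe_Icc, Set.ncard_coe_finset, Int.card_Icc, (hi x hx).1, ← hNs hx] at h1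
          omega
        · have : N x = x := if_neg hx
          omega
      disj := fun x hx x' hx' hne => by
        have : Disjoint (Set.Icc (m (i x)) (n (i x))) (Set.Icc (m (i x')) (n (i x'))) :=
          hdisj fun h => hne (by rw [← (hi x hx).1, ← (hi x' hx').1, h])
        rwa [(hi x hx).1, (hi x' hx').1, ← hNs hx, ← hNs hx'] at this
      D := D
      trivial := hD' }
  refine ⟨F, F.exists_prod (fun x hx k z hz => hD x hx k z hz) fun j hj M => ?_⟩
  refine hα' _ (site_mem_supp (fun hmem => ?_) M)
  obtain ⟨l, hl⟩ := Set.mem_iUnion.1 hmem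
  have hls : m l ∈ s := ⟨l, rfl, hl.1.trans hl.2⟩
  have hil : i (m l) = l := by
    by_contra hne
    refine (hdisj hne).ne_of_mem (a := m l) ?_ ⟨le_rfl, hl.1.trans hl.2⟩ rfl
    obtain ⟨h1, h2⟩ := hi (m l) hls
    rw [h1] at h2 ⊢
    exact ⟨le_rfl, h2⟩
  refine hj (m l) hls ⟨hl.1, ?_⟩
  change j.1 ≤ N (m l)
  rw [hNs hls, hil]
  exact hl.2

end SpinSystem

namespace SpinSystem

variable {S S' T R : SpinSystem} {G : Type*} [Group G]

/-! ### Stacking with a clock -/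

/-- The image of strip data under an equivariant local homomorphism. -/
def StripData.map {β : OnSiteSymmetry G S} {β' : OnSiteSymmetry G R} {f : S.Alg →⋆ₐ[ℂ] R.Alg}
    (hf : IsLocal f) (hβ : ∀ g x, β'.toHom g (f x) = f (β.toHom g x)) {m n : ℤ} {r : ℕ}
    (D : StripData β m n r) : StripData β' m n r :=
  have h (g : G) (u : unitary S.Alg) :
      uaut (β'.toHom g) (umap f u) = umap f (uaut (β.toHom g) u) := Subtype.ext (hβ g u)
  { W := fun k => umap f (D.W k)
    X := fun k => umap f (D.X k)
    p := fun k g => umap f (D.p k g)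
    q := fun k g => umap f (D.q k g)
    ω := D.ω
    W_mem := fun k => hf.umap_mem (D.W_mem k)
    X_mem := fun k => hf.umap_mem (D.X_mem k)
    p_mem := fun k g => hf.umap_mem (D.p_mem k g)
    q_mem := fun k g => hf.umap_mem (D.q_mem k g)
    W_eq := fun k g => by rw [h, ← umap_mul, ← umap_mul, ← D.W_eq]
    p_mul := fun k g g' => by rw [h, ← umap_mul, D.p_mul, umap_mul, umap_phase]
    q_mul := fun k g g' => by rw [h, ← umap_phase f, ← umap_mul, ← umap_mul, D.q_mul]
    X_eq := fun k g => by rw [h, ← umap_mul, ← umap_mul, ← D.X_eq] }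

/-- A clock in the second layer of a stacked system. -/
def Clock.inr [Fintype G] {δ : OnSiteSymmetry G T} (c : Clock δ) {β : OnSiteSymmetry G (S.stack T)}
    (hβ : ∀ g y, β.toHom g (S.inr T y) = S.inr T (δ.toHom g y)) : Clock β where
  e j h := S.inr T (c.e j h)
  mem j h := (isLocal_inr S T).map_mem (c.mem j h)
  partition j := (c.partition j).map (S.inr T)
  act_e g j h := by rw [hβ, c.act_e]

/-- After stacking with a clock, a striped entangler becomes a circuit with symmetric gates. -/
theorem _root_.SpinSys.SymmetricEntangler.IsStriped.isSymmetricCircuit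
    [Fintype G] {E : SymmetricEntangler G S} (hE : E.IsStriped) {δ : OnSiteSymmetry G T} (c₀ : Clock δ)
    {β : OnSiteSymmetry G (S.stack T)}
    (hβ : ∀ g, IsTensor (E.β.toHom g) (δ.toHom g) (β.toHom g)) {α : (S.stack T).Aut}
    (hα : IsTensor E.α 1 α) : SymmetricEntangler.IsSymmetricCircuit β α := by
  obtain ⟨F₀, A, B, hA, hB, hAB⟩ := hE.exists_stripes
  let c : Clock β := c₀.inr fun g => (hβ g).2
  have hmem (u : unitary S.Alg) : umap (S.inl T) u ∈ c.C := fun j h => inl_commute_inr S T u _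
  let F : StripeFamily c :=
    { s := F₀.s
      N := F₀.N
      width := F₀.width
      r := F₀.r
      r_pos := F₀.r_pos
      le := F₀.le
      N_le := F₀.N_le
      disj := F₀.disj
      D := fun x => (F₀.D x).map (isLocal_inl S T) fun g => (hβ g).1
      trivial := fun x hx => by
        rw [F₀.trivial x hx]
        simp only [StripData.map, StripData.trivial, map_one]
      W_mem_C := fun _ _ => hmem _
      X_mem_C := fun _ _ => hmem _
      p_mem_C := fun _ _ _ => hmem _
      q_mem_C := fun _ _ _ => hmem _ }
  obtain ⟨A', hA'⟩ := IsProd.exists_of_nbhd F F.W_nbhd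
    (c.pairwise_commute F.nearCut_disjoint F.W_core F.W_core)
  obtain ⟨B', hB'⟩ := IsProd.exists_of_nbhd F F.X_nbhd
    (c.pairwise_commute F.between_disjoint F.X_core F.X_core)
  have hAt : IsTensor A 1 A' := isTensor_of_isInfProd hA hA'
  have hBt : IsTensor B 1 B' := isTensor_of_isInfProd hB hB'
  have hABt : IsTensor E.α 1 (A'⁻¹ * B') := by
    have := hAt.inv.mul hBt
    rwa [← hAB, inv_one, one_mul] at this
  rw [hα.unique hABt]
  exact F.isSymmetricCircuit hA' hB'

/-! ### The regular representation -/

/-- The permutation matrices as unitary matrices. -/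
def permUnitary (n : Type*) [Fintype n] [DecidableEq n] :
    Equiv.Perm n →* Matrix.unitaryGroup n ℂ where
  toFun σ := ⟨Matrix.of fun a b => if a = σ b then 1 else 0, by
    rw [Matrix.mem_unitaryGroup_iff']
    ext a b
    simp [Matrix.mul_apply, Matrix.one_apply, Matrix.star_apply, eq_comm]⟩
  map_one' := Subtype.ext <| Matrix.ext fun a b => (Matrix.one_apply (i := a) (j := b)).symm
  map_mul' σ τ := Subtype.ext <| Matrix.ext fun a b => by
    change (if a = σ (τ b) then (1 : ℂ) else 0) =
      ∑ c, (if a = σ c then 1 else 0) * if c = τ b then 1 else 0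
    simp

theorem permUnitary_apply {n : Type*} [Fintype n] [DecidableEq n] (σ : Equiv.Perm n) (a b : n) :
    (permUnitary n σ : Matrix n n ℂ) a b = if a = σ b then 1 else 0 := rfl

theorem conjMatrix_permUnitary {n : Type*} [Fintype n] [DecidableEq n] (σ : Equiv.Perm n) (b : n) :
    conjMatrix (permUnitary n σ) (Matrix.single b b 1) = Matrix.single (σ b) (σ b) 1 := by
  have h : (permUnitary n σ : Matrix n n ℂ) * Matrix.single b b 1 =
      Matrix.single (σ b) (σ b) 1 * (permUnitary n σ : Matrix n n ℂ) := by
    ext i j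
    simp only [Matrix.mul_apply, Matrix.single_apply, permUnitary_apply]
    by_cases hi : i = σ b <;> by_cases hj : b = j <;> simp [hi, hj, eq_comm]
  rw [conjMatrix, h, mul_assoc, Unitary.mul_star_self_of_mem (permUnitary n σ).2, mul_one]

/-- The spin system whose on-site Hilbert spaces have dimension `n`. -/
def uniform (n : ℕ) [NeZero n] : SpinSystem where
  idx _ := Fin n
  bounded := ⟨n, fun _ => by simp⟩

/-- The on-site algebra of the uniform system. -/
def uniformSite (n : ℕ) [NeZero n] (j : Site) :
    Matrix (Fin n) (Fin n) ℂ →⋆ₐ[ℂ] (uniform n).Alg := (uniform n).site j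

/-- The regular representation. -/
def regular {n : ℕ} (e : G ≃ Fin n) : G →* Matrix.unitaryGroup (Fin n) ℂ :=
  (permUnitary (Fin n)).comp
    ((e.permCongrHom : Equiv.Perm G →* Equiv.Perm (Fin n)).comp (MulAction.toPermHom G G))

theorem conjMatrix_regular {n : ℕ} (e : G ≃ Fin n) (g h : G) :
    conjMatrix (regular e g) (Matrix.single (e h) (e h) 1) =
      Matrix.single (e (g * h)) (e (g * h)) 1 := by
  refine (conjMatrix_permUnitary (e.permCongrHom (MulAction.toPermHom G G g)) (e h)).trans ?_
  simp

/-- The clock of the regular representation. -/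
def regularClock [Fintype G] {n : ℕ} [NeZero n] (e : G ≃ Fin n) {δ : OnSiteSymmetry G (uniform n)}
    (hδ : ∀ g j M, δ.toHom g (uniformSite n j M) =
      uniformSite n j (conjMatrix (regular e g) M)) : Clock δ where
  e j h := uniformSite n j (Matrix.single (e h) (e h) 1)
  mem j h := (uniform n).site_mem_supp (Set.mem_singleton j) _
  partition j := isPartition_matrix e (uniformSite n j)
  act_e g j h := by rw [hδ, conjMatrix_regular]

/-! ### Tensor products of representations -/

/-- The tensor product of two unitary representations. -/
def kronRep {m n : Type*} [Fintype m] [DecidableEq m] [Fintype n] [DecidableEq n]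
    (U : G →* Matrix.unitaryGroup m ℂ) (V : G →* Matrix.unitaryGroup n ℂ) :
    G →* Matrix.unitaryGroup (m × n) ℂ where
  toFun g := ⟨(U g : Matrix m m ℂ) ⊗ₖ (V g : Matrix n n ℂ),
    Matrix.kronecker_mem_unitary (U g).2 (V g).2⟩
  map_one' := Subtype.ext <| by simp
  map_mul' g h := Subtype.ext <| by
    simp [Matrix.mul_kronecker_mul]

theorem conjMatrix_kron {m n : Type*} [Fintype m] [DecidableEq m] [Fintype n] [DecidableEq n]
    (U : G →* Matrix.unitaryGroup m ℂ) (V : G →* Matrix.unitaryGroup n ℂ) (g : G)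
    (M : Matrix m m ℂ) (N : Matrix n n ℂ) :
    conjMatrix (kronRep U V g) (M ⊗ₖ N) = conjMatrix (U g) M ⊗ₖ conjMatrix (V g) N := by
  simp only [conjMatrix, kronRep, MonoidHom.coe_mk, OneHom.coe_mk, Matrix.star_eq_conjTranspose,
    Matrix.conjTranspose_kronecker, Matrix.mul_kronecker_mul]

theorem conjMatrix_one {m : Type*} [Fintype m] [DecidableEq m] (u : Matrix.unitaryGroup m ℂ) :
    conjMatrix u 1 = 1 := by
  rw [conjMatrix, mul_one, Unitary.mul_star_self_of_mem u.2]

theorem isTensor_kron {β : OnSiteSymmetry G S} {δ : OnSiteSymmetry G T}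
    {ε : OnSiteSymmetry G (S.stack T)} {U : ∀ j, G →* Matrix.unitaryGroup (S.idx j) ℂ}
    {V : ∀ j, G →* Matrix.unitaryGroup (T.idx j) ℂ}
    (hβ : ∀ g j M, β.toHom g (S.site j M) = S.site j (conjMatrix (U j g) M))
    (hδ : ∀ g j M, δ.toHom g (T.site j M) = T.site j (conjMatrix (V j g) M))
    (hε : ∀ g j M, ε.toHom g (S.stackSite T j M) =
      S.stackSite T j (conjMatrix (kronRep (U j) (V j) g) M)) (g : G) :
    IsTensor (β.toHom g) (δ.toHom g) (ε.toHom g) := by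
  refine isTensor_of_site (fun j M => ?_) fun j M => ?_
  · rw [hβ, inl_stackSite, inl_stackSite, hε, conjMatrix_kron, conjMatrix_one]
  · rw [hδ, inr_stackSite, inr_stackSite, hε, conjMatrix_kron, conjMatrix_one]

theorem exists_stackSymmetry (U : ∀ j, G →* Matrix.unitaryGroup (S.idx j) ℂ)
    (V : ∀ j, G →* Matrix.unitaryGroup (T.idx j) ℂ) :
    ∃ ε : OnSiteSymmetry G (S.stack T), ∀ g j M, ε.toHom g (S.stackSite T j M) =
      S.stackSite T j (conjMatrix (kronRep (U j) (V j) g) M) :=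
  exists_onSiteSymmetry (S := S.stack T) fun j => kronRep (U j) (V j)

/-- The stack of an entangler with an identity entangler. -/
theorem exists_stack (E : SymmetricEntangler G S) {δ : OnSiteSymmetry G T}
    {ε : OnSiteSymmetry G (S.stack T)}
    (hε : ∀ g, IsTensor (E.β.toHom g) (δ.toHom g) (ε.toHom g)) :
    ∃ F : SymmetricEntangler G (S.stack T),
      SymmetricEntangler.IsStack E δ.idEntangler F ∧ F.β = ε := by
  obtain ⟨α, hα, hαt⟩ := IsCircuit.exists_tensor T E.fdqc
  refine ⟨⟨α, ε, hα, fun g => ?_⟩, ⟨hαt, hε⟩, rfl⟩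
  have h1 := hαt.mul (hε g)
  have h2 := (hε g).mul hαt
  rw [E.equivariant, one_mul] at h1
  rw [mul_one] at h2
  exact h1.unique h2

end SpinSystem

namespace SpinSystem

variable {S S' T : SpinSystem} {G : Type*} [Group G]

/-! ### Stable equivalence of striped entanglers -/

theorem OnSiteSymmetry.exists_rep (β : OnSiteSymmetry G S) :
    ∃ U : ∀ j, G →* Matrix.unitaryGroup (S.idx j) ℂ, ∀ g j M,
      β.toHom g (S.site j M) = S.site j (conjMatrix (U j g) M) := β.onSite

/-- Exchange of the first two factors of a triple product. -/
def swapFirstTwo (a b c : Type*) : a × b × c ≃ b × a × c where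
  toFun x := (x.2.1, x.1, x.2.2)
  invFun x := (x.2.1, x.1, x.2.2)
  left_inv _ := rfl
  right_inv _ := rfl

theorem conjMatrix_submatrix {m n : Type*} [Fintype m] [DecidableEq m] [Fintype n] [DecidableEq n]
    (e : n ≃ m) {u : Matrix.unitaryGroup m ℂ} {v : Matrix.unitaryGroup n ℂ}
    (h : (u : Matrix m m ℂ).submatrix e e = v) (M : Matrix m m ℂ) :
    (conjMatrix u M).submatrix e e = conjMatrix v (M.submatrix e e) := by
  rw [conjMatrix, conjMatrix, ← h, Matrix.star_eq_conjTranspose, Matrix.star_eq_conjTranspose,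
    Matrix.conjTranspose_submatrix, Matrix.submatrix_mul_equiv, Matrix.submatrix_mul_equiv]

theorem relabel_equivariant (e : ∀ j, S.idx j ≃ S'.idx j) {γ : S.Aut} {γ' : S'.Aut}
    {u : ∀ j, Matrix.unitaryGroup (S.idx j) ℂ} {u' : ∀ j, Matrix.unitaryGroup (S'.idx j) ℂ}
    (hγ : ∀ j M, γ (S.site j M) = S.site j (conjMatrix (u j) M))
    (hγ' : ∀ j M, γ' (S'.site j M) = S'.site j (conjMatrix (u' j) M))
    (h : ∀ j, (u j : Matrix _ _ ℂ).submatrix (e j).symm (e j).symm = u' j) (x : S.Alg) :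
    relabel e (γ x) = γ' (relabel e x) := by
  refine congrArg (fun f : S.Alg →⋆ₐ[ℂ] S'.Alg => f x)
    (hom_ext (f := (relabel e : S.Alg →⋆ₐ[ℂ] S'.Alg).comp (γ : S.Alg →⋆ₐ[ℂ] S.Alg))
      (g := (γ' : S'.Alg →⋆ₐ[ℂ] S'.Alg).comp (relabel e : S.Alg →⋆ₐ[ℂ] S'.Alg)) fun j M => ?_)
  change relabel e (γ (S.site j M)) = γ' (relabel e (S.site j M))
  rw [hγ, relabel_site, relabel_site, hγ', conjMatrix_submatrix (e j).symm (h j)]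

theorem kronRep_swapFirstTwo {a b c : Type*} [Fintype a] [DecidableEq a] [Fintype b] [DecidableEq b]
    [Fintype c] [DecidableEq c] (U : G →* Matrix.unitaryGroup a ℂ)
    (V : G →* Matrix.unitaryGroup b ℂ) (R : G →* Matrix.unitaryGroup c ℂ) (g : G) :
    (kronRep U (kronRep V R) g : Matrix _ _ ℂ).submatrix (swapFirstTwo a b c).symm
      (swapFirstTwo a b c).symm = kronRep V (kronRep U R) g := by
  ext x y
  exact mul_left_comm _ _ _

theorem isLocal_relabel (e : ∀ j, S.idx j ≃ S'.idx j) :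
    IsLocal (relabel e : S.Alg →⋆ₐ[ℂ] S'.Alg) := fun j M => by
  change relabel e (S.site j M) ∈ _
  rw [relabel_site]
  exact site_mem_supp (Set.mem_singleton j) _

theorem isLocal_relabel_symm (e : ∀ j, S.idx j ≃ S'.idx j) :
    IsLocal ((relabel e).symm : S'.Alg →⋆ₐ[ℂ] S.Alg) := fun j M => by
  change (relabel e).symm (S'.site j M) ∈ _
  rw [relabel_symm_site]
  exact site_mem_supp (Set.mem_singleton j) _

theorem IsSymmetricCircuit.inv {β : OnSiteSymmetry G S} {γ : S.Aut}
    (h : SymmetricEntangler.IsSymmetricCircuit β γ) :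
    SymmetricEntangler.IsSymmetricCircuit β γ⁻¹ :=
  IsCircuit.inv (fun V hV g => by rw [map_star, hV g]) h

/-- Entanglers that are circuits with symmetric gates are equivalent. -/
theorem equivalent_of_isSymmetricCircuit (e : ∀ j, S.idx j ≃ S'.idx j)
    {F : SymmetricEntangler G S} {F' : SymmetricEntangler G S'}
    (he : ∀ g x, relabel e (F.β.toHom g x) = F'.β.toHom g (relabel e x))
    (hF : SymmetricEntangler.IsSymmetricCircuit F.β F.α)
    (hF' : SymmetricEntangler.IsSymmetricCircuit F'.β F'.α) : F.Equivalent F' := by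
  have he' (g : G) (x : S'.Alg) :
      F.β.toHom g ((relabel e).symm x) = (relabel e).symm (F'.β.toHom g x) := by
    rw [StarAlgEquiv.eq_symm_apply, he, StarAlgEquiv.apply_symm_apply]
  have hT : SymmetricEntangler.IsSymmetricCircuit F.β
      (((relabel e).symm.symm.trans F'.α).trans (relabel e).symm) :=
    IsCircuit.transport (P := {V | ∀ g, F'.β.toHom g V = V}) (P' := {V | ∀ g, F.β.toHom g V = V})
      (Φ := (relabel e).symm) (isLocal_relabel_symm e) (isLocal_relabel e)
      (fun V hV g => by rw [he', hV g]) hF'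
  refine ⟨relabel e, relabel_range e, he, F.α⁻¹ * (((relabel e).symm.symm.trans F'.α).trans
    (relabel e).symm), IsCircuit.mul (IsSymmetricCircuit.inv hF) hT, fun x => ?_⟩
  rw [StarAlgEquiv.mul_apply, aut_apply_inv]
  exact StarAlgEquiv.apply_symm_apply _ _

/-- The ancilla of each of the two entanglers consists of the system of the other one, which makes the
two stacks isomorphic, and of the regular representation, which provides the clock. -/
theorem stablyEquivalent_of_isStriped [Fintype G] {E : SymmetricEntangler G S}
    {E' : SymmetricEntangler G S'} (hE : E.IsStriped) (hE' : E'.IsStriped) :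
    E.StablyEquivalent E' := by
  obtain ⟨U, hU⟩ := OnSiteSymmetry.exists_rep E.β
  obtain ⟨V, hV⟩ := OnSiteSymmetry.exists_rep E'.β
  have e₀ := Fintype.equivFin G
  have : NeZero (Fintype.card G) := ⟨Fintype.card_ne_zero⟩
  obtain ⟨ρ, hρ⟩ := exists_onSiteSymmetry (S := uniform (Fintype.card G)) fun _ => regular e₀
  let c := regularClock e₀ hρ
  obtain ⟨δ, hδ⟩ := exists_stackSymmetry (T := uniform (Fintype.card G)) V fun _ => regular e₀
  obtain ⟨δ', hδ'⟩ := exists_stackSymmetry (T := uniform (Fintype.card G)) U fun _ => regular e₀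
  obtain ⟨ε, hε⟩ := exists_stackSymmetry (T := S'.stack (uniform (Fintype.card G))) U
    fun j => kronRep (V j) (regular e₀)
  obtain ⟨ε', hε'⟩ := exists_stackSymmetry (T := S.stack (uniform (Fintype.card G))) V
    fun j => kronRep (U j) (regular e₀)
  have hδt := isTensor_kron hV hρ hδ
  have hδt' := isTensor_kron hU hρ hδ'
  have hεt := isTensor_kron hU hδ hε
  have hεt' := isTensor_kron hV hδ' hε'
  obtain ⟨F, hF, rfl⟩ := exists_stack E hεt
  obtain ⟨F', hF', rfl⟩ := exists_stack E' hεt'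
  refine ⟨_, _, δ, δ', F, F', hF, hF', ?_⟩
  refine equivalent_of_isSymmetricCircuit (fun j => swapFirstTwo _ _ _) (fun g => ?_)
    (hE.isSymmetricCircuit (c.inr fun g => (hδt g).2) hεt hF.1)
    (hE'.isSymmetricCircuit (c.inr fun g => (hδt' g).2) hεt' hF'.1)
  exact relabel_equivariant _ (hε g) (hε' g) fun j => kronRep_swapFirstTwo _ _ _ _

theorem isStriped_idEntangler (β : OnSiteSymmetry G S) : β.idEntangler.IsStriped := by
  -- all intervals `[1, 0]` are empty
  refine ⟨fun _ => 1, fun _ => 0, fun _ => 1, fun _ _ _ => ?_, ⟨0, fun _ => by simp⟩,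
    ⟨0, fun _ X x hx => ?_⟩, fun _ => isCircuit_one, fun _ _ _ => rfl, fun _ _ => rfl⟩
  · simp
  · have hsub : X ⊆ fatten X 0 := fun j hj => ⟨j, hj, by simp⟩
    exact supp_mono hsub hx

end SpinSystem

end SpinSys

end

theorem lemmaC1 {G : Type*} [Group G] [Finite G] {S S' : SpinSys.SpinSystem}
    (E : SpinSys.SymmetricEntangler G S) (E' : SpinSys.SymmetricEntangler G S')
    (hE : E.IsStriped) (hE' : E'.IsStriped) :
    E.StablyEquivalent E' ∧ E.StablyEquivalent E.β.idEntangler := by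
  have := Fintype.ofFinite G
  exact ⟨SpinSys.SpinSystem.stablyEquivalent_of_isStriped hE hE',
    SpinSys.SpinSystem.stablyEquivalent_of_isStriped hE
      (SpinSys.SpinSystem.isStriped_idEntangler E.β)⟩
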